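/- **Setting.** Let $T>0$, $n,m\in\mathbb N$. Let $A:[0,T]\times\mathbb R^n\to\mathbb R^n$, $B:[0,T]\to\mathbb R^{n\times m}$, $Q:[0,T]\times\mathbb R^n\to\mathbb R$, $S:[0,T]\times\mathbb R^n\to\mathbb R^m$, $R:[0,T]\to\mathbb S^m$ (symmetric matrices), $G:\mathbb R^n\to\mathbb R$ be twice continuously differentiable (up to $t=0,T$). Subscripts $x$ denote derivatives in the state variable, $|\cdot|$ is the Euclidean norm and the induced operator norm. Assume: * $A$ is Lipschitz in $x$, uniformly in $t\in[0,T]$; * there are $\rho_0,L,q,g,\sigma>0$, $\varepsilon_0\in(0,1)$ such that for all $(t,x)$: $R(t)\ge\rho_0I$; $(1-\varepsilon_0)Q-\tfrac12S^TR^{-1}S\ge-L$; $G\ge-L$; $Q\le q(1+|x|^2)$; $G\le g(1+|x|^2)$; $|S|\le \sigma(1+|x|)$; $|A+BR^{-1}S|\le L(1+|x|)$; $|BR^{-1}B^T|\le L$. For $t\in[0,T]$, $x\in\mathbb R^n$, $u\in L^2(t,T;\mathbb R^m)$ let $X$ solve $\dot X=A(s,X)+B(s)u$ on $[t,T]$,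 $X(t)=x$, and put $$J(t,x;u)=\int_t^T\Big[Q(s,X)+\langle S(s,X),u\rangle+\tfrac12\langle R(s)u,u\rangle\Big]ds+G(X(T)),\qquad V(t,x)=\inf_{u}J(t,x;u).$$ The *optimality system* for $(t,x)$ is, on $[t,T]$, $$\dot X=A-BR^{-1}(B^TY+S),\quad \dot Y=-[A_x-BR^{-1}S_x]^TY-[Q_x-S^TR^{-1}S_x]^T,\quad X(t)=x,\ Y(T)=G_x(X(T))^T,$$ with coefficients evaluated at $(s,X(s))$. For a solution $(X,Y)$, the control $u=-R^{-1}(B^TY+S(\cdot,X))$ is called a *candidate optimal control*. For constants $\bar L_A,\bar L_B,\bar L_Q,\bar L_G\ge0$ consider the following two sets of conditions (for all $(t,x)\in[0,T]\times\mathbb R^n$). (a) $|A_x-BR^{-1}S_x|\le\bar L_A$, $|BR^{-1}B^T|\le\bar L_B$, $|Q_x-S^TR^{-1}S_x|\le Q_0+\bar L_Q|x|$, $|G_x(x)|\le|G_x(0)|+\bar L_G|x|$, $|A(t,0)-BR^{-1}S(t,0)|\le A_0$, and $$T\big[\bar L_A+\bar L_B(T\bar L_Q+\bar L_G)e^{\bar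 L_AT}\big]<1 .$$ (b) for some $L_0>0$: $[A_x-BR^{-1}S_x]+[A_x-BR^{-1}S_x]^T\le-2L_0I$, $|A_x-BR^{-1}S_x|\le\bar L_A$, $|BR^{-1}B^T|\le\bar L_B$, $|Q_x-S^TR^{-1}S_x|\le\bar L_Q|x|$, $|G_x(x)|\le\bar L_G|x|$, $A(t,0)=0$, $S(t,0)=0$, and $2L_0^2-\bar L_B^2\bar L_G^2>0$, $L_0^4-\bar L_B^2\bar L_Q^2>0$, $2(2L_0^2-\bar L_B^2\bar L_G^2)(L_0^4-\bar L_B^2\bar L_Q^2)-\bar L_B^4\bar L_Q^2\bar L_G^2>0$. **Theorem.** (i) If (a) or (b) holds, there is a constant $K_0>0$ such that for every $(t,x)\in[0,T]\times\mathbb R^n$ every solution $(X,Y)$ of the optimality system satisfies $$|Y(s)|\le K_0(1+|X(s)|),\qquad s\in[t,T]. \tag{1}$$ In case (a), $K_0$ can be chosen to depend only on $T,\bar L_A,\bar L_B,\bar L_Q,\bar L_G,A_0,Q_0,|G_x(0)|$; in case (b), only on $L_0,\bar L_A,\bar L_B,\bar L_Q,\bar L_G$ (in particular not on $T$). (ii)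 Let (a) or (b) hold, and let $K_0>0$ be any constant for which (1) holds (for instance one from (i)). Let $\bar G\in\mathbb S^n$, $\bar Q:[0,T]\to\mathbb S^n$, $\alpha\in(0,1)$, $\delta>0$ be such that $$G_{xx}(x)+\bar G\ge0,\qquad x\in\mathbb R^n,$$ $$\alpha R(s)-[\hat G(t)+\hat Q(s,t)]I\ge\delta I,\qquad 0\le t\le s\le T,$$ $$Q_{xx}+\bar Q(s)-K_0(1+|x|)\,M(s,x)\,I-\sum_{j=1}^m\big[e_j^TR^{-1}S\big]S^j_{xx}-(1-\alpha)^{-1}S_x^TR^{-1}S_x\ge0,\qquad (s,x)\in[0,T]\times\mathbb R^n .$$ Here, with $\tilde B^i$ the transposed $i$-th row of $B$, $$M(s,x)=\max_{|y|=1}\Big|\sum_{i=1}^ny^i\Big(A^i_{xx}(s,x)-\sum_{j=1}^m\big[e_j^TR(s)^{-1}\tilde B^i(s)\big]S^j_{xx}(s,x)\Big)\Big|$$ (that is, the norm of the $\mathbb R^n$-valued bilinear map $A_{xx}-BR^{-1}S_{xx}$; $M=0$ if $n=0$), and the second condition is required along every solution $(X,Y)$ of the optimality system on $[t,T]$, for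 every $(t,x)$, where $\Phi(\cdot,\cdot)$ is the fundamental matrix of $s\mapsto A_x(s,X(s))$ and $$\hat G(t)=\Big[\int_t^T\!\!\int_t^T|B(s)^T\Phi(T,s)^T\bar G\,\Phi(T,r)B(r)|^2\,dr\,ds\Big]^{1/2},\qquad \hat Q(s,t)=\int_s^T\Big[\int_t^\tau\!\!\int_t^\tau|B(r)^T\Phi(\tau,r)^T\bar Q(\tau)\Phi(\tau,r')B(r')|^2\,dr'\,dr\Big]^{1/2}d\tau,$$ the function of $\tau$ integrated in $\hat Q$ being integrable over $[t,T]$. Then, for every $(t,x)\in[0,T]\times\mathbb R^n$ and every candidate optimal control $u$ for $(t,x)$, the functional $J(t,x;\cdot)$ is twice continuously differentiable near $u$ in $L^2(t,T;\mathbb R^m)$ and $$D_{uu}J(t,x;u)\ge\delta I,$$ and the value function $V$ is differentiable on $[0,T]\times\mathbb R^n$ (jointly in $(t,x)$, relative to this set). -/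

import Mathlib

open MeasureTheory Set
open scoped RealInnerProductSpace InnerProduct

noncomputable section

namespace AQ

/-- `ℝᵏ` with the Euclidean norm. A matrix in `ℝ^{k×l}` is the linear map `Vec l →L[ℝ] Vec k`, its
transpose is the adjoint, and its norm is the operator norm. -/
abbrev Vec (k : ℕ) := EuclideanSpace ℝ (Fin k)

/-- The admissible controls on `[t,T]` with values in `ℝᵐ`: the Hilbert space `L²(t,T;ℝᵐ)`. -/
abbrev Control (m : ℕ) (t T : ℝ) := Lp (Vec m) 2 (volume.restrict (Icc t T))

/-- Coefficients of an affine-quadratic problem in which the control matrix `B` and the control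
weight `R` do not depend on the state. Only their values at times in `[0,T]` matter. -/
structure Problem (n m : ℕ) where
  A : ℝ → Vec n → Vec n
  B : ℝ → Vec m →L[ℝ] Vec n
  Q : ℝ → Vec n → ℝ
  S : ℝ → Vec n → Vec m
  R : ℝ → Vec m →L[ℝ] Vec m
  G : Vec n → ℝ

namespace Problem

variable {n m : ℕ}

/-! ### The control problem -/

/-- `X` is the state trajectory on `[t,T]` with `X(t) = x` under the control `u`:
`X' = A(s,X) + B(s)u`, in integrated form. -/
def IsTrajectory (p : Problem n m) (T t : ℝ) (x : Vec n) (u : ℝ → Vec m) (X : ℝ → Vec n) : Prop :=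
  ContinuousOn X (Icc t T) ∧
    ∀ s ∈ Icc t T, X s = x + ∫ r in t..s, (p.A r (X r) + p.B r (u r))

/-- The trajectory `X(·;t,x,u)`; on `[t,T]` it is unique when `A` is Lipschitz in the state. -/
def trajectory (p : Problem n m) (T t : ℝ) (x : Vec n) (u : ℝ → Vec m) : ℝ → Vec n :=
  Classical.epsilon (p.IsTrajectory T t x u)

/-- The cost functional `J(t,x;u)`. -/
def cost (p : Problem n m) (T t : ℝ) (x : Vec n) (u : Control m t T) : ℝ :=
  (∫ s in t..T, (p.Q s (p.trajectory T t x u s) + ⟪p.S s (p.trajectory T t x u s), u s⟫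
      + (1 / 2) * ⟪p.R s (u s), u s⟫))
    + p.G (p.trajectory T t x u T)

/-- The value function `V(t,x) = inf_u J(t,x;u)`. -/
def value (p : Problem n m) (T t : ℝ) (x : Vec n) : ℝ :=
  ⨅ u : Control m t T, p.cost T t x u

/-! ### Derivatives of the coefficients in the state variable -/

/-- `R(s)⁻¹`. -/
def Rinv (p : Problem n m) (s : ℝ) : Vec m →L[ℝ] Vec m := (p.R s).inverse

/-- `A_x(s,x)`. -/
def Ax (p : Problem n m) (s : ℝ) (x : Vec n) : Vec n →L[ℝ] Vec n := fderiv ℝ (p.A s) x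

/-- `S_x(s,x)`. -/
def Sx (p : Problem n m) (s : ℝ) (x : Vec n) : Vec n →L[ℝ] Vec m := fderiv ℝ (p.S s) x

/-- `A_xx(s,x)`, as an `ℝⁿ`-valued bilinear map. -/
def Axx (p : Problem n m) (s : ℝ) (x : Vec n) : Vec n →L[ℝ] Vec n →L[ℝ] Vec n :=
  fderiv ℝ (fderiv ℝ (p.A s)) x

/-- `S_xx(s,x)`, as an `ℝᵐ`-valued bilinear map. -/
def Sxx (p : Problem n m) (s : ℝ) (x : Vec n) : Vec n →L[ℝ] Vec n →L[ℝ] Vec m :=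
  fderiv ℝ (fderiv ℝ (p.S s)) x

/-- `Q_xx(s,x)`, as a bilinear form. -/
def Qxx (p : Problem n m) (s : ℝ) (x : Vec n) : Vec n →L[ℝ] Vec n →L[ℝ] ℝ :=
  fderiv ℝ (fderiv ℝ (p.Q s)) x

/-- `G_xx(x)`, as a bilinear form. -/
def Gxx (p : Problem n m) (x : Vec n) : Vec n →L[ℝ] Vec n →L[ℝ] ℝ :=
  fderiv ℝ (fderiv ℝ p.G) x

/-- The matrix `A_x - B R⁻¹ S_x`. -/
def driftJac (p : Problem n m) (s : ℝ) (x : Vec n) : Vec n →L[ℝ] Vec n :=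
  p.Ax s x - p.B s ∘L p.Rinv s ∘L p.Sx s x

/-- The vector `(Q_x - Sᵀ R⁻¹ S_x)ᵀ`. -/
def costGrad (p : Problem n m) (s : ℝ) (x : Vec n) : Vec n :=
  gradient (p.Q s) x - ContinuousLinearMap.adjoint (p.Sx s x) (p.Rinv s (p.S s x))

/-- The `ℝⁿ`-valued bilinear map `(ξ,η) ↦ A_xx(ξ,η) - B R⁻¹ S_xx(ξ,η)`. Its `i`-th component is
the matrix `Aⁱ_xx - ∑ⱼ (eⱼᵀ R⁻¹ B̃ⁱ) Sʲ_xx`, where `B̃ⁱ` is the `i`-th row of `B`, as a column. Its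
norm is the maximum over unit vectors `y` of the norm of `∑ᵢ yⁱ (Aⁱ_xx - ∑ⱼ (eⱼᵀ R⁻¹ B̃ⁱ) Sʲ_xx)`. -/
def driftHess (p : Problem n m) (s : ℝ) (x : Vec n) : Vec n →L[ℝ] Vec n →L[ℝ] Vec n :=
  p.Axx s x -
    (ContinuousLinearMap.compL ℝ (Vec n) (Vec m) (Vec n) (p.B s ∘L p.Rinv s)) ∘L p.Sxx s x

/-! ### Standing assumptions -/

/-- Continuity of the dynamics, and `A` Lipschitz in the state. -/
structure DynamicsHyp (p : Problem n m) (T : ℝ) : Prop where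
  contA : ContinuousOn (fun z : ℝ × Vec n => p.A z.1 z.2) (Icc 0 T ×ˢ univ)
  contB : ContinuousOn p.B (Icc 0 T)
  lipA : ∃ L > 0, ∀ t ∈ Icc 0 T, ∀ x y, ‖p.A t x - p.A t y‖ ≤ L * ‖x - y‖

/-- Continuity, growth and coercivity of the cost. -/
structure CostHyp (p : Problem n m) (T : ℝ) : Prop where
  contQ : ContinuousOn (fun z : ℝ × Vec n => p.Q z.1 z.2) (Icc 0 T ×ˢ univ)
  contS : ContinuousOn (fun z : ℝ × Vec n => p.S z.1 z.2) (Icc 0 T ×ˢ univ)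
  contR : ContinuousOn p.R (Icc 0 T)
  contG : Continuous p.G
  symmR : ∀ t ∈ Icc 0 T, IsSelfAdjoint (p.R t)
  coerciveR : ∃ ρ₀ > 0, ∀ t ∈ Icc 0 T, ∀ v, ρ₀ * ‖v‖ ^ 2 ≤ ⟪p.R t v, v⟫
  below : ∃ L > 0, ∃ ε₀ ∈ Ioo (0 : ℝ) 1, ∀ t ∈ Icc 0 T, ∀ x,
    -L ≤ (1 - ε₀) * p.Q t x - (1 / 2) * ⟪p.S t x, p.Rinv t (p.S t x)⟫ ∧ -L ≤ p.G x
  above : ∃ q > 0, ∃ g > 0, ∃ σ > 0, ∀ t ∈ Icc 0 T, ∀ x,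
    p.Q t x ≤ q * (1 + ‖x‖ ^ 2) ∧ p.G x ≤ g * (1 + ‖x‖ ^ 2) ∧ ‖p.S t x‖ ≤ σ * (1 + ‖x‖)
  growth : ∃ L > 0, ∀ t ∈ Icc 0 T, ∀ x,
    ‖p.A t x + p.B t (p.Rinv t (p.S t x))‖ ≤ L * (1 + ‖x‖) ∧
      ‖p.B t ∘L p.Rinv t ∘L ContinuousLinearMap.adjoint (p.B t)‖ ≤ L

/-- All coefficients are twice continuously differentiable, up to the ends of the time interval. -/
structure SmoothHyp (p : Problem n m) (T : ℝ) : Prop where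
  smoothA : ContDiffOn ℝ 2 (fun z : ℝ × Vec n => p.A z.1 z.2) (Icc 0 T ×ˢ univ)
  smoothB : ContDiffOn ℝ 2 p.B (Icc 0 T)
  smoothQ : ContDiffOn ℝ 2 (fun z : ℝ × Vec n => p.Q z.1 z.2) (Icc 0 T ×ˢ univ)
  smoothS : ContDiffOn ℝ 2 (fun z : ℝ × Vec n => p.S z.1 z.2) (Icc 0 T ×ˢ univ)
  smoothR : ContDiffOn ℝ 2 p.R (Icc 0 T)
  smoothG : ContDiff ℝ 2 p.G

/-! ### The optimality system -/

/-- The feedback `-R⁻¹ (Bᵀ y + S(s,x))`. -/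
def feedback (p : Problem n m) (s : ℝ) (x y : Vec n) : Vec m :=
  -p.Rinv s (ContinuousLinearMap.adjoint (p.B s) y + p.S s x)

/-- `(X,Y)` solves the two-point boundary value problem
`X' = A - B R⁻¹ (Bᵀ Y + S)`, `Y' = -(A_x - B R⁻¹ S_x)ᵀ Y - (Q_x - Sᵀ R⁻¹ S_x)ᵀ` on `[t,T]`,
`X(t) = x`, `Y(T) = G_x(X(T))ᵀ`. -/
structure IsExtremal (p : Problem n m) (T t : ℝ) (x : Vec n) (X Y : ℝ → Vec n) : Prop where
  state : ∀ s ∈ Icc t T, HasDerivWithinAt X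
    (p.A s (X s) + p.B s (p.feedback s (X s) (Y s))) (Icc t T) s
  adjoint : ∀ s ∈ Icc t T, HasDerivWithinAt Y
    (-ContinuousLinearMap.adjoint (p.driftJac s (X s)) (Y s) - p.costGrad s (X s)) (Icc t T) s
  initial : X t = x
  terminal : Y T = gradient p.G (X T)

/-- Every solution of the optimality system satisfies `|Y(s)| ≤ K₀ (1 + |X(s)|)`. -/
def AdjointBound (p : Problem n m) (T K₀ : ℝ) : Prop :=
  ∀ t ∈ Icc 0 T, ∀ x X Y, p.IsExtremal T t x X Y →
    ∀ s ∈ Icc t T, ‖Y s‖ ≤ K₀ * (1 + ‖X s‖)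

/-- First set of conditions under which the adjoint variable is bounded (short horizon); `A₀`
bounds the reduced drift at the origin. -/
structure ShortHorizon (p : Problem n m) (T LA LB LQ LG A₀ Q₀ : ℝ) : Prop where
  nonneg : 0 ≤ LA ∧ 0 ≤ LB ∧ 0 ≤ LQ ∧ 0 ≤ LG
  drift : ∀ t ∈ Icc 0 T, ∀ x, ‖p.driftJac t x‖ ≤ LA
  control : ∀ t ∈ Icc 0 T, ‖p.B t ∘L p.Rinv t ∘L ContinuousLinearMap.adjoint (p.B t)‖ ≤ LB
  running : ∀ t ∈ Icc 0 T, ∀ x, ‖p.costGrad t x‖ ≤ Q₀ + LQ * ‖x‖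
  final : ∀ x, ‖gradient p.G x‖ ≤ ‖gradient p.G 0‖ + LG * ‖x‖
  origin : ∀ t ∈ Icc 0 T, ‖p.A t 0 - p.B t (p.Rinv t (p.S t 0))‖ ≤ A₀
  small : T * (LA + LB * (T * LQ + LG) * Real.exp (LA * T)) < 1

/-- Second set of conditions under which the adjoint variable is bounded (dissipativity). -/
structure Dissipative (p : Problem n m) (T L₀ LA LB LQ LG : ℝ) : Prop where
  pos : 0 < L₀
  nonneg : 0 ≤ LA ∧ 0 ≤ LB ∧ 0 ≤ LQ ∧ 0 ≤ LG
  dissip : ∀ t ∈ Icc 0 T, ∀ x ξ,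
    ⟪(p.driftJac t x + ContinuousLinearMap.adjoint (p.driftJac t x)) ξ, ξ⟫ ≤ -2 * L₀ * ‖ξ‖ ^ 2
  drift : ∀ t ∈ Icc 0 T, ∀ x, ‖p.driftJac t x‖ ≤ LA
  control : ∀ t ∈ Icc 0 T, ‖p.B t ∘L p.Rinv t ∘L ContinuousLinearMap.adjoint (p.B t)‖ ≤ LB
  running : ∀ t ∈ Icc 0 T, ∀ x, ‖p.costGrad t x‖ ≤ LQ * ‖x‖
  final : ∀ x, ‖gradient p.G x‖ ≤ LG * ‖x‖
  origin : ∀ t ∈ Icc 0 T, p.A t 0 = 0 ∧ p.S t 0 = 0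
  small₁ : 0 < 2 * L₀ ^ 2 - LB ^ 2 * LG ^ 2
  small₂ : 0 < L₀ ^ 4 - LB ^ 2 * LQ ^ 2
  small₃ : 0 < 2 * (2 * L₀ ^ 2 - LB ^ 2 * LG ^ 2) * (L₀ ^ 4 - LB ^ 2 * LQ ^ 2)
    - LB ^ 4 * LQ ^ 2 * LG ^ 2

/-! ### Semi-convexity and positivity conditions -/

/-- `Φ` is the fundamental matrix of `s ↦ M(s)` on `[t,T]`: for each `τ ∈ [t,T]`,
`(d/ds) Φ(s,τ) = M(s) Φ(s,τ)` on `[τ,T]` and `Φ(τ,τ) = I`. -/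
def IsFundamental (M : ℝ → Vec n →L[ℝ] Vec n) (T t : ℝ) (Φ : ℝ → ℝ → Vec n →L[ℝ] Vec n) : Prop :=
  ∀ τ ∈ Icc t T, Φ τ τ = ContinuousLinearMap.id ℝ (Vec n) ∧
    ∀ s ∈ Icc τ T, HasDerivWithinAt (fun s => Φ s τ) (M s ∘L Φ s τ) (Icc τ T) s

/-- `[∫_t^τ ∫_t^τ |B(r)ᵀ Φ(τ,r)ᵀ P Φ(τ,r') B(r')|² dr' dr]^{1/2}`. -/
def gram (p : Problem n m) (t τ : ℝ) (Φ : ℝ → ℝ → Vec n →L[ℝ] Vec n)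
    (P : Vec n →L[ℝ] Vec n) : ℝ :=
  Real.sqrt (∫ r in t..τ, ∫ r' in t..τ,
    ‖ContinuousLinearMap.adjoint (p.B r) ∘L ContinuousLinearMap.adjoint (Φ τ r) ∘L P ∘L
      Φ τ r' ∘L p.B r'‖ ^ 2)

/-- `Ĝ(t)`. -/
def Ghat (p : Problem n m) (T t : ℝ) (Φ : ℝ → ℝ → Vec n →L[ℝ] Vec n)
    (Gbar : Vec n →L[ℝ] Vec n) : ℝ :=
  p.gram t T Φ Gbar

/-- `Q̂(s,t)`. -/
def Qhat (p : Problem n m) (T s t : ℝ) (Φ : ℝ → ℝ → Vec n →L[ℝ] Vec n)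
    (Qbar : ℝ → Vec n →L[ℝ] Vec n) : ℝ :=
  ∫ τ in s..T, p.gram t τ Φ (Qbar τ)

/-- `G_xx(x) + Ḡ ≥ 0` for all `x`. -/
def TerminalSemiconvex (p : Problem n m) (Gbar : Vec n →L[ℝ] Vec n) : Prop :=
  ∀ x ξ, 0 ≤ p.Gxx x ξ ξ + ⟪Gbar ξ, ξ⟫

/-- `α R(s) - [Ĝ(t) + Q̂(s,t)] I ≥ δ I` for `0 ≤ t ≤ s ≤ T`, where `Ĝ` and `Q̂` are formed with the
fundamental matrix of `A_x(·,X(·))` along every solution `(X,Y)` of the optimality system on `[t,T]`.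
That the integral in `Q̂` converges is part of the condition. -/
def ControlWeightPositive (p : Problem n m) (T α δ : ℝ) (Gbar : Vec n →L[ℝ] Vec n)
    (Qbar : ℝ → Vec n →L[ℝ] Vec n) : Prop :=
  ∀ t ∈ Icc 0 T, ∀ x X Y Φ, p.IsExtremal T t x X Y →
    IsFundamental (fun s => p.Ax s (X s)) T t Φ →
    IntervalIntegrable (fun τ => p.gram t τ Φ (Qbar τ)) volume t T ∧
    ∀ s ∈ Icc t T, ∀ v : Vec m,
      δ * ‖v‖ ^ 2 ≤ α * ⟪p.R s v, v⟫ - (p.Ghat T t Φ Gbar + p.Qhat T s t Φ Qbar) * ‖v‖ ^ 2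

/-- `Q_xx + Q̄ - K₀(1+|x|) |A_xx - B R⁻¹ S_xx| I - ∑ⱼ [eⱼᵀ R⁻¹ S] Sʲ_xx
  - (1-α)⁻¹ S_xᵀ R⁻¹ S_x ≥ 0` on `[0,T] × ℝⁿ`. -/
def RunningSemiconvex (p : Problem n m) (T K₀ α : ℝ) (Qbar : ℝ → Vec n →L[ℝ] Vec n) : Prop :=
  ∀ s ∈ Icc 0 T, ∀ x ξ,
    0 ≤ p.Qxx s x ξ ξ + ⟪Qbar s ξ, ξ⟫ - K₀ * (1 + ‖x‖) * ‖p.driftHess s x‖ * ‖ξ‖ ^ 2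
      - ⟪p.Rinv s (p.S s x), p.Sxx s x ξ ξ⟫
      - (1 - α)⁻¹ * ⟪p.Rinv s (p.Sx s x ξ), p.Sx s x ξ⟫

/-- `D_uu J(t,x;u) ≥ δ I` at every candidate optimal control `u = -R⁻¹ (Bᵀ Y + S(·,X))`, for all
initial pairs: `J(t,x;·)` is twice continuously differentiable near `u`, and the quadratic form of
its second derivative at `u` is at least `δ` times the squared `L²` norm. -/
def HessianCoercive (p : Problem n m) (T δ : ℝ) : Prop :=
  ∀ t ∈ Icc 0 T, ∀ x X Y, p.IsExtremal T t x X Y →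
    ∀ u : Control m t T,
      (∀ᵐ s ∂(volume.restrict (Icc t T)), u s = p.feedback s (X s) (Y s)) →
      ContDiffAt ℝ 2 (p.cost T t x) u ∧
        ∀ v : Control m t T, δ * ‖v‖ ^ 2 ≤ fderiv ℝ (fderiv ℝ (p.cost T t x)) u v v

end Problem

end AQ

end

noncomputable section
set_option maxSynthPendingDepth 3
set_option linter.unusedSectionVars false

namespace AQ

open Filter Topology

/-! ### Superposition operators on spaces of continuous functions -/

section Superposition

section Topological

variable {K A B : Type*} [TopologicalSpace K] [TopologicalSpace A] [TopologicalSpace B]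

/-- The superposition operator `X ↦ f(·, X(·))`. -/
def superpose (f : C(K × A, B)) (X : C(K, A)) : C(K, B) :=
  f.comp ((ContinuousMap.id K).prodMk X)

@[simp] lemma superpose_apply (f : C(K × A, B)) (X : C(K, A)) (s : K) :
    superpose f X s = f (s, X s) := rfl

lemma continuous_superpose [LocallyCompactSpace K] (f : C(K × A, B)) :
    Continuous (superpose f) := by
  refine ContinuousMap.continuous_of_continuous_uncurry _ ?_
  simp only [Function.uncurry_def, superpose_apply]
  fun_prop

lemma continuous_superpose_prodMk [LocallyCompactSpace K] {C : Type*} [TopologicalSpace C]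
    (f : C(K × (A × B), C)) (X : C(K, A)) :
    Continuous fun H : C(K, B) => superpose f (X.prodMk H) := by
  refine ContinuousMap.continuous_of_continuous_uncurry _ ?_
  simp only [Function.uncurry_def, superpose_apply, ContinuousMap.prod_eval]
  fun_prop

end Topological

variable {K E F : Type*} [TopologicalSpace K] [CompactSpace K] [LocallyCompactSpace K]
  [NormedAddCommGroup E] [NormedSpace ℝ E] [NormedAddCommGroup F] [NormedSpace ℝ F]

/-- Pointwise application of an operator-valued function. -/
def pointwiseApply : C(K, E →L[ℝ] F) →L[ℝ] C(K, E) →L[ℝ] C(K, F) :=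
  LinearMap.mkContinuous₂
    (LinearMap.mk₂ ℝ (fun (M : C(K, E →L[ℝ] F)) (X : C(K, E)) =>
        (⟨fun s => M s (X s), by fun_prop⟩ : C(K, F)))
      (fun _ _ _ => by ext; simp) (fun _ _ _ => by ext; simp)
      (fun _ _ _ => by ext; simp) (fun _ _ _ => by ext; simp)) 1
    (fun M X => by
      rw [one_mul, ContinuousMap.norm_le _ (by positivity)]
      intro s
      exact (ContinuousLinearMap.le_opNorm _ _).trans
        (by gcongr; exacts [M.norm_coe_le_norm s, X.norm_coe_le_norm s]))

@[simp] lemma pointwiseApply_apply (M : C(K, E →L[ℝ] F)) (X : C(K, E)) (s : K) :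
    pointwiseApply M X s = M s (X s) := rfl

lemma norm_pointwiseApply_le (M : C(K, E →L[ℝ] F)) (X : C(K, E)) :
    ‖pointwiseApply M X‖ ≤ ‖M‖ * ‖X‖ := by
  rw [ContinuousMap.norm_le _ (by positivity)]
  intro s
  exact (ContinuousLinearMap.le_opNorm _ _).trans
    (by gcongr; exacts [M.norm_coe_le_norm s, X.norm_coe_le_norm s])

/-- Averages `∫₀¹ w(θ) f(s, x + θ h) dθ` along segments. -/
def segmentAverage [LocallyCompactSpace E] [FirstCountableTopology K]
    (w : C(ℝ, ℝ)) (f : C(K × E, F)) : C(K × (E × E), F) :=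
  ⟨fun q => ∫ θ in (0:ℝ)..1, w θ • f (q.1, q.2.1 + θ • q.2.2), by
    apply intervalIntegral.continuous_parametric_intervalIntegral_of_continuous'
    simp only [Function.uncurry_def]
    fun_prop⟩

variable [LocallyCompactSpace E] [FirstCountableTopology K]
  [CompleteSpace F]

omit [LocallyCompactSpace E] [LocallyCompactSpace K] [FirstCountableTopology K]
  [CompleteSpace F] [CompactSpace K] in
lemma continuous_smul_segment (w : C(ℝ, ℝ)) (f : C(K × E, F)) (s : K) (x d : E) :
    Continuous fun θ : ℝ => w θ • f (s, x + θ • d) := by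
  fun_prop

lemma segmentAverage_one_apply (f : C(K × E, F)) (f' : C(K × E, E →L[ℝ] F))
    (h : ∀ s x, HasFDerivAt (fun x => f (s, x)) (f' (s, x)) x) (s : K) (x d : E) :
    segmentAverage 1 f' (s, (x, d)) d = f (s, x + d) - f (s, x) := by
  have hint : IntervalIntegrable (fun θ : ℝ => (1 : C(ℝ, ℝ)) θ • f' (s, x + θ • d)) volume 0 1 :=
    Continuous.intervalIntegrable (by fun_prop) _ _
  change (∫ θ in (0:ℝ)..1, (1 : C(ℝ, ℝ)) θ • f' (s, x + θ • d)) d = _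
  rw [ContinuousLinearMap.intervalIntegral_apply hint]
  have hd : ∀ θ ∈ uIcc (0:ℝ) 1, HasDerivAt (fun θ : ℝ => f (s, x + θ • d))
      (((1 : C(ℝ, ℝ)) θ • f' (s, x + θ • d)) d) θ := by
    intro θ _
    have h1 : HasDerivAt (fun θ : ℝ => x + θ • d) d θ := by
      simpa using ((hasDerivAt_id θ).smul_const d).const_add x
    simpa [Function.comp_def] using (h s (x + θ • d)).comp_hasDerivAt θ h1
  rw [intervalIntegral.integral_eq_sub_of_hasDerivAt hd]
  · simp
  · exact Continuous.intervalIntegrable (by fun_prop) _ _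

/-- The weight `1 - θ` of the second-order remainder. -/
def taylorWeight : C(ℝ, ℝ) := ⟨fun θ => 1 - θ, by fun_prop⟩

lemma segmentAverage_taylor_apply (f : C(K × E, F)) (f' : C(K × E, E →L[ℝ] F))
    (f'' : C(K × E, E →L[ℝ] E →L[ℝ] F))
    (h : ∀ s x, HasFDerivAt (fun x => f (s, x)) (f' (s, x)) x)
    (h' : ∀ s x, HasFDerivAt (fun x => f' (s, x)) (f'' (s, x)) x) (s : K) (x d : E) :
    segmentAverage (F := E →L[ℝ] E →L[ℝ] F) taylorWeight f'' (s, (x, d)) d d =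
      f (s, x + d) - f (s, x) - f' (s, x) d := by
  have hcont := continuous_smul_segment taylorWeight f'' s x d
  have hcont1 := hcont.clm_apply (continuous_const (y := d))
  have hcont2 := hcont1.clm_apply (continuous_const (y := d))
  change (∫ θ in (0:ℝ)..1, taylorWeight θ • f'' (s, x + θ • d)) d d = _
  rw [ContinuousLinearMap.intervalIntegral_apply (hcont.intervalIntegrable _ _),
    ContinuousLinearMap.intervalIntegral_apply (hcont1.intervalIntegrable _ _)]
  have h1 : ∀ θ : ℝ, HasDerivAt (fun θ : ℝ => x + θ • d) d θ := fun θ => by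
    simpa using ((hasDerivAt_id θ).smul_const d).const_add x
  have hd : ∀ θ ∈ uIcc (0:ℝ) 1, HasDerivAt
      (fun θ : ℝ => f (s, x + θ • d) + (1 - θ) • (f' (s, x + θ • d) d))
      ((taylorWeight θ • f'' (s, x + θ • d)) d d) θ := by
    intro θ _
    have h2 := (h s (x + θ • d)).comp_hasDerivAt θ (h1 θ)
    have h30 := h' s (x + θ • d)
    have h31 := h30.comp_hasDerivAt θ (h1 θ)
    have h3 := h31.clm_apply (hasDerivAt_const θ d)
    have h4 := ((hasDerivAt_id θ).const_sub 1).smul h3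
    have h5 := h2.add h4
    refine h5.congr_deriv ?_
    change f' (s, x + θ • d) d + ((1 - θ) • (f'' (s, x + θ • d) d d + f' (s, x + θ • d) 0) +
      (-1 : ℝ) • f' (s, x + θ • d) d) = (1 - θ) • f'' (s, x + θ • d) d d
    rw [map_zero, add_zero, neg_one_smul]
    abel
  rw [intervalIntegral.integral_eq_sub_of_hasDerivAt hd (hcont2.intervalIntegrable _ _)]
  simp [sub_sub]

lemma hasFDerivAt_superpose (f : C(K × E, F)) (f' : C(K × E, E →L[ℝ] F))
    (h : ∀ s x, HasFDerivAt (fun x => f (s, x)) (f' (s, x)) x) (X : C(K, E)) :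
    HasFDerivAt (superpose f) (pointwiseApply (superpose f' X)) X := by
  rw [hasFDerivAt_iff_isLittleO_nhds_zero, Asymptotics.isLittleO_iff]
  intro ε hε
  have hcont : Continuous fun H : C(K, E) => superpose (segmentAverage (F := E →L[ℝ] F) 1 f') (X.prodMk H) :=
    continuous_superpose_prodMk _ X
  have h0 : superpose (segmentAverage (F := E →L[ℝ] F) 1 f') (X.prodMk 0) = superpose f' X := by
    ext1 s
    change (∫ θ in (0:ℝ)..1, (1 : C(ℝ, ℝ)) θ • f' (s, X s + θ • (0 : E))) = f' (s, X s)
    simp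
  have hev := Metric.tendsto_nhds.1 (hcont.tendsto 0) ε hε
  filter_upwards [hev] with H hH
  have hid : superpose f (X + H) - superpose f X - pointwiseApply (superpose f' X) H =
      pointwiseApply (superpose (segmentAverage (F := E →L[ℝ] F) 1 f') (X.prodMk H) -
        superpose (segmentAverage (F := E →L[ℝ] F) 1 f') (X.prodMk 0)) H := by
    rw [h0]
    ext1 s
    have := segmentAverage_one_apply f f' h s (X s) (H s)
    simp only [ContinuousMap.sub_apply, superpose_apply, ContinuousMap.add_apply,
      pointwiseApply_apply, ContinuousMap.prod_eval, sub_apply, this]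
  rw [hid]
  refine (norm_pointwiseApply_le _ _).trans ?_
  rw [dist_eq_norm] at hH
  gcongr

lemma contDiff_one_superpose (f : C(K × E, F)) (f' : C(K × E, E →L[ℝ] F))
    (h : ∀ s x, HasFDerivAt (fun x => f (s, x)) (f' (s, x)) x) :
    ContDiff ℝ 1 (superpose f) := by
  have hf : fderiv ℝ (superpose f) = fun X => pointwiseApply (superpose f' X) :=
    funext fun X => (hasFDerivAt_superpose f f' h X).fderiv
  refine contDiff_one_iff_fderiv.2 ⟨fun X => (hasFDerivAt_superpose f f' h X).differentiableAt, ?_⟩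
  rw [hf]
  exact pointwiseApply.continuous.comp (continuous_superpose f')

lemma contDiff_two_superpose [CompleteSpace (E →L[ℝ] F)] (f : C(K × E, F))
    (f' : C(K × E, E →L[ℝ] F))
    (f'' : C(K × E, E →L[ℝ] E →L[ℝ] F))
    (h : ∀ s x, HasFDerivAt (fun x => f (s, x)) (f' (s, x)) x)
    (h' : ∀ s x, HasFDerivAt (fun x => f' (s, x)) (f'' (s, x)) x) :
    ContDiff ℝ 2 (superpose f) := by
  have hf : fderiv ℝ (superpose f) = fun X => pointwiseApply (superpose f' X) :=
    funext fun X => (hasFDerivAt_superpose f f' h X).fderiv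
  rw [show (2 : WithTop ℕ∞) = 1 + 1 from by norm_num, contDiff_succ_iff_fderiv]
  refine ⟨fun X => (hasFDerivAt_superpose f f' h X).differentiableAt, by simp, ?_⟩
  rw [hf]
  exact pointwiseApply.contDiff.comp (contDiff_one_superpose f' f'' h')

end Superposition

end AQ

namespace AQ

open Filter Topology

/-! ### Volterra equations on spaces of continuous functions -/

section Volterra

variable {a b : ℝ} {E : Type*} [NormedAddCommGroup E] [NormedSpace ℝ E]

/-- The primitive `s ↦ ∫_c^s X` of a continuous function on `[a,b]`. -/
def primitive (hab : a ≤ b) (c : Icc a b) (X : C(Icc a b, E)) : C(Icc a b, E) :=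
  ⟨fun s => ∫ r in (c:ℝ)..s, IccExtend hab X r, by
    have h : Continuous fun s : ℝ => ∫ r in (c:ℝ)..s, IccExtend hab X r :=
      intervalIntegral.continuous_primitive
        (fun _ _ => (X.continuous.Icc_extend' (h := hab)).intervalIntegrable _ _) _
    exact h.comp continuous_subtype_val⟩

lemma intervalIntegrable_IccExtend (hab : a ≤ b) (X : C(Icc a b, E)) (s t : ℝ) :
    IntervalIntegrable (IccExtend hab X) volume s t :=
  (X.continuous.Icc_extend' (h := hab)).intervalIntegrable _ _

lemma primitive_apply (hab : a ≤ b) (c : Icc a b) (X : C(Icc a b, E)) (s : Icc a b) :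
    primitive hab c X s = ∫ r in (c:ℝ)..s, IccExtend hab X r := rfl

lemma norm_IccExtend_le (hab : a ≤ b) (X : C(Icc a b, E)) (r : ℝ) :
    ‖IccExtend hab X r‖ ≤ ‖X‖ := X.norm_coe_le_norm _

/-- The Volterra operator `X ↦ (s ↦ ∫_c^s X)`. -/
def volterra (hab : a ≤ b) (c : Icc a b) : C(Icc a b, E) →L[ℝ] C(Icc a b, E) :=
  LinearMap.mkContinuous
    { toFun := primitive hab c
      map_add' := fun X Y => by
        ext s
        simp only [primitive_apply, ContinuousMap.add_apply]
        rw [← intervalIntegral.integral_add (intervalIntegrable_IccExtend hab X _ _)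
          (intervalIntegrable_IccExtend hab Y _ _)]
        rfl
      map_smul' := fun r X => by
        ext s
        simp only [primitive_apply, ContinuousMap.smul_apply, RingHom.id_apply]
        rw [← intervalIntegral.integral_smul]
        rfl } (b - a)
    (fun X => by
      have h0 : 0 ≤ b - a := sub_nonneg.2 hab
      rw [ContinuousMap.norm_le _ (by positivity)]
      intro s
      have h1 := intervalIntegral.norm_integral_le_of_norm_le_const (a := (c:ℝ)) (b := (s:ℝ))
        (C := ‖X‖) (f := IccExtend hab X) (fun r _ => norm_IccExtend_le hab X r)
      refine h1.trans ?_
      rw [mul_comm]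
      gcongr
      rw [abs_le]
      constructor <;> linarith [s.2.1, s.2.2, c.2.1, c.2.2])

@[simp] lemma volterra_apply (hab : a ≤ b) (c : Icc a b) (X : C(Icc a b, E)) (s : Icc a b) :
    volterra hab c X s = ∫ r in (c:ℝ)..s, IccExtend hab X r := rfl

/-- The map `X ↦ X - ∫_c f(r, X(r)) dr`, whose inverse solves `X' = f(r, X)` with forcing. -/
def volterraMap (hab : a ≤ b) (c : Icc a b) (f : C(Icc a b × E, E)) (X : C(Icc a b, E)) :
    C(Icc a b, E) := X - volterra hab c (superpose f X)

lemma norm_iterate_sub_le (hab : a ≤ b) (c : Icc a b) (f : C(Icc a b × E, E)) {L : ℝ}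
    (hL : 0 ≤ L) (hf : ∀ s x y, ‖f (s, x) - f (s, y)‖ ≤ L * ‖x - y‖) (w : C(Icc a b, E))
    (X Y : C(Icc a b, E)) (n : ℕ) (s : Icc a b) :
    ‖(fun X => w + volterra hab c (superpose f X))^[n] X s -
      (fun X => w + volterra hab c (superpose f X))^[n] Y s‖ ≤
        (L * |(s:ℝ) - c|) ^ n / n.factorial * ‖X - Y‖ := by
  induction n generalizing s with
  | zero => simpa using (X - Y).norm_coe_le_norm s
  | succ n hn =>
    rw [Function.iterate_succ_apply', Function.iterate_succ_apply']
    set X' := (fun X => w + volterra hab c (superpose f X))^[n] X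
    set Y' := (fun X => w + volterra hab c (superpose f X))^[n] Y
    simp only [ContinuousMap.add_apply, volterra_apply, add_sub_add_left_eq_sub]
    rw [← intervalIntegral.integral_sub (intervalIntegrable_IccExtend hab _ _ _)
      (intervalIntegrable_IccExtend hab _ _ _)]
    calc
      _ ≤ ∫ r in uIoc (c:ℝ) s, L ^ (n + 1) * |r - c| ^ n / n.factorial * ‖X - Y‖ := by
        rw [intervalIntegral.norm_intervalIntegral_eq]
        apply MeasureTheory.norm_integral_le_of_norm_le (Continuous.integrableOn_uIoc (by fun_prop))
        apply (ae_restrict_mem measurableSet_uIoc).mono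
        intro r hr
        have hr' : r ∈ Icc a b := (uIoc_subset_uIcc.trans (uIcc_subset_Icc c.2 s.2)) hr
        rw [IccExtend_of_mem _ _ hr', IccExtend_of_mem _ _ hr']
        simp only [superpose_apply]
        refine (hf _ _ _).trans ?_
        have h1 := hn ⟨r, hr'⟩
        calc L * ‖X' ⟨r, hr'⟩ - Y' ⟨r, hr'⟩‖
            ≤ L * ((L * |r - c|) ^ n / n.factorial * ‖X - Y‖) := by gcongr
          _ = _ := by rw [mul_pow]; ring
      _ ≤ (L * |(s:ℝ) - c|) ^ (n + 1) / (n + 1).factorial * ‖X - Y‖ := by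
        apply le_of_abs_le
        rw [← intervalIntegral.abs_intervalIntegral_eq, intervalIntegral.integral_mul_const,
          intervalIntegral.integral_div, intervalIntegral.integral_const_mul, abs_mul, abs_div,
          abs_mul, intervalIntegral.abs_intervalIntegral_eq, integral_pow_abs_sub_uIoc, abs_div,
          abs_pow, abs_pow, abs_norm, abs_of_nonneg hL, abs_abs, mul_div, div_div, ← abs_mul,
          ← Nat.cast_succ, ← Nat.cast_mul, ← Nat.factorial_succ, Nat.abs_cast, ← mul_pow]

lemma exists_contracting_iterate (hab : a ≤ b) (c : Icc a b) (f : C(Icc a b × E, E)) {L : ℝ}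
    (hL : 0 ≤ L) (hf : ∀ s x y, ‖f (s, x) - f (s, y)‖ ≤ L * ‖x - y‖) (w : C(Icc a b, E)) :
    ∃ (n : ℕ) (C : NNReal), ContractingWith C
      (fun X => w + volterra hab c (superpose f X))^[n] := by
  obtain ⟨n, hn⟩ := FloorSemiring.tendsto_pow_div_factorial_atTop (L * (b - a))
    |>.eventually (gt_mem_nhds zero_lt_one) |>.exists
  have h0 : 0 ≤ b - a := sub_nonneg.2 hab
  have h1 : (0 : ℝ) ≤ (L * (b - a)) ^ n / n.factorial := by positivity
  refine ⟨n, ⟨_, h1⟩, hn, LipschitzWith.of_dist_le_mul fun X Y => ?_⟩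
  rw [dist_eq_norm, dist_eq_norm, ContinuousMap.norm_le _ (by positivity)]
  intro s
  refine (norm_iterate_sub_le hab c f hL hf w X Y n s).trans ?_
  change _ ≤ (L * (b - a)) ^ n / n.factorial * ‖X - Y‖
  gcongr
  rw [abs_le]
  constructor <;> linarith [s.2.1, s.2.2, c.2.1, c.2.2]

lemma volterraMap_bijective [CompleteSpace E] (hab : a ≤ b) (c : Icc a b) (f : C(Icc a b × E, E))
    {L : ℝ} (hL : 0 ≤ L) (hf : ∀ s x y, ‖f (s, x) - f (s, y)‖ ≤ L * ‖x - y‖) :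
    Function.Bijective (volterraMap hab c f) := by
  have key : ∀ w X, volterraMap hab c f X = w ↔
      Function.IsFixedPt (fun X => w + volterra hab c (superpose f X)) X := by
    intro w X
    rw [volterraMap, Function.IsFixedPt, sub_eq_iff_eq_add]
    exact eq_comm
  constructor
  · intro X Y hXY
    obtain ⟨n, C, hC⟩ := exists_contracting_iterate hab c f hL hf (volterraMap hab c f Y)
    exact hC.fixedPoint_unique' (((key _ _).1 hXY).iterate n) (((key _ _).1 rfl).iterate n)
  · intro w
    obtain ⟨n, C, hC⟩ := exists_contracting_iterate hab c f hL hf w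
    exact ⟨_, (key _ _).2 hC.isFixedPt_fixedPoint_iterate⟩

/-- The inverse of `volterraMap`. -/
def volterraSol (hab : a ≤ b) (c : Icc a b) (f : C(Icc a b × E, E)) :
    C(Icc a b, E) → C(Icc a b, E) := Function.invFun (volterraMap hab c f)

variable [CompleteSpace E]

section

variable (hab : a ≤ b) (c : Icc a b) (f : C(Icc a b × E, E)) {L : ℝ} (hL : 0 ≤ L)
  (hf : ∀ s x y, ‖f (s, x) - f (s, y)‖ ≤ L * ‖x - y‖)

include hL hf in
lemma volterraMap_volterraSol (w : C(Icc a b, E)) :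
    volterraMap hab c f (volterraSol hab c f w) = w :=
  Function.rightInverse_invFun (volterraMap_bijective hab c f hL hf).2 w

include hL hf in
lemma volterraSol_volterraMap (X : C(Icc a b, E)) :
    volterraSol hab c f (volterraMap hab c f X) = X :=
  Function.leftInverse_invFun (volterraMap_bijective hab c f hL hf).1 X

include hL hf in
lemma volterraSol_spec (w : C(Icc a b, E)) (s : Icc a b) :
    volterraSol hab c f w s =
      w s + ∫ r in (c:ℝ)..s, IccExtend hab (superpose f (volterraSol hab c f w)) r := by
  have h := volterraMap_volterraSol hab c f hL hf w
  rw [volterraMap, sub_eq_iff_eq_add] at h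
  have := congrArg (fun X : C(Icc a b, E) => X s) h
  simpa using this

end

/-- The linear map `H ↦ H - ∫_c M H`. -/
def linVolterra (hab : a ≤ b) (c : Icc a b) (M : C(Icc a b, E →L[ℝ] E)) :
    C(Icc a b, E) →L[ℝ] C(Icc a b, E) :=
  ContinuousLinearMap.id ℝ _ - volterra hab c ∘L pointwiseApply M

lemma linVolterra_bijective (hab : a ≤ b) (c : Icc a b) (M : C(Icc a b, E →L[ℝ] E)) :
    Function.Bijective (linVolterra hab c M) := by
  let g : C(Icc a b × E, E) := ⟨fun q => M q.1 q.2,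
    (M.continuous.comp continuous_fst).clm_apply continuous_snd⟩
  have h := volterraMap_bijective hab c g (norm_nonneg M) (fun s x y => by
    change ‖M s x - M s y‖ ≤ _
    rw [← map_sub]
    exact (M s).le_of_opNorm_le (M.norm_coe_le_norm s) _)
  exact h

/-- The equivalence `H ↦ H - ∫_c M H`. -/
def linVolterraEquiv (hab : a ≤ b) (c : Icc a b) (M : C(Icc a b, E →L[ℝ] E)) :
    C(Icc a b, E) ≃L[ℝ] C(Icc a b, E) :=
  ContinuousLinearEquiv.ofBijective (linVolterra hab c M)
    (LinearMap.ker_eq_bot.2 (linVolterra_bijective hab c M).1)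
    (LinearMap.range_eq_top.2 (linVolterra_bijective hab c M).2)

lemma coe_linVolterraEquiv (hab : a ≤ b) (c : Icc a b) (M : C(Icc a b, E →L[ℝ] E)) :
    (linVolterraEquiv hab c M : C(Icc a b, E) →L[ℝ] C(Icc a b, E)) = linVolterra hab c M := by
  ext1 X
  rfl

variable [LocallyCompactSpace E]

section

variable (hab : a ≤ b) (c : Icc a b) (f : C(Icc a b × E, E)) (f' : C(Icc a b × E, E →L[ℝ] E))
  {L : ℝ} (hL : 0 ≤ L) (hf : ∀ s x y, ‖f (s, x) - f (s, y)‖ ≤ L * ‖x - y‖)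
  (h : ∀ s x, HasFDerivAt (fun x => f (s, x)) (f' (s, x)) x)

include h in
lemma hasFDerivAt_volterraMap (X : C(Icc a b, E)) :
    HasFDerivAt (volterraMap hab c f) (linVolterra hab c (superpose f' X)) X := by
  have h1 := (volterra (E := E) hab c).hasFDerivAt.comp X (hasFDerivAt_superpose f f' h X)
  exact (hasFDerivAt_id X).sub h1

include hL hf h in
lemma contDiff_volterraSol {n : WithTop ℕ∞} (hn : 1 ≤ n) (hfn : ContDiff ℝ n (superpose f)) :
    ContDiff ℝ n (volterraSol hab c f) := by
  have hcd : ContDiff ℝ n (volterraMap hab c f) :=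
    contDiff_id.sub ((volterra (E := E) hab c).contDiff.comp hfn)
  have hd : ∀ X, HasFDerivAt (volterraMap hab c f)
      (linVolterraEquiv hab c (superpose f' X) : C(Icc a b, E) →L[ℝ] C(Icc a b, E)) X := by
    intro X
    rw [coe_linVolterraEquiv]
    exact hasFDerivAt_volterraMap hab c f f' h X
  have hs : ∀ X, HasStrictFDerivAt (volterraMap hab c f)
      (linVolterraEquiv hab c (superpose f' X) : C(Icc a b, E) →L[ℝ] C(Icc a b, E)) X := by
    intro X
    exact hcd.contDiffAt.hasStrictFDerivAt' (hd X) (by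
      rintro rfl; simp at hn)
  let e : C(Icc a b, E) ≃ₜ C(Icc a b, E) :=
    (Equiv.ofBijective _ (volterraMap_bijective hab c f hL hf)).toHomeomorphOfContinuousOpen
      hcd.continuous (isOpenMap_of_hasStrictFDerivAt_equiv hs)
  have he : (e.symm : C(Icc a b, E) → C(Icc a b, E)) = volterraSol hab c f := by
    funext w
    apply (volterraMap_bijective hab c f hL hf).1
    rw [volterraMap_volterraSol hab c f hL hf]
    exact e.apply_symm_apply w
  rw [← he]
  exact e.contDiff_symm (f₀' := fun X => linVolterraEquiv hab c (superpose f' X)) hd hcd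

include hL hf h in
lemma linVolterra_fderiv_volterraSol (w k : C(Icc a b, E)) :
    linVolterra hab c (superpose f' (volterraSol hab c f w))
      (fderiv ℝ (volterraSol hab c f) w k) = k := by
  have hd : DifferentiableAt ℝ (volterraSol hab c f) w :=
    (contDiff_volterraSol hab c f f' hL hf h le_rfl
      (contDiff_one_superpose f f' h)).differentiable (by simp) w
  have h1 := (hasFDerivAt_volterraMap hab c f f' h (volterraSol hab c f w)).comp w hd.hasFDerivAt
  have h2 : volterraMap hab c f ∘ volterraSol hab c f = id :=
    funext fun w => volterraMap_volterraSol hab c f hL hf w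
  rw [h2] at h1
  have h3 := h1.unique (hasFDerivAt_id w)
  exact congrArg (fun T : C(Icc a b, E) →L[ℝ] C(Icc a b, E) => T k) h3

include hL hf h in
lemma fderiv_volterraSol_spec (w k : C(Icc a b, E)) (s : Icc a b) :
    fderiv ℝ (volterraSol hab c f) w k s = k s + ∫ r in (c:ℝ)..s,
      IccExtend hab (pointwiseApply (superpose f' (volterraSol hab c f w))
        (fderiv ℝ (volterraSol hab c f) w k)) r := by
  have h1 := linVolterra_fderiv_volterraSol hab c f f' hL hf h w k
  have h2 := congrArg (fun X : C(Icc a b, E) => X s) h1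
  simp only [linVolterra, sub_apply, ContinuousMap.sub_apply,
    ContinuousLinearMap.comp_apply, ContinuousLinearMap.id_apply, volterra_apply] at h2
  rw [sub_eq_iff_eq_add] at h2
  exact h2

end

end Volterra

end AQ

namespace AQ

open Filter Topology

/-! ### Regularity of time slices -/

section Slices

variable {E F : Type*} [NormedAddCommGroup E] [NormedSpace ℝ E] [NormedAddCommGroup F]
  [NormedSpace ℝ F] {T : ℝ} {f : ℝ → E → F}

lemma uniqueDiffOn_slab (hT : 0 < T) : UniqueDiffOn ℝ (Icc 0 T ×ˢ (univ : Set E)) :=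
  (uniqueDiffOn_Icc hT).prod uniqueDiffOn_univ

lemma hasFDerivAt_slice_of_contDiffOn
    (hf : ContDiffOn ℝ 1 (fun z : ℝ × E => f z.1 z.2) (Icc 0 T ×ˢ univ)) {s : ℝ}
    (hs : s ∈ Icc 0 T) (x : E) :
    HasFDerivAt (f s) (fderivWithin ℝ (fun z : ℝ × E => f z.1 z.2) (Icc 0 T ×ˢ univ) (s, x) ∘L
      ContinuousLinearMap.inr ℝ ℝ E) x := by
  have h1 : HasFDerivWithinAt (fun z : ℝ × E => f z.1 z.2)
      (fderivWithin ℝ (fun z : ℝ × E => f z.1 z.2) (Icc 0 T ×ˢ univ) (s, x))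
      (Icc 0 T ×ˢ univ) (s, x) :=
    ((hf.differentiableOn (by simp)) (s, x) ⟨hs, mem_univ _⟩).hasFDerivWithinAt
  have h2 : HasFDerivWithinAt (fun y : E => (s, y)) (ContinuousLinearMap.inr ℝ ℝ E) univ x :=
    (hasFDerivAt_prodMk_right s x).hasFDerivWithinAt
  have h3 := h1.comp x h2 (fun y _ => ⟨hs, mem_univ _⟩)
  exact hasFDerivWithinAt_univ.1 h3

lemma hasFDerivAt_slice (hf : ContDiffOn ℝ 1 (fun z : ℝ × E => f z.1 z.2) (Icc 0 T ×ˢ univ))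
    {s : ℝ} (hs : s ∈ Icc 0 T) (x : E) : HasFDerivAt (f s) (fderiv ℝ (f s) x) x :=
  (hasFDerivAt_slice_of_contDiffOn hf hs x).differentiableAt.hasFDerivAt

lemma contDiffOn_fderiv_slice (hT : 0 < T) {k n : WithTop ℕ∞} (hkn : k + 1 ≤ n)
    (hf : ContDiffOn ℝ n (fun z : ℝ × E => f z.1 z.2) (Icc 0 T ×ˢ univ)) :
    ContDiffOn ℝ k (fun z : ℝ × E => fderiv ℝ (f z.1) z.2) (Icc 0 T ×ˢ univ) := by
  have h1 := hf.fderivWithin (uniqueDiffOn_slab hT) hkn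
  have h2 : ContDiffOn ℝ k (fun z : ℝ × E =>
      fderivWithin ℝ (fun z : ℝ × E => f z.1 z.2) (Icc 0 T ×ˢ univ) z ∘L
        ContinuousLinearMap.inr ℝ ℝ E) (Icc 0 T ×ˢ univ) :=
    h1.clm_comp contDiffOn_const
  refine h2.congr fun z hz => ?_
  exact (hasFDerivAt_slice_of_contDiffOn
    (hf.of_le (le_trans (by simp) hkn)) hz.1 z.2).fderiv

end Slices

/-! ### Extension of coefficients to all times -/

/-- The projection of time to `[0,T]`. -/
def clamp (T s : ℝ) : ℝ := max 0 (min s T)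

lemma clamp_mem {T : ℝ} (hT : 0 < T) (s : ℝ) : clamp T s ∈ Icc 0 T :=
  ⟨le_max_left _ _, max_le hT.le (min_le_right _ _)⟩

lemma clamp_eq {T s : ℝ} (hs : s ∈ Icc 0 T) : clamp T s = s := by
  rw [clamp, min_eq_left hs.2, max_eq_right hs.1]

@[fun_prop]
lemma continuous_clamp (T : ℝ) : Continuous (clamp T) := by
  unfold clamp; fun_prop

lemma continuous_clamp_comp {E F : Type*} [TopologicalSpace E] [TopologicalSpace F] {T : ℝ}
    (hT : 0 < T) {f : ℝ → E → F}
    (hf : ContinuousOn (fun z : ℝ × E => f z.1 z.2) (Icc 0 T ×ˢ univ)) :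
    Continuous fun z : ℝ × E => f (clamp T z.1) z.2 := by
  have h : Continuous fun z : ℝ × E => (clamp T z.1, z.2) := by fun_prop
  exact hf.comp_continuous h fun z => ⟨clamp_mem hT _, mem_univ _⟩

/-- A coefficient, as a continuous function on `K × E` for a time interval `K`. -/
def coeff {E F : Type*} [TopologicalSpace E] [TopologicalSpace F] {T : ℝ}
    (hT : 0 < T) (K : Set ℝ) (f : ℝ → E → F)
    (hf : ContinuousOn (fun z : ℝ × E => f z.1 z.2) (Icc 0 T ×ˢ univ)) : C(K × E, F) :=
  ⟨fun q => f (clamp T q.1) q.2, by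
    have h : Continuous fun q : K × E => ((q.1 : ℝ), q.2) := by fun_prop
    exact (continuous_clamp_comp hT hf).comp h⟩

@[simp] lemma coeff_apply {E F : Type*} [TopologicalSpace E] [TopologicalSpace F] {T : ℝ}
    (hT : 0 < T) (K : Set ℝ) (f : ℝ → E → F)
    (hf : ContinuousOn (fun z : ℝ × E => f z.1 z.2) (Icc 0 T ×ˢ univ)) (q : K × E) :
    coeff hT K f hf q = f (clamp T q.1) q.2 := rfl

namespace Problem

variable {n m : ℕ} {p : Problem n m} {T : ℝ}

/-! ### The control weight -/

lemma isInvertible_R (hC : p.CostHyp T) {s : ℝ} (hs : s ∈ Icc 0 T) : (p.R s).IsInvertible := by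
  obtain ⟨ρ, hρ, h⟩ := hC.coerciveR
  have hinj : Function.Injective (p.R s : Vec m →ₗ[ℝ] Vec m) := by
    rw [← LinearMap.ker_eq_bot, LinearMap.ker_eq_bot']
    intro v hv
    have h1 := h s hs v
    have h2 : p.R s v = 0 := hv
    rw [h2, inner_zero_left] at h1
    have h3 : ‖v‖ ^ 2 ≤ 0 := by nlinarith [sq_nonneg ‖v‖]
    have h4 : ‖v‖ = 0 := by nlinarith [norm_nonneg v]
    exact norm_eq_zero.1 h4
  refine ⟨(LinearEquiv.ofInjectiveEndo _ hinj).toContinuousLinearEquiv, ?_⟩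
  ext1 v
  rfl

lemma R_Rinv (hC : p.CostHyp T) {s : ℝ} (hs : s ∈ Icc 0 T) (v : Vec m) :
    p.R s (p.Rinv s v) = v := by
  obtain ⟨e, he⟩ := isInvertible_R hC hs
  rw [Rinv, ← he, ContinuousLinearMap.inverse_equiv]
  exact e.apply_symm_apply v

lemma inner_R_comm (hC : p.CostHyp T) {s : ℝ} (hs : s ∈ Icc 0 T) (v w : Vec m) :
    ⟪p.R s v, w⟫ = ⟪v, p.R s w⟫ :=
  (ContinuousLinearMap.isSelfAdjoint_iff_isSymmetric.1 (hC.symmR s hs)) v w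

lemma inner_Rinv_comm (hC : p.CostHyp T) {s : ℝ} (hs : s ∈ Icc 0 T) (v w : Vec m) :
    ⟪p.Rinv s v, w⟫ = ⟪v, p.Rinv s w⟫ := by
  conv_lhs => rw [← R_Rinv hC hs w]
  conv_rhs => rw [← R_Rinv hC hs v]
  rw [inner_R_comm hC hs]

lemma inner_R_nonneg (hC : p.CostHyp T) {s : ℝ} (hs : s ∈ Icc 0 T) (v : Vec m) :
    0 ≤ ⟪p.R s v, v⟫ := by
  obtain ⟨ρ, hρ, h⟩ := hC.coerciveR
  exact le_trans (by positivity) (h s hs v)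

lemma contDiffOn_Rinv (hC : p.CostHyp T) (hS : p.SmoothHyp T) :
    ContDiffOn ℝ 2 p.Rinv (Icc 0 T) := by
  intro s hs
  obtain ⟨e, he⟩ := isInvertible_R hC hs
  have h1 : ContDiffAt ℝ 2 ContinuousLinearMap.inverse (p.R s) := by
    rw [← he]; exact contDiffAt_map_inverse e
  exact h1.comp_contDiffWithinAt s (hS.smoothR s hs)

/-! ### Regularity of the coefficients -/

section

variable (hT : 0 < T) (hS : p.SmoothHyp T)

include hT hS

lemma contDiffOn_Ax : ContDiffOn ℝ 1 (fun z : ℝ × Vec n => p.Ax z.1 z.2) (Icc 0 T ×ˢ univ) :=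
  contDiffOn_fderiv_slice hT (by norm_num) hS.smoothA

lemma contDiffOn_Sx : ContDiffOn ℝ 1 (fun z : ℝ × Vec n => p.Sx z.1 z.2) (Icc 0 T ×ˢ univ) :=
  contDiffOn_fderiv_slice hT (by norm_num) hS.smoothS

lemma contDiffOn_fderiv_Q :
    ContDiffOn ℝ 1 (fun z : ℝ × Vec n => fderiv ℝ (p.Q z.1) z.2) (Icc 0 T ×ˢ univ) :=
  contDiffOn_fderiv_slice hT (by norm_num) hS.smoothQ

lemma continuousOn_Axx :
    ContinuousOn (fun z : ℝ × Vec n => p.Axx z.1 z.2) (Icc 0 T ×ˢ univ) :=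
  (contDiffOn_fderiv_slice (k := 0) (f := p.Ax) hT (by norm_num)
    (contDiffOn_Ax hT hS)).continuousOn

lemma continuousOn_Sxx :
    ContinuousOn (fun z : ℝ × Vec n => p.Sxx z.1 z.2) (Icc 0 T ×ˢ univ) :=
  (contDiffOn_fderiv_slice (k := 0) (f := p.Sx) hT (by norm_num)
    (contDiffOn_Sx hT hS)).continuousOn

lemma continuousOn_Qxx :
    ContinuousOn (fun z : ℝ × Vec n => p.Qxx z.1 z.2) (Icc 0 T ×ˢ univ) :=
  (contDiffOn_fderiv_slice (k := 0) (f := fun s => fderiv ℝ (p.Q s)) hT (by norm_num)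
    (contDiffOn_fderiv_Q hT hS)).continuousOn

omit hT in
lemma hasFDerivAt_A {s : ℝ} (hs : s ∈ Icc 0 T) (x : Vec n) :
    HasFDerivAt (p.A s) (p.Ax s x) x :=
  hasFDerivAt_slice (hS.smoothA.of_le (by norm_num)) hs x

omit hT in
lemma hasFDerivAt_S {s : ℝ} (hs : s ∈ Icc 0 T) (x : Vec n) :
    HasFDerivAt (p.S s) (p.Sx s x) x :=
  hasFDerivAt_slice (hS.smoothS.of_le (by norm_num)) hs x

omit hT in
lemma hasFDerivAt_Q {s : ℝ} (hs : s ∈ Icc 0 T) (x : Vec n) :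
    HasFDerivAt (p.Q s) (fderiv ℝ (p.Q s) x) x :=
  hasFDerivAt_slice (hS.smoothQ.of_le (by norm_num)) hs x

lemma hasFDerivAt_Ax {s : ℝ} (hs : s ∈ Icc 0 T) (x : Vec n) :
    HasFDerivAt (p.Ax s) (p.Axx s x) x :=
  hasFDerivAt_slice (contDiffOn_Ax hT hS) hs x

lemma hasFDerivAt_Sx {s : ℝ} (hs : s ∈ Icc 0 T) (x : Vec n) :
    HasFDerivAt (p.Sx s) (p.Sxx s x) x :=
  hasFDerivAt_slice (contDiffOn_Sx hT hS) hs x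

lemma hasFDerivAt_fderiv_Q {s : ℝ} (hs : s ∈ Icc 0 T) (x : Vec n) :
    HasFDerivAt (fderiv ℝ (p.Q s)) (p.Qxx s x) x :=
  hasFDerivAt_slice (f := fun s => fderiv ℝ (p.Q s)) (contDiffOn_fderiv_Q hT hS) hs x

omit hT in
lemma hasFDerivAt_fderiv_G (x : Vec n) : HasFDerivAt (fderiv ℝ p.G) (p.Gxx x) x :=
  ((hS.smoothG.fderiv_right (m := 1) (by norm_num)).differentiable (by simp) x).hasFDerivAt

omit hT in
lemma contDiff_fderiv_G : ContDiff ℝ 1 (fderiv ℝ p.G) :=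
  hS.smoothG.fderiv_right (m := 1) (by norm_num)

omit hT in
lemma hasFDerivAt_G (x : Vec n) : HasFDerivAt p.G (fderiv ℝ p.G x) x :=
  (hS.smoothG.differentiable (by simp) x).hasFDerivAt

end

lemma inner_gradient (f : Vec n → ℝ) (x v : Vec n) : ⟪gradient f x, v⟫ = fderiv ℝ f x v := by
  simp [gradient]

end Problem

end AQ

namespace AQ

open Filter Topology

namespace Problem

variable {n m : ℕ} {p : Problem n m} {T : ℝ}

/-! ### Estimates of the adjoint variable -/

/-- The reduced drift `A - B R⁻¹ S`. -/
def redDrift (p : Problem n m) (s : ℝ) (x : Vec n) : Vec n :=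
  p.A s x - p.B s (p.Rinv s (p.S s x))

/-- The matrix `B R⁻¹ Bᵀ`. -/
def controlGram (p : Problem n m) (s : ℝ) : Vec n →L[ℝ] Vec n :=
  p.B s ∘L p.Rinv s ∘L ContinuousLinearMap.adjoint (p.B s)

lemma drift_feedback (p : Problem n m) (s : ℝ) (x y : Vec n) :
    p.A s x + p.B s (p.feedback s x y) = p.redDrift s x - p.controlGram s y := by
  simp only [feedback, redDrift, controlGram, map_neg, map_add, ContinuousLinearMap.comp_apply]
  abel

lemma hasFDerivAt_redDrift (hS : p.SmoothHyp T) {s : ℝ} (hs : s ∈ Icc 0 T) (x : Vec n) :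
    HasFDerivAt (p.redDrift s) (p.driftJac s x) x := by
  have h1 := hasFDerivAt_A hS hs x
  have h2 := hasFDerivAt_S hS hs x
  have h3 := (p.B s ∘L p.Rinv s).hasFDerivAt.comp x h2
  exact h1.sub h3

namespace IsExtremal

variable {t : ℝ} {x : Vec n} {X Y : ℝ → Vec n}

lemma continuousOn_state (h : p.IsExtremal T t x X Y) : ContinuousOn X (Icc t T) :=
  fun s hs => (h.state s hs).continuousWithinAt

lemma continuousOn_adjoint (h : p.IsExtremal T t x X Y) : ContinuousOn Y (Icc t T) :=
  fun s hs => (h.adjoint s hs).continuousWithinAt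

end IsExtremal

lemma inner_redDrift_le (hS : p.SmoothHyp T) {L₀ LA LB LQ LG : ℝ}
    (hD : p.Dissipative T L₀ LA LB LQ LG) {s : ℝ} (hs : s ∈ Icc 0 T) (x : Vec n) :
    ⟪p.redDrift s x, x⟫ ≤ -L₀ * ‖x‖ ^ 2 := by
  have h0 : p.redDrift s 0 = 0 := by
    simp [redDrift, (hD.origin s hs).1, (hD.origin s hs).2]
  have hjac : ∀ y, ⟪p.driftJac s y x, x⟫ ≤ -L₀ * ‖x‖ ^ 2 := by
    intro y
    have h1 := hD.dissip s hs y x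
    rw [add_apply, inner_add_left, ContinuousLinearMap.adjoint_inner_left,
      real_inner_comm (p.driftJac s y x) x] at h1
    linarith [real_inner_comm (p.driftJac s y x) x]
  have hd : ∀ θ : ℝ, HasDerivAt (fun θ : ℝ => ⟪p.redDrift s (θ • x), x⟫)
      ⟪p.driftJac s (θ • x) x, x⟫ θ := by
    intro θ
    have h1 : HasDerivAt (fun θ : ℝ => θ • x) x θ := by
      simpa using (hasDerivAt_id θ).smul_const x
    have h2 := (hasFDerivAt_redDrift hS hs (θ • x)).comp_hasDerivAt θ h1
    simpa using h2.inner ℝ (hasDerivAt_const θ x)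
  obtain ⟨θ, -, hθ⟩ := exists_hasDerivAt_eq_slope (fun θ : ℝ => ⟪p.redDrift s (θ • x), x⟫) _
    zero_lt_one (fun θ _ => (hd θ).continuousAt.continuousWithinAt) (fun θ _ => hd θ)
  have h2 := hjac (θ • x)
  simp only [one_smul, zero_smul, h0, inner_zero_left, sub_zero, div_one] at hθ
  linarith

/-- A slope preserved backwards by the Riccati inequality of the dissipative case. -/
def dissipativeSlope (L₀ LB LQ LG : ℝ) : ℝ :=
  max LG (if LB = 0 then LQ / (2 * L₀) else L₀ / LB)

lemma dissipativeSlope_spec {L₀ LB LQ LG : ℝ} (hL₀ : 0 < L₀) (hLB : 0 ≤ LB) (hLQ : 0 ≤ LQ)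
    (h₂ : 0 < L₀ ^ 4 - LB ^ 2 * LQ ^ 2)
    (h₃ : 0 < 2 * (2 * L₀ ^ 2 - LB ^ 2 * LG ^ 2) * (L₀ ^ 4 - LB ^ 2 * LQ ^ 2)
      - LB ^ 4 * LQ ^ 2 * LG ^ 2) :
    LQ + (dissipativeSlope L₀ LB LQ LG) ^ 2 * LB ≤
      2 * L₀ * dissipativeSlope L₀ LB LQ LG := by
  unfold dissipativeSlope
  by_cases hB : LB = 0
  · subst hB
    simp only [if_true, mul_zero, add_zero]
    have h1 : LQ / (2 * L₀) ≤ max LG (LQ / (2 * L₀)) := le_max_right _ _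
    rw [div_le_iff₀ (by positivity)] at h1
    linarith
  have hLB' : 0 < LB := lt_of_le_of_ne hLB (Ne.symm hB)
  simp only [hB, if_false]
  have h2' : LB * LQ < L₀ ^ 2 := by
    by_contra hcon
    push Not at hcon
    have : (L₀ ^ 2) ^ 2 ≤ (LB * LQ) ^ 2 := by gcongr
    nlinarith
  rcases le_total LG (L₀ / LB) with hle | hle
  · rw [max_eq_right hle]
    have h5 : (L₀ / LB) ^ 2 * LB = L₀ ^ 2 / LB := by field_simp
    have h6 : 2 * L₀ * (L₀ / LB) = L₀ ^ 2 / LB + L₀ ^ 2 / LB := by field_simp; ring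
    rw [h5, h6]
    have h7 : LQ ≤ L₀ ^ 2 / LB := by
      rw [le_div_iff₀ hLB']; nlinarith
    linarith
  rw [max_eq_left hle]
  have hle' : L₀ ≤ LB * LG := by
    rw [div_le_iff₀ hLB'] at hle; linarith
  set β := LB * LQ with hβ
  set γ := LB * LG with hγ
  have hβ0 : 0 ≤ β := by positivity
  have h3' : γ ^ 2 * (2 * L₀ ^ 4 - β ^ 2) < 4 * L₀ ^ 2 * (L₀ ^ 4 - β ^ 2) := by
    have : 2 * (2 * L₀ ^ 2 - LB ^ 2 * LG ^ 2) * (L₀ ^ 4 - LB ^ 2 * LQ ^ 2)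
      - LB ^ 4 * LQ ^ 2 * LG ^ 2 =
      4 * L₀ ^ 2 * (L₀ ^ 4 - β ^ 2) - γ ^ 2 * (2 * L₀ ^ 4 - β ^ 2) := by
      rw [hβ, hγ]; ring
    linarith
  set r := Real.sqrt (L₀ ^ 2 - β) with hr
  have hr2 : r ^ 2 = L₀ ^ 2 - β := Real.sq_sqrt (by linarith)
  have hr0 : 0 ≤ r := Real.sqrt_nonneg _
  have hβr : β = L₀ ^ 2 - r ^ 2 := by linarith
  have hrL : r ≤ L₀ := by nlinarith
  have hkey : γ ≤ L₀ + r := by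
    by_contra hcon
    push Not at hcon
    rw [hβr] at h3'
    have hpos : 0 ≤ 2 * L₀ ^ 4 - (L₀ ^ 2 - r ^ 2) ^ 2 := by
      have : (L₀ ^ 2 - r ^ 2) ^ 2 ≤ (L₀ ^ 2) ^ 2 := by
        apply pow_le_pow_left₀ (by nlinarith) (by nlinarith [sq_nonneg r])
      nlinarith [sq_nonneg (L₀ ^ 2)]
    have hsq : 4 * (L₀ * r) ≤ γ ^ 2 := by
      have : (L₀ + r) ^ 2 ≤ γ ^ 2 := by gcongr
      nlinarith [sq_nonneg (L₀ - r)]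
    have h8 : 4 * (L₀ * r) * (2 * L₀ ^ 4 - (L₀ ^ 2 - r ^ 2) ^ 2) <
        4 * L₀ ^ 2 * (L₀ ^ 4 - (L₀ ^ 2 - r ^ 2) ^ 2) :=
      lt_of_le_of_lt (mul_le_mul_of_nonneg_right hsq hpos) h3'
    have h9 : 4 * (L₀ * r) * (2 * L₀ ^ 4 - (L₀ ^ 2 - r ^ 2) ^ 2) -
        4 * L₀ ^ 2 * (L₀ ^ 4 - (L₀ ^ 2 - r ^ 2) ^ 2) =
        4 * (L₀ * r) * (L₀ ^ 2 * (L₀ - r) ^ 2 + L₀ ^ 2 * r ^ 2 + L₀ * r ^ 3 - r ^ 4) := by ring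
    have h10 : 0 ≤ L₀ * r ^ 3 - r ^ 4 := by
      have : L₀ * r ^ 3 - r ^ 4 = r ^ 3 * (L₀ - r) := by ring
      rw [this]
      exact mul_nonneg (by positivity) (by linarith)
    have h11 : 0 ≤ 4 * (L₀ * r) *
        (L₀ ^ 2 * (L₀ - r) ^ 2 + L₀ ^ 2 * r ^ 2 + L₀ * r ^ 3 - r ^ 4) := by
      apply mul_nonneg (by positivity)
      have : 0 ≤ L₀ ^ 2 * (L₀ - r) ^ 2 + L₀ ^ 2 * r ^ 2 := by positivity
      linarith
    linarith
  have hq : γ ^ 2 - 2 * L₀ * γ + β ≤ 0 := by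
    have : γ ^ 2 - 2 * L₀ * γ + β = (γ - L₀) ^ 2 - r ^ 2 := by rw [hr2]; ring
    rw [this]
    nlinarith
  have hmul : LB * (LQ + LG ^ 2 * LB) ≤ LB * (2 * L₀ * LG) := by
    have : LB * (LQ + LG ^ 2 * LB) = β + γ ^ 2 := by rw [hβ, hγ]; ring
    rw [this]
    have : LB * (2 * L₀ * LG) = 2 * L₀ * γ := by rw [hγ]; ring
    rw [this]; linarith
  exact le_of_mul_le_mul_left hmul hLB'

lemma norm_adjoint_le_of_dissipative (hS : p.SmoothHyp T) {L₀ LA LB LQ LG : ℝ}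
    (hD : p.Dissipative T L₀ LA LB LQ LG) {t : ℝ} (ht : t ∈ Icc 0 T) {x : Vec n}
    {X Y : ℝ → Vec n} (h : p.IsExtremal T t x X Y) {s : ℝ} (hs : s ∈ Icc t T) :
    ‖Y s‖ ≤ dissipativeSlope L₀ LB LQ LG * ‖X s‖ := by
  obtain ⟨hLA, hLB, hLQ, hLG⟩ := hD.nonneg
  set K := dissipativeSlope L₀ LB LQ LG with hK
  have hKG : LG ≤ K := le_max_left _ _
  have hK0 : 0 ≤ K := hLG.trans hKG
  have hKspec : LQ + K ^ 2 * LB ≤ 2 * L₀ * K :=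
    dissipativeSlope_spec hD.pos hLB hLQ hD.small₂ hD.small₃
  have hder : ∀ r ∈ Icc t T, HasDerivWithinAt (fun r => ‖Y r‖ ^ 2 - K ^ 2 * ‖X r‖ ^ 2)
      (2 * ⟪Y r, -ContinuousLinearMap.adjoint (p.driftJac r (X r)) (Y r) - p.costGrad r (X r)⟫
        - K ^ 2 * (2 * ⟪X r, p.redDrift r (X r) - p.controlGram r (Y r)⟫)) (Icc t T) r := by
    intro r hr
    have h1 := (h.adjoint r hr).norm_sq
    have h2 := (h.state r hr).norm_sq
    rw [drift_feedback] at h2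
    exact h1.sub (h2.const_mul _)
  have hmono : MonotoneOn (fun r => ‖Y r‖ ^ 2 - K ^ 2 * ‖X r‖ ^ 2) (Icc t T) := by
    refine monotoneOn_of_hasDerivWithinAt_nonneg (convex_Icc t T)
      (fun r hr => (hder r hr).continuousWithinAt)
      (fun r hr => (hder r (interior_subset hr)).mono interior_subset) ?_
    intro r hr
    replace hr := interior_subset hr
    have hr0 : r ∈ Icc 0 T := ⟨ht.1.trans hr.1, hr.2⟩
    have e1 : ⟪Y r, ContinuousLinearMap.adjoint (p.driftJac r (X r)) (Y r)⟫ ≤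
        -L₀ * ‖Y r‖ ^ 2 := by
      have h1 := hD.dissip r hr0 (X r) (Y r)
      rw [add_apply, inner_add_left, real_inner_comm (Y r) (ContinuousLinearMap.adjoint
        (p.driftJac r (X r)) (Y r)), ContinuousLinearMap.adjoint_inner_right] at h1
      rw [ContinuousLinearMap.adjoint_inner_right]
      linarith
    have e2 : ⟪Y r, p.costGrad r (X r)⟫ ≤ ‖Y r‖ * (LQ * ‖X r‖) :=
      (real_inner_le_norm _ _).trans (by gcongr; exact hD.running r hr0 _)
    have e3 : ⟪X r, p.redDrift r (X r)⟫ ≤ -L₀ * ‖X r‖ ^ 2 := by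
      rw [real_inner_comm]; exact inner_redDrift_le hS hD hr0 _
    have e4 : -(‖X r‖ * (LB * ‖Y r‖)) ≤ ⟪X r, p.controlGram r (Y r)⟫ := by
      refine neg_le_of_abs_le ((abs_real_inner_le_norm _ _).trans ?_)
      gcongr
      exact (p.controlGram r).le_of_opNorm_le (hD.control r hr0) _
    rw [inner_sub_right, inner_sub_right, inner_neg_right]
    have e5 : 0 ≤ K ^ 2 := sq_nonneg K
    have e6 := mul_le_mul_of_nonneg_left e3 e5
    have e7 := mul_le_mul_of_nonneg_left e4 e5
    have e8 : ‖X r‖ * ‖Y r‖ * (LQ + K ^ 2 * LB) ≤ ‖X r‖ * ‖Y r‖ * (2 * L₀ * K) := by gcongr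
    have e9 : 0 ≤ L₀ * (‖Y r‖ - K * ‖X r‖) ^ 2 := mul_nonneg hD.pos.le (sq_nonneg _)
    nlinarith
  have hT : T ∈ Icc t T := ⟨ht.2, le_rfl⟩
  have h1 := hmono hs hT hs.2
  simp only at h1
  have h2 : ‖Y T‖ ≤ K * ‖X T‖ := by
    rw [h.terminal]
    exact (hD.final _).trans (by gcongr)
  have h3 : ‖Y T‖ ^ 2 ≤ (K * ‖X T‖) ^ 2 := by gcongr
  have h4 : ‖Y s‖ ^ 2 ≤ (K * ‖X s‖) ^ 2 := by rw [mul_pow] at *; linarith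
  exact le_of_sq_le_sq h4 (by positivity)

/-- The constant of the adjoint estimate in the dissipative case. -/
def dissipativeConst (L₀ _LA LB LQ LG : ℝ) : ℝ := max 1 (dissipativeSlope L₀ LB LQ LG)

lemma adjointBound_of_dissipative (hS : p.SmoothHyp T) {L₀ LA LB LQ LG : ℝ}
    (hD : p.Dissipative T L₀ LA LB LQ LG) :
    p.AdjointBound T (dissipativeConst L₀ LA LB LQ LG) := by
  intro t ht x X Y h s hs
  refine (norm_adjoint_le_of_dissipative hS hD ht h hs).trans ?_
  have h1 : dissipativeSlope L₀ LB LQ LG ≤ dissipativeConst L₀ LA LB LQ LG := le_max_right _ _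
  have h2 : (1:ℝ) ≤ dissipativeConst L₀ LA LB LQ LG := le_max_left _ _
  calc dissipativeSlope L₀ LB LQ LG * ‖X s‖ ≤ dissipativeConst L₀ LA LB LQ LG * ‖X s‖ := by gcongr
    _ ≤ _ := by gcongr; linarith

/-! #### Short horizon -/

lemma gronwallBound_le {δ K ε x : ℝ} (hK : 0 ≤ K) (hε : 0 ≤ ε) :
    gronwallBound δ K ε x ≤ (δ + ε * x) * Real.exp (K * x) := by
  rcases hK.eq_or_lt with rfl | hK
  · simp [gronwallBound_K0]
  rw [gronwallBound_of_K_ne_0 hK.ne', add_mul]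
  have h1 : Real.exp (K * x) - 1 ≤ K * x * Real.exp (K * x) := by
    have h2 := Real.add_one_le_exp (-(K * x))
    have h3 : Real.exp (-(K * x)) * Real.exp (K * x) = 1 := by
      rw [← Real.exp_add]; simp
    nlinarith [Real.exp_pos (K * x)]
  have h4 : ε / K * (Real.exp (K * x) - 1) ≤ ε / K * (K * x * Real.exp (K * x)) := by gcongr
  have h5 : ε / K * (K * x * Real.exp (K * x)) = ε * x * Real.exp (K * x) := by field_simp
  linarith

/-- The constant of the adjoint estimate on a short horizon. -/
def shortHorizonConst (T LA LB LQ LG A₀ Q₀ g₀ : ℝ) : ℝ :=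
  1 + |(g₀ + T * Q₀) * Real.exp (LA * T) + (LG + T * LQ) * Real.exp (LA * T) *
    ((1 + (T * A₀ + T * LB * ((g₀ + T * Q₀) * Real.exp (LA * T)))) /
      (1 - T * (LA + LB * (T * LQ + LG) * Real.exp (LA * T))))|

lemma adjointBound_of_shortHorizon (hS : p.SmoothHyp T) {LA LB LQ LG A₀ Q₀ : ℝ}
    (hT : 0 < T) (hH : p.ShortHorizon T LA LB LQ LG A₀ Q₀) :
    p.AdjointBound T (shortHorizonConst T LA LB LQ LG A₀ Q₀ ‖gradient p.G 0‖) := by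
  intro t ht x X Y h s hs
  obtain ⟨hLA, hLB, hLQ, hLG⟩ := hH.nonneg
  have h0T : (0:ℝ) ∈ Icc 0 T := ⟨le_rfl, hT.le⟩
  have hA₀ : 0 ≤ A₀ := (norm_nonneg _).trans (hH.origin 0 h0T)
  have hQ₀ : 0 ≤ Q₀ := (norm_nonneg _).trans ((hH.running 0 h0T 0).trans (by simp))
  set g₀ := ‖gradient p.G 0‖ with hg₀
  have hg0 : 0 ≤ g₀ := norm_nonneg _
  set e := Real.exp (LA * T) with he
  have he0 : 0 < e := Real.exp_pos _
  have hs0 : 0 ≤ s := ht.1.trans hs.1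
  have hsub : Icc s T ⊆ Icc t T := Icc_subset_Icc_left hs.1
  obtain ⟨r₀, hr₀, hmax⟩ := isCompact_Icc.exists_isMaxOn (nonempty_Icc.2 hs.2)
    ((h.continuousOn_state.mono hsub).norm)
  set M := ‖X r₀‖ with hM
  have hXM : ∀ r ∈ Icc s T, ‖X r‖ ≤ M := fun r hr => hmax hr
  have hM0 : 0 ≤ M := norm_nonneg _
  set N := (g₀ + LG * M + (Q₀ + LQ * M) * T) * e with hN
  have hN0 : 0 ≤ N := by positivity
  have hY : ∀ r ∈ Icc s T, ‖Y r‖ ≤ N := by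
    intro r hr
    have hmaps : MapsTo (fun ρ => T - ρ) (Icc 0 (T - s)) (Icc s T) := fun ρ hρ =>
      ⟨by linarith [hρ.2], by linarith [hρ.1]⟩
    have hd : ∀ ρ ∈ Icc 0 (T - s), HasDerivWithinAt (fun ρ => Y (T - ρ))
        (-(-ContinuousLinearMap.adjoint (p.driftJac (T - ρ) (X (T - ρ))) (Y (T - ρ)) -
          p.costGrad (T - ρ) (X (T - ρ)))) (Icc 0 (T - s)) ρ := by
      intro ρ hρ
      have h1 := (h.adjoint (T - ρ) (hsub (hmaps hρ))).mono hsub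
      have h2 : HasDerivWithinAt (fun ρ : ℝ => T - ρ) (-1) (Icc 0 (T - s)) ρ := by
        simpa using ((hasDerivAt_id ρ).const_sub T).hasDerivWithinAt
      simpa [Function.comp_def] using h1.scomp ρ h2 hmaps
    have hg := norm_le_gronwallBound_of_norm_deriv_right_le (f := fun ρ => Y (T - ρ))
      (δ := g₀ + LG * M) (K := LA) (ε := Q₀ + LQ * M) (a := 0) (b := T - s)
      (fun ρ hρ => (hd ρ hρ).continuousWithinAt)
      (fun ρ hρ => ((hd ρ (Ico_subset_Icc_self hρ)).mono_of_mem_nhdsWithin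
        (Icc_mem_nhdsGE_of_mem hρ)))
      (by
        simp only [sub_zero]
        rw [h.terminal]
        refine (hH.final _).trans ?_
        gcongr
        exact hXM T ⟨hs.2, le_rfl⟩)
      (fun ρ hρ => by
        have hρ' := hmaps (Ico_subset_Icc_self hρ)
        have hρ0 : T - ρ ∈ Icc 0 T := ⟨hs0.trans hρ'.1, hρ'.2⟩
        rw [norm_neg]
        refine (norm_sub_le _ _).trans ?_
        rw [norm_neg]
        gcongr
        · refine ContinuousLinearMap.le_of_opNorm_le _ ?_ _
          rw [LinearIsometryEquiv.norm_map]
          exact hH.drift _ hρ0 _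
        · refine (hH.running _ hρ0 _).trans ?_
          gcongr
          exact hXM _ hρ')
      (T - r) ⟨by linarith [hr.2], by linarith [hr.1]⟩
    simp only [sub_sub_cancel, sub_zero] at hg
    refine hg.trans ((gronwallBound_le hLA (by positivity)).trans ?_)
    have hr0 : T - r ≤ T := by linarith [hr.1]
    rw [hN, he]
    gcongr
  have hdrift : ∀ r ∈ Icc 0 T, ∀ y, ‖p.redDrift r y‖ ≤ A₀ + LA * ‖y‖ := by
    intro r hr y
    have h1 := convex_univ.norm_image_sub_le_of_norm_hasFDerivWithin_le (f := p.redDrift r)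
      (fun z _ => (hasFDerivAt_redDrift hS hr z).hasFDerivWithinAt)
      (fun z _ => hH.drift r hr z) (mem_univ 0) (mem_univ y)
    rw [sub_zero] at h1
    have h2 : ‖p.redDrift r 0‖ ≤ A₀ := hH.origin r hr
    calc ‖p.redDrift r y‖ = ‖p.redDrift r 0 + (p.redDrift r y - p.redDrift r 0)‖ := by
          congr 1; abel
      _ ≤ _ := (norm_add_le _ _).trans (add_le_add h2 h1)
  have hX := norm_image_sub_le_of_norm_deriv_le_segment' (f := X) (a := s) (b := T)
    (C := A₀ + LA * M + LB * N) (fun r hr => (h.state r (hsub hr)).mono hsub)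
    (fun r hr => by
      have hr' := Ico_subset_Icc_self hr
      have hr0 : r ∈ Icc 0 T := ⟨hs0.trans hr'.1, hr'.2⟩
      rw [drift_feedback]
      refine (norm_sub_le _ _).trans ?_
      gcongr
      · refine (hdrift r hr0 _).trans ?_
        gcongr
        exact hXM r hr'
      · refine (ContinuousLinearMap.le_of_opNorm_le _ (hH.control r hr0) _).trans ?_
        gcongr
        exact hY r hr') r₀ hr₀
  have hM1 : M ≤ ‖X s‖ + (A₀ + LA * M + LB * N) * T := by
    have h1 : M ≤ ‖X s‖ + ‖X r₀ - X s‖ := by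
      rw [hM]
      calc ‖X r₀‖ = ‖X s + (X r₀ - X s)‖ := by congr 1; abel
        _ ≤ _ := norm_add_le _ _
    have h2 : (A₀ + LA * M + LB * N) * (r₀ - s) ≤ (A₀ + LA * M + LB * N) * T := by
      gcongr
      linarith [hr₀.2]
    linarith
  set θ := 1 - T * (LA + LB * (T * LQ + LG) * e) with hθ
  have hθ0 : 0 < θ := by have := hH.small; rw [hθ]; linarith
  set c₀ := T * A₀ + T * LB * ((g₀ + T * Q₀) * e) with hc₀
  have hc0 : 0 ≤ c₀ := by positivity
  have hM2 : M * θ ≤ ‖X s‖ + c₀ := by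
    have : M * θ = M - (LA * M + LB * ((LG * M + LQ * M * T) * e)) * T := by rw [hθ]; ring
    rw [this]
    have : (A₀ + LA * M + LB * N) * T =
        c₀ + (LA * M + LB * ((LG * M + LQ * M * T) * e)) * T := by rw [hc₀, hN]; ring
    linarith
  have hM3 : M ≤ (1 + c₀) / θ * (1 + ‖X s‖) := by
    rw [div_mul_eq_mul_div, le_div_iff₀ hθ0]
    nlinarith [norm_nonneg (X s)]
  have hfin : ‖Y s‖ ≤ ((g₀ + T * Q₀) * e + (LG + T * LQ) * e * ((1 + c₀) / θ)) * (1 + ‖X s‖) := by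
    refine (hY s ⟨le_rfl, hs.2⟩).trans ?_
    have h1 : N = (g₀ + T * Q₀) * e + (LG + T * LQ) * e * M := by rw [hN]; ring
    have hP : 0 ≤ (g₀ + T * Q₀) * e := by positivity
    have h2 := mul_le_mul_of_nonneg_left hM3 (by positivity : 0 ≤ (LG + T * LQ) * e)
    rw [h1]
    nlinarith [mul_nonneg hP (norm_nonneg (X s))]
  refine hfin.trans ?_
  gcongr
  rw [shortHorizonConst]
  exact (le_abs_self _).trans (by linarith)

lemma shortHorizonConst_pos (T LA LB LQ LG A₀ Q₀ g₀ : ℝ) :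
    0 < shortHorizonConst T LA LB LQ LG A₀ Q₀ g₀ := by
  unfold shortHorizonConst; positivity

lemma dissipativeConst_pos (L₀ LA LB LQ LG : ℝ) : 0 < dissipativeConst L₀ LA LB LQ LG :=
  lt_of_lt_of_le one_pos (le_max_left _ _)

end Problem

end AQ

namespace AQ

open Filter Topology

/-! ### Operators on `L²(a,b)` -/

section L2

variable {a b : ℝ} {E F : Type*} [NormedAddCommGroup E] [NormedSpace ℝ E] [NormedAddCommGroup F]
  [NormedSpace ℝ F]

/-- `L²(a,b;E)`. -/
abbrev L2 (E : Type*) [NormedAddCommGroup E] (a b : ℝ) := Lp E 2 (volume.restrict (Icc a b))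

lemma memLp_IccExtend [SecondCountableTopology E] (hab : a ≤ b) (X : C(Icc a b, E)) :
    MemLp (IccExtend hab X) 2 (volume.restrict (Icc a b)) :=
  MemLp.of_bound (X.continuous.Icc_extend' (h := hab)).aestronglyMeasurable ‖X‖
    (Eventually.of_forall fun r => norm_IccExtend_le hab X r)

/-- The inclusion of `C([a,b];E)` in `L²(a,b;E)`. -/
def toL2 [SecondCountableTopology E] (hab : a ≤ b) : C(Icc a b, E) →L[ℝ] L2 E a b :=
  LinearMap.mkContinuous
    { toFun := fun X => (memLp_IccExtend hab X).toLp _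
      map_add' := fun X Y => by rw [← MemLp.toLp_add]; rfl
      map_smul' := fun r X => by rw [RingHom.id_apply, ← MemLp.toLp_const_smul]; rfl }
    ((volume.restrict (Icc a b)).real univ ^ (ENNReal.toReal 2)⁻¹)
    (fun X => Lp.norm_le_of_ae_bound (norm_nonneg X) (by
      filter_upwards [(memLp_IccExtend hab X).coeFn_toLp] with r hr
      exact (congrArg norm hr).trans_le (norm_IccExtend_le hab X r)))

lemma coeFn_toL2 [SecondCountableTopology E] (hab : a ≤ b) (X : C(Icc a b, E)) :
    toL2 hab X =ᵐ[volume.restrict (Icc a b)] IccExtend hab X :=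
  (memLp_IccExtend hab X).coeFn_toLp

lemma memLp_IccExtend_apply (hab : a ≤ b) (M : C(Icc a b, E →L[ℝ] F)) (u : L2 E a b) :
    MemLp (fun r => IccExtend hab M r (u r)) 2 (volume.restrict (Icc a b)) :=
  (Lp.memLp u).of_le_mul (c := ‖M‖)
    (isBoundedBilinearMap_apply.continuous.comp_aestronglyMeasurable₂
      (M.continuous.Icc_extend' (h := hab)).aestronglyMeasurable (Lp.aestronglyMeasurable u))
    (Eventually.of_forall fun r =>
      ContinuousLinearMap.le_of_opNorm_le _ (norm_IccExtend_le hab M r) _)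

/-- Multiplication by a continuous operator-valued function. -/
def mulL2 (hab : a ≤ b) (M : C(Icc a b, E →L[ℝ] F)) : L2 E a b →L[ℝ] L2 F a b :=
  LinearMap.mkContinuous
    { toFun := fun u => (memLp_IccExtend_apply hab M u).toLp _
      map_add' := fun u v => by
        rw [← MemLp.toLp_add]
        apply MemLp.toLp_congr
        filter_upwards [Lp.coeFn_add u v] with r hr
        rw [hr]; simp
      map_smul' := fun c u => by
        rw [RingHom.id_apply, ← MemLp.toLp_const_smul]
        apply MemLp.toLp_congr
        filter_upwards [Lp.coeFn_smul c u] with r hr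
        rw [hr]; simp } ‖M‖
    (fun u => Lp.norm_le_mul_norm_of_ae_le_mul (by
      filter_upwards [(memLp_IccExtend_apply hab M u).coeFn_toLp] with r hr
      exact (congrArg norm hr).trans_le
        (ContinuousLinearMap.le_of_opNorm_le _ (norm_IccExtend_le hab M r) _)))

lemma coeFn_mulL2 (hab : a ≤ b) (M : C(Icc a b, E →L[ℝ] F)) (u : L2 E a b) :
    mulL2 hab M u =ᵐ[volume.restrict (Icc a b)] fun r => IccExtend hab M r (u r) :=
  (memLp_IccExtend_apply hab M u).coeFn_toLp

lemma integrable_L2 (u : L2 E a b) : Integrable u (volume.restrict (Icc a b)) :=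
  (Lp.memLp u).integrable (by norm_num)

lemma intervalIntegrable_of_integrable_Icc {f : ℝ → E}
    (hf : Integrable f (volume.restrict (Icc a b))) {c d : ℝ} (hc : c ∈ Icc a b)
    (hd : d ∈ Icc a b) : IntervalIntegrable f volume c d := by
  have h : IntegrableOn f (uIcc c d) volume :=
    IntegrableOn.mono_set hf (uIcc_subset_Icc hc hd)
  exact h.intervalIntegrable

lemma integral_norm_le_L2 (u : L2 E a b) :
    ∫ r in Icc a b, ‖u r‖ ≤
      ((volume.restrict (Icc a b)) univ ^ (1 / (1:ENNReal).toReal - 1 / (2:ENNReal).toReal)).toReal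
        * ‖u‖ := by
  rw [integral_norm_eq_lintegral_enorm (Lp.aestronglyMeasurable u), ← eLpNorm_one_eq_lintegral_enorm,
    Lp.norm_def, mul_comm, ← ENNReal.toReal_mul]
  refine ENNReal.toReal_mono ?_ (eLpNorm_le_eLpNorm_mul_rpow_measure_univ (by norm_num)
    (Lp.aestronglyMeasurable u))
  refine ENNReal.mul_ne_top (Lp.eLpNorm_ne_top u) (ENNReal.rpow_ne_top_of_nonneg (by norm_num) ?_)
  exact measure_ne_top _ _

/-- The primitive `s ↦ ∫_a^s u` of a square-integrable function. -/
def primitiveL2 [CompleteSpace E] (hab : a ≤ b) : L2 E a b →L[ℝ] C(Icc a b, E) :=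
  LinearMap.mkContinuous
    { toFun := fun u => ⟨fun s => ∫ r in a..s, u r, by
        have h := intervalIntegral.continuousOn_primitive_interval' (a := a) (b₁ := a) (b₂ := b)
          (f := u) (μ := volume)
          (intervalIntegrable_of_integrable_Icc (integrable_L2 u) ⟨le_rfl, hab⟩ ⟨hab, le_rfl⟩)
          left_mem_uIcc
        rw [uIcc_of_le hab] at h
        exact h.domRestrict⟩
      map_add' := fun u v => by
        ext s
        have hs : ∀ w : L2 E a b, IntervalIntegrable w volume a s := fun w =>
          intervalIntegrable_of_integrable_Icc (integrable_L2 w) ⟨le_rfl, hab⟩ s.2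
        change ∫ r in a..s, (u + v : L2 E a b) r = (∫ r in a..s, u r) + ∫ r in a..s, v r
        rw [← intervalIntegral.integral_add (hs u) (hs v)]
        apply intervalIntegral.integral_congr_ae
        have h1 := (ae_restrict_iff' measurableSet_Icc).1 (Lp.coeFn_add u v)
        filter_upwards [h1] with r hr hrs
        exact hr (((uIoc_subset_uIcc).trans (uIcc_subset_Icc ⟨le_rfl, hab⟩ s.2)) hrs)
      map_smul' := fun c u => by
        ext s
        change ∫ r in a..s, (c • u : L2 E a b) r = c • ∫ r in a..s, u r
        rw [← intervalIntegral.integral_smul]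
        apply intervalIntegral.integral_congr_ae
        have h1 := (ae_restrict_iff' measurableSet_Icc).1 (Lp.coeFn_smul c u)
        filter_upwards [h1] with r hr hrs
        exact hr (((uIoc_subset_uIcc).trans (uIcc_subset_Icc ⟨le_rfl, hab⟩ s.2)) hrs) }
    _ (fun u => by
      refine le_trans ?_ (integral_norm_le_L2 u)
      rw [ContinuousMap.norm_le _ (integral_nonneg fun _ => norm_nonneg _)]
      intro s
      change ‖∫ r in a..s, u r‖ ≤ _
      refine (intervalIntegral.norm_integral_le_integral_norm s.2.1).trans ?_
      rw [intervalIntegral.integral_of_le s.2.1]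
      exact setIntegral_mono_set (integrable_L2 u).norm
        (Eventually.of_forall fun _ => norm_nonneg _)
        (Eventually.of_forall (Ioc_subset_Icc_self.trans (Icc_subset_Icc_right s.2.2))))

lemma primitiveL2_apply [CompleteSpace E] (hab : a ≤ b) (u : L2 E a b) (s : Icc a b) :
    primitiveL2 hab u s = ∫ r in a..s, u r := rfl

end L2

end AQ

namespace AQ

open Filter Topology

/-- A function of time, extended from `[0,T]` and restricted to a time interval `K`. -/
def timeCoeff {F : Type*} [TopologicalSpace F] {T : ℝ} (hT : 0 < T) (K : Set ℝ) (g : ℝ → F)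
    (hg : ContinuousOn g (Icc 0 T)) : C(K, F) :=
  ⟨fun q => g (clamp T q), by
    have h : Continuous fun q : K => clamp T (q : ℝ) := by fun_prop
    exact hg.comp_continuous h fun q => clamp_mem hT _⟩

@[simp] lemma timeCoeff_apply {F : Type*} [TopologicalSpace F] {T : ℝ} (hT : 0 < T) (K : Set ℝ)
    (g : ℝ → F) (hg : ContinuousOn g (Icc 0 T)) (q : K) :
    timeCoeff hT K g hg q = g (clamp T q) := rfl

lemma contDiff_eval {K F : Type*} [TopologicalSpace K] [CompactSpace K] [NormedAddCommGroup F]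
    [NormedSpace ℝ F] {k : WithTop ℕ∞} (s : K) : ContDiff ℝ k fun X : C(K, F) => X s := by
  let l : C(K, F) →L[ℝ] F := ContinuousMap.evalCLM ℝ s
  exact l.contDiff

namespace Problem

variable {n m : ℕ} {p : Problem n m} {T : ℝ}

/-- The standing assumptions on a problem. -/
structure StandingHyp (p : Problem n m) (T : ℝ) : Prop where
  pos : 0 < T
  dynamics : p.DynamicsHyp T
  cost : p.CostHyp T
  smooth : p.SmoothHyp T

variable (h : p.StandingHyp T) {t : ℝ} (ht : t ∈ Icc 0 T)

/-! ### The state as a smooth function of the control -/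

/-- The drift as a continuous function. -/
abbrev driftC (h : p.StandingHyp T) (K : Set ℝ) : C(K × Vec n, Vec n) :=
  coeff h.pos K p.A h.smooth.smoothA.continuousOn

/-- The derivative of the drift as a continuous function. -/
abbrev driftC' (h : p.StandingHyp T) (K : Set ℝ) : C(K × Vec n, Vec n →L[ℝ] Vec n) :=
  coeff h.pos K p.Ax (contDiffOn_Ax h.pos h.smooth).continuousOn

/-- The second derivative of the drift as a continuous function. -/
abbrev driftC'' (h : p.StandingHyp T) (K : Set ℝ) :
    C(K × Vec n, Vec n →L[ℝ] Vec n →L[ℝ] Vec n) :=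
  coeff h.pos K p.Axx (continuousOn_Axx h.pos h.smooth)

/-- The control matrix as a continuous function. -/
abbrev controlC (h : p.StandingHyp T) (K : Set ℝ) : C(K, Vec m →L[ℝ] Vec n) :=
  timeCoeff h.pos K p.B h.smooth.smoothB.continuousOn

lemma exists_lipschitz_drift (h : p.StandingHyp T) (K : Set ℝ) :
    ∃ L, 0 ≤ L ∧ ∀ (s : K) (x y : Vec n), ‖driftC h K (s, x) - driftC h K (s, y)‖ ≤ L * ‖x - y‖ := by
  obtain ⟨L, hL, hA⟩ := h.dynamics.lipA
  exact ⟨L, hL.le, fun s x y => hA _ (clamp_mem h.pos (s : ℝ)) x y⟩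

/-- The state trajectory, as a function of the control. -/
def stateMap (h : p.StandingHyp T) (ht : t ∈ Icc 0 T) (x : Vec n) (u : L2 (Vec m) t T) :
    C(Icc t T, Vec n) :=
  volterraSol ht.2 ⟨t, le_rfl, ht.2⟩ (driftC h (Icc t T))
    (ContinuousMap.const _ x + primitiveL2 ht.2 (mulL2 ht.2 (controlC h (Icc t T)) u))

lemma integrable_control (u : L2 (Vec m) t T) :
    Integrable (fun s => p.B s (u s)) (volume.restrict (Icc t T)) ∧
    ∀ s ∈ Icc t T, ∫ r in t..s, p.B r (u r) =
      ∫ r in t..s, mulL2 ht.2 (controlC h (Icc t T)) u r := by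
  have h1 : mulL2 ht.2 (controlC h (Icc t T)) u =ᵐ[volume.restrict (Icc t T)]
      fun r => p.B r (u r) := by
    filter_upwards [coeFn_mulL2 ht.2 (controlC h (Icc t T)) u, ae_restrict_mem measurableSet_Icc]
      with r hr hrm
    rw [hr, IccExtend_of_mem _ _ hrm, timeCoeff_apply, clamp_eq ⟨ht.1.trans hrm.1, hrm.2⟩]
  refine ⟨(integrable_L2 _).congr h1, fun s hs => ?_⟩
  apply intervalIntegral.integral_congr_ae
  filter_upwards [(ae_restrict_iff' measurableSet_Icc).1 h1] with r hr hrs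
  exact (hr (((uIoc_subset_uIcc).trans (uIcc_subset_Icc ⟨le_rfl, ht.2⟩ hs)) hrs)).symm

lemma continuousOn_A_comp (h : p.StandingHyp T) {I : Set ℝ} (hI : I ⊆ Icc 0 T) {X : ℝ → Vec n}
    (hX : ContinuousOn X I) : ContinuousOn (fun r => p.A r (X r)) I :=
  h.smooth.smoothA.continuousOn.comp (continuousOn_id.prodMk hX) fun _ hr => ⟨hI hr, mem_univ _⟩

lemma isTrajectory_iff (x : Vec n) (u : L2 (Vec m) t T) (X : ℝ → Vec n) :
    p.IsTrajectory T t x u X ↔ EqOn X (IccExtend ht.2 (stateMap h ht x u)) (Icc t T) := by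
  obtain ⟨L, hL, hLip⟩ := exists_lipschitz_drift h (Icc t T)
  have hsub : Icc t T ⊆ Icc 0 T := Icc_subset_Icc_left ht.1
  have hstep : ∀ (X : ℝ → Vec n) (Y : C(Icc t T, Vec n)), EqOn X (IccExtend ht.2 Y) (Icc t T) →
      ∀ s ∈ Icc t T, (∫ r in t..s, (p.A r (X r) + p.B r (u r))) =
        (∫ r in t..s, IccExtend ht.2 (superpose (driftC h (Icc t T)) Y) r) +
          primitiveL2 ht.2 (mulL2 ht.2 (controlC h (Icc t T)) u) (projIcc t T ht.2 s) := by
    intro X Y hXY s hs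
    have hXc : ContinuousOn X (Icc t T) :=
      (Y.continuous.Icc_extend' (h := ht.2)).continuousOn.congr hXY
    have hst : uIcc t s ⊆ Icc t T := uIcc_subset_Icc ⟨le_rfl, ht.2⟩ hs
    obtain ⟨hi, he⟩ := integrable_control h ht u
    rw [intervalIntegral.integral_add, he s hs, primitiveL2_apply, projIcc_of_mem ht.2 hs]
    · congr 1
      apply intervalIntegral.integral_congr
      intro r hr
      have hr' := hst hr
      simp only
      rw [IccExtend_of_mem _ _ hr', superpose_apply, coeff_apply, clamp_eq (hsub hr'), hXY hr',
        IccExtend_of_mem _ _ hr']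
    · exact ((continuousOn_A_comp h hsub hXc).mono hst).intervalIntegrable
    · exact intervalIntegrable_of_integrable_Icc hi ⟨le_rfl, ht.2⟩ hs
  constructor
  · rintro ⟨hXc, hX⟩
    let Y : C(Icc t T, Vec n) := ⟨_, hXc.domRestrict⟩
    have hXY : EqOn X (IccExtend ht.2 Y) (Icc t T) := fun s hs => by
      rw [IccExtend_of_mem _ _ hs]; rfl
    have hY : Y = stateMap h ht x u := by
      rw [stateMap, ← volterraSol_volterraMap ht.2 ⟨t, le_rfl, ht.2⟩ _ hL hLip Y]
      congr 1
      ext1 s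
      have h1 := hX s s.2
      rw [hstep X Y hXY s s.2, projIcc_val] at h1
      change X s - ∫ r in t..s, IccExtend ht.2 (superpose (driftC h (Icc t T)) Y) r = x + _
      rw [h1]
      abel
    rw [← hY]
    exact hXY
  · intro hX
    refine ⟨((stateMap h ht x u).continuous.Icc_extend' (h := ht.2)).continuousOn.congr hX, ?_⟩
    intro s hs
    have h1 := volterraSol_spec ht.2 ⟨t, le_rfl, ht.2⟩ _ hL hLip
      (ContinuousMap.const _ x + primitiveL2 ht.2 (mulL2 ht.2 (controlC h (Icc t T)) u)) ⟨s, hs⟩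
    rw [hstep X _ hX s hs, hX hs, IccExtend_of_mem _ _ hs, projIcc_of_mem ht.2 hs]
    refine h1.trans ?_
    rw [ContinuousMap.add_apply, ContinuousMap.const_apply, add_assoc, add_comm (primitiveL2 _ _ _)]
    rfl

lemma trajectory_eq (x : Vec n) (u : L2 (Vec m) t T) :
    EqOn (p.trajectory T t x u) (IccExtend ht.2 (stateMap h ht x u)) (Icc t T) := by
  rw [← isTrajectory_iff h ht]
  exact Classical.epsilon_spec ⟨_, (isTrajectory_iff h ht x u _).2 (eqOn_refl _ _)⟩

lemma hasFDerivAt_driftC (h : p.StandingHyp T) (K : Set ℝ) (s : K) (x : Vec n) :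
    HasFDerivAt (fun x => driftC h K (s, x)) (driftC' h K (s, x)) x :=
  hasFDerivAt_A h.smooth (clamp_mem h.pos (s : ℝ)) x

lemma hasFDerivAt_driftC' (h : p.StandingHyp T) (K : Set ℝ) (s : K) (x : Vec n) :
    HasFDerivAt (fun x => driftC' h K (s, x)) (driftC'' h K (s, x)) x :=
  hasFDerivAt_Ax h.pos h.smooth (clamp_mem h.pos (s : ℝ)) x

lemma contDiff_stateMap (x : Vec n) : ContDiff ℝ 2 (stateMap h ht x) := by
  obtain ⟨L, hL, hLip⟩ := exists_lipschitz_drift h (Icc t T)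
  have h1 : ContDiff ℝ 2 (superpose (driftC h (Icc t T))) :=
    contDiff_two_superpose _ (driftC' h _) (driftC'' h _) (hasFDerivAt_driftC h _)
      (hasFDerivAt_driftC' h _)
  have h2 := contDiff_volterraSol ht.2 ⟨t, le_rfl, ht.2⟩ (driftC h (Icc t T)) (driftC' h _) hL hLip
    (hasFDerivAt_driftC h _) (by norm_num) h1
  have h3 : ContDiff ℝ 2 fun u : L2 (Vec m) t T => ContinuousMap.const (Icc t T) x +
      primitiveL2 ht.2 (mulL2 ht.2 (controlC h (Icc t T)) u) :=
    contDiff_const.add (primitiveL2 ht.2 ∘L mulL2 ht.2 (controlC h (Icc t T))).contDiff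
  exact h2.comp h3

/-! ### The cost as a smooth function of the control -/

/-- The running cost rate of the state as a continuous function. -/
abbrev costC (h : p.StandingHyp T) (K : Set ℝ) : C(K × Vec n, ℝ) :=
  coeff h.pos K p.Q h.smooth.smoothQ.continuousOn

/-- The coupling coefficient as a continuous function. -/
abbrev couplingC (h : p.StandingHyp T) (K : Set ℝ) : C(K × Vec n, Vec m) :=
  coeff h.pos K p.S h.smooth.smoothS.continuousOn

/-- The control weight as a continuous function. -/
abbrev weightC (h : p.StandingHyp T) (K : Set ℝ) : C(K, Vec m →L[ℝ] Vec m) :=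
  timeCoeff h.pos K p.R h.smooth.smoothR.continuousOn

lemma inner_toL2_eq (x : Vec n) (u : L2 (Vec m) t T) :
    (fun s => ⟪toL2 ht.2 (superpose (couplingC h (Icc t T)) (stateMap h ht x u)) s, u s⟫)
      =ᵐ[volume.restrict (Icc t T)] fun s => ⟪p.S s (p.trajectory T t x u s), u s⟫ := by
  filter_upwards [coeFn_toL2 ht.2 (superpose (couplingC h (Icc t T)) (stateMap h ht x u)),
    ae_restrict_mem measurableSet_Icc] with s hs hsm
  rw [hs, trajectory_eq h ht x u hsm, IccExtend_of_mem _ _ hsm, IccExtend_of_mem _ _ hsm,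
    superpose_apply, coeff_apply, clamp_eq ⟨ht.1.trans hsm.1, hsm.2⟩]

lemma inner_mulL2_eq (u : L2 (Vec m) t T) :
    (fun s => ⟪mulL2 ht.2 (weightC h (Icc t T)) u s, u s⟫)
      =ᵐ[volume.restrict (Icc t T)] fun s => ⟪p.R s (u s), u s⟫ := by
  filter_upwards [coeFn_mulL2 ht.2 (weightC h (Icc t T)) u,
    ae_restrict_mem measurableSet_Icc] with s hs hsm
  rw [hs, IccExtend_of_mem _ _ hsm, timeCoeff_apply, clamp_eq ⟨ht.1.trans hsm.1, hsm.2⟩]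

lemma intervalIntegral_eq_Icc (hab : t ≤ T) (f : ℝ → ℝ) :
    ∫ s in t..T, f s = ∫ s in Icc t T, f s := by
  rw [intervalIntegral.integral_of_le hab, integral_Icc_eq_integral_Ioc]

lemma cost_eq (x : Vec n) (u : L2 (Vec m) t T) :
    p.cost T t x u =
      volterra ht.2 ⟨t, le_rfl, ht.2⟩ (superpose (costC h (Icc t T)) (stateMap h ht x u))
        ⟨T, ht.2, le_rfl⟩ +
      ⟪toL2 ht.2 (superpose (couplingC h (Icc t T)) (stateMap h ht x u)), u⟫ +
      (1 / 2) * ⟪mulL2 ht.2 (weightC h (Icc t T)) u, u⟫ +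
      p.G (stateMap h ht x u ⟨T, ht.2, le_rfl⟩) := by
  have hTm : T ∈ Icc t T := ⟨ht.2, le_rfl⟩
  have hX := trajectory_eq h ht x u
  have e1 : (fun s => p.Q s (p.trajectory T t x u s)) =ᵐ[volume.restrict (Icc t T)]
      IccExtend ht.2 (superpose (costC h (Icc t T)) (stateMap h ht x u)) := by
    filter_upwards [ae_restrict_mem measurableSet_Icc] with s hs
    rw [hX hs, IccExtend_of_mem _ _ hs, IccExtend_of_mem _ _ hs, superpose_apply, coeff_apply,
      clamp_eq ⟨ht.1.trans hs.1, hs.2⟩]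
  have i1 : Integrable (fun s => p.Q s (p.trajectory T t x u s)) (volume.restrict (Icc t T)) :=
    ((memLp_IccExtend ht.2 _).integrable (by norm_num)).congr e1.symm
  have e2 := inner_toL2_eq h ht x u
  have i2 := (L2.integrable_inner (𝕜 := ℝ)
    (toL2 ht.2 (superpose (couplingC h (Icc t T)) (stateMap h ht x u))) u).congr e2
  have e3 := inner_mulL2_eq h ht u
  have i3 := (L2.integrable_inner (𝕜 := ℝ) (mulL2 ht.2 (weightC h (Icc t T)) u) u).congr e3
  have e4 : ∫ s in Icc t T, (p.Q s (p.trajectory T t x u s) + ⟪p.S s (p.trajectory T t x u s), u s⟫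
      + (1 / 2) * ⟪p.R s (u s), u s⟫) = (∫ s in Icc t T, p.Q s (p.trajectory T t x u s)) +
        (∫ s in Icc t T, ⟪p.S s (p.trajectory T t x u s), u s⟫) +
        (1 / 2) * ∫ s in Icc t T, ⟪p.R s (u s), u s⟫ := by
    rw [← integral_const_mul, ← integral_add i1 i2]
    exact integral_add (i1.add i2) (i3.const_mul _)
  rw [cost, intervalIntegral_eq_Icc ht.2, e4, integral_congr_ae e1, ← integral_congr_ae e2,
    ← integral_congr_ae e3, hX hTm, IccExtend_of_mem _ _ hTm, ← intervalIntegral_eq_Icc ht.2]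
  rfl

lemma contDiff_cost (h : p.StandingHyp T) (ht : t ∈ Icc 0 T) (x : Vec n) :
    ContDiff ℝ 2 (p.cost T t x) := by
  have hX := contDiff_stateMap h ht x
  have hQ : ContDiff ℝ 2 (superpose (costC h (Icc t T))) :=
    contDiff_two_superpose _
      (coeff h.pos _ (fun s x => fderiv ℝ (p.Q s) x)
        (contDiffOn_fderiv_Q h.pos h.smooth).continuousOn)
      (coeff h.pos _ p.Qxx (continuousOn_Qxx h.pos h.smooth))
      (fun s x => hasFDerivAt_Q h.smooth (clamp_mem h.pos (s : ℝ)) x)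
      (fun s x => hasFDerivAt_fderiv_Q h.pos h.smooth (clamp_mem h.pos (s : ℝ)) x)
  have hSc : ContDiff ℝ 2 (superpose (couplingC h (Icc t T))) :=
    contDiff_two_superpose _
      (coeff h.pos _ p.Sx (contDiffOn_Sx h.pos h.smooth).continuousOn)
      (coeff h.pos _ p.Sxx (continuousOn_Sxx h.pos h.smooth))
      (fun s x => hasFDerivAt_S h.smooth (clamp_mem h.pos (s : ℝ)) x)
      (fun s x => hasFDerivAt_Sx h.pos h.smooth (clamp_mem h.pos (s : ℝ)) x)
  have c1 : ContDiff ℝ 2 fun u : L2 (Vec m) t T => volterra (E := ℝ) ht.2 ⟨t, le_rfl, ht.2⟩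
      (superpose (costC h (Icc t T)) (stateMap h ht x u)) :=
    (volterra (E := ℝ) ht.2 ⟨t, le_rfl, ht.2⟩).contDiff.comp (hQ.comp hX)
  have c2 : ContDiff ℝ 2 fun u : L2 (Vec m) t T => toL2 (E := Vec m) ht.2
      (superpose (couplingC h (Icc t T)) (stateMap h ht x u)) :=
    (toL2 (E := Vec m) ht.2).contDiff.comp (hSc.comp hX)
  have c3 : ContDiff ℝ 2 fun u : L2 (Vec m) t T => mulL2 ht.2 (weightC h (Icc t T)) u :=
    (mulL2 ht.2 (weightC h (Icc t T))).contDiff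
  have c4 : ContDiff ℝ 2 fun u : L2 (Vec m) t T => stateMap h ht x u ⟨T, ht.2, le_rfl⟩ :=
    (contDiff_eval _).comp hX
  have c5 : ContDiff ℝ 2 fun u : L2 (Vec m) t T => u := contDiff_id
  have c6 := (contDiff_eval (F := ℝ) (k := 2) (⟨T, ht.2, le_rfl⟩ : Icc t T)).comp c1
  have c7 := c2.inner ℝ c5
  have c8 := (contDiff_const (c := (1 / 2 : ℝ))).mul (c3.inner ℝ c5)
  have c9 := h.smooth.smoothG.comp c4
  rw [show p.cost T t x = _ from funext fun u => cost_eq h ht x u]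
  exact ((c6.add c7).add c8).add c9

end Problem

end AQ

namespace AQ

open Filter Topology

/-! ### Integral inequalities -/

lemma integral_mul_le_sqrt {a b : ℝ} (hab : a ≤ b) {f g : ℝ → ℝ} (hf : ContinuousOn f (Icc a b))
    (hg : ContinuousOn g (Icc a b)) :
    ∫ s in a..b, f s * g s ≤ √(∫ s in a..b, f s ^ 2) * √(∫ s in a..b, g s ^ 2) := by
  have hu : uIcc a b = Icc a b := uIcc_of_le hab
  have i1 : IntervalIntegrable (fun s => f s ^ 2) volume a b :=
    ContinuousOn.intervalIntegrable (by rw [hu]; exact hf.pow 2)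
  have i2 : IntervalIntegrable (fun s => f s * g s) volume a b :=
    ContinuousOn.intervalIntegrable (by rw [hu]; exact hf.mul hg)
  have i3 : IntervalIntegrable (fun s => g s ^ 2) volume a b :=
    ContinuousOn.intervalIntegrable (by rw [hu]; exact hg.pow 2)
  have hd := discrim_le_zero (a := ∫ s in a..b, g s ^ 2) (b := -2 * ∫ s in a..b, f s * g s)
    (c := ∫ s in a..b, f s ^ 2) (fun l => by
      have h1 : 0 ≤ ∫ s in a..b, (f s - l * g s) ^ 2 :=
        intervalIntegral.integral_nonneg hab fun _ _ => sq_nonneg _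
      have h2 : ∫ s in a..b, (f s - l * g s) ^ 2 =
          (∫ s in a..b, f s ^ 2) - 2 * l * (∫ s in a..b, f s * g s) +
            l ^ 2 * ∫ s in a..b, g s ^ 2 := by
        rw [← intervalIntegral.integral_const_mul, ← intervalIntegral.integral_const_mul,
          ← intervalIntegral.integral_sub i1 (i2.const_mul _),
          ← intervalIntegral.integral_add (i1.sub (i2.const_mul _)) (i3.const_mul _)]
        congr 1
        ext s
        ring
      rw [h2] at h1
      linarith)
  rw [discrim] at hd
  rw [← Real.sqrt_mul (intervalIntegral.integral_nonneg hab fun _ _ => sq_nonneg _)]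
  apply Real.le_sqrt_of_sq_le
  nlinarith

lemma integral_mul_primitive {a b : ℝ} (hab : a ≤ b) {g w : ℝ → ℝ}
    (hg : IntervalIntegrable g volume a b) (hw : IntervalIntegrable w volume a b) :
    ∫ s in a..b, g s * (∫ r in a..s, w r) = ∫ r in a..b, (∫ s in r..b, g s) * w r := by
  set μ := volume.restrict (Ioc a b) with hμ
  have hg' : Integrable g μ := (intervalIntegrable_iff_integrableOn_Ioc_of_le hab).1 hg
  have hw' : Integrable w μ := (intervalIntegrable_iff_integrableOn_Ioc_of_le hab).1 hw
  let f : ℝ → ℝ → ℝ := fun s r => indicator {q : ℝ × ℝ | q.2 ≤ q.1} (fun q => g q.1 * w q.2) (s, r)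
  have hf : Integrable (Function.uncurry f) (μ.prod μ) :=
    (hg'.mul_prod hw').indicator (measurableSet_le measurable_snd measurable_fst)
  have hswap := integral_integral_swap hf
  rw [intervalIntegral.integral_of_le hab, intervalIntegral.integral_of_le hab]
  have h1 : ∀ s ∈ Ioc a b, g s * (∫ r in a..s, w r) = ∫ r, f s r ∂μ := by
    intro s hs
    have e : ∀ r, f s r = indicator (Iic s) (fun r => g s * w r) r := by
      intro r
      simp only [f, indicator, mem_ofPred_eq, mem_Iic]
    have hset : Iic s ∩ Ioc a b = Ioc a s := by
      ext r
      exact ⟨fun h => ⟨h.2.1, h.1⟩, fun h => ⟨h.2, h.1, h.2.trans hs.2⟩⟩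
    simp_rw [e]
    rw [integral_indicator measurableSet_Iic, hμ, Measure.restrict_restrict measurableSet_Iic,
      intervalIntegral.integral_of_le hs.1.le, integral_const_mul, hset]
  have h2 : ∀ r ∈ Ioc a b, (∫ s in r..b, g s) * w r = ∫ s, f s r ∂μ := by
    intro r hr
    have e : ∀ s, f s r = indicator (Ici r) (fun s => g s * w r) s := by
      intro s
      simp only [f, indicator, mem_ofPred_eq, mem_Ici]
    have hset : Ici r ∩ Ioc a b = Icc r b := by
      ext s
      exact ⟨fun h => ⟨h.1, h.2.2⟩, fun h => ⟨h.1, hr.1.trans_le h.1, h.2⟩⟩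
    simp_rw [e]
    rw [integral_indicator measurableSet_Ici, hμ, Measure.restrict_restrict measurableSet_Ici,
      intervalIntegral.integral_of_le hr.2, integral_mul_const, hset, integral_Icc_eq_integral_Ioc]
  rw [setIntegral_congr_fun measurableSet_Ioc h1, setIntegral_congr_fun measurableSet_Ioc h2]
  exact hswap

/-! ### Linear differential equations -/

section LinearODE

variable {a b : ℝ} {E : Type*} [NormedAddCommGroup E] [NormedSpace ℝ E] [CompleteSpace E]

lemma hasDerivAt_primitive_IccExtend (hab : a ≤ b) (c : ℝ) (z : E) (X : C(Icc a b, E)) (s : ℝ) :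
    HasDerivAt (fun s => z + ∫ r in c..s, IccExtend hab X r) (IccExtend hab X s) s := by
  have hc : Continuous (IccExtend hab X) := X.continuous.Icc_extend' (h := hab)
  exact (intervalIntegral.integral_hasDerivAt_right (hc.intervalIntegrable _ _)
    (hc.stronglyMeasurableAtFilter _ _) hc.continuousAt).const_add z

lemma exists_linear_ode (hab : a ≤ b) (M : ℝ → E →L[ℝ] E) (hM : ContinuousOn M (Icc a b))
    {c : ℝ} (hc : c ∈ Icc a b) (z : E) :
    ∃ Z : ℝ → E, Z c = z ∧ ∀ s ∈ Icc a b, HasDerivWithinAt Z (M s (Z s)) (Icc a b) s := by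
  let MC : C(Icc a b, E →L[ℝ] E) := ⟨_, hM.domRestrict⟩
  obtain ⟨H, hH⟩ := (linVolterra_bijective hab ⟨c, hc⟩ MC).2 (ContinuousMap.const _ z)
  let Z : ℝ → E := fun s => z + ∫ r in c..s, IccExtend hab (pointwiseApply MC H) r
  have hZ : ∀ s (hs : s ∈ Icc a b), Z s = H ⟨s, hs⟩ := by
    intro s hs
    have h1 := congrArg (fun X : C(Icc a b, E) => X ⟨s, hs⟩) hH
    simp only [linVolterra, sub_apply, ContinuousMap.sub_apply, ContinuousLinearMap.comp_apply,
      ContinuousLinearMap.id_apply, volterra_apply, ContinuousMap.const_apply] at h1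
    rw [sub_eq_iff_eq_add] at h1
    exact h1.symm
  refine ⟨Z, by simp [Z], fun s hs => ?_⟩
  have h1 := (hasDerivAt_primitive_IccExtend hab c z (pointwiseApply MC H) s).hasDerivWithinAt
    (s := Icc a b)
  rw [IccExtend_of_mem _ _ hs, pointwiseApply_apply, ← hZ s hs] at h1
  exact h1

lemma eq_left_of_hasDerivWithinAt_zero {f : ℝ → E}
    (hf : ∀ s ∈ Icc a b, HasDerivWithinAt f 0 (Icc a b) s) {s : ℝ} (hs : s ∈ Icc a b) :
    f s = f a :=
  constant_of_has_deriv_right_zero (fun s hs => (hf s hs).continuousWithinAt)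
    (fun s hs => (hf s (Ico_subset_Icc_self hs)).mono_of_mem_nhdsWithin
      (Icc_mem_nhdsGE_of_mem hs)) s hs

lemma integral_eq_sub_of_hasDerivWithinAt_Icc {f f' : ℝ → E}
    (hf : ∀ s ∈ Icc a b, HasDerivWithinAt f (f' s) (Icc a b) s)
    (hf' : ContinuousOn f' (Icc a b)) {c d : ℝ} (hc : c ∈ Icc a b) (hd : d ∈ Icc a b)
    (hcd : c ≤ d) : ∫ s in c..d, f' s = f d - f c := by
  have hsub : Icc c d ⊆ Icc a b := Icc_subset_Icc hc.1 hd.2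
  refine intervalIntegral.integral_eq_sub_of_hasDerivAt_of_le hcd
    (fun s hs => ((hf s (hsub hs)).continuousWithinAt).mono hsub) (fun s hs => ?_)
    (ContinuousOn.intervalIntegrable (by rw [uIcc_of_le hcd]; exact hf'.mono hsub))
  exact (hf s (hsub (Ioo_subset_Icc_self hs))).hasDerivAt
    (Icc_mem_nhds (hc.1.trans_lt hs.1) (hs.2.trans_le hd.2))

variable {n : ℕ}

/-- A fundamental matrix, factored into the solutions of the equation and of its dual. -/
lemma exists_fundamental (hab : a ≤ b) (M : ℝ → Vec n →L[ℝ] Vec n)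
    (hM : ContinuousOn M (Icc a b)) :
    ∃ Z W : ℝ → Vec n →L[ℝ] Vec n,
      (∀ s ∈ Icc a b, HasDerivWithinAt Z (M s ∘L Z s) (Icc a b) s) ∧
      (∀ s ∈ Icc a b, HasDerivWithinAt W (-(W s ∘L M s)) (Icc a b) s) ∧
      (∀ s ∈ Icc a b, W s ∘L Z s = ContinuousLinearMap.id ℝ _) ∧
      (∀ s ∈ Icc a b, Z s ∘L W s = ContinuousLinearMap.id ℝ _) := by
  have ha : a ∈ Icc a b := ⟨le_rfl, hab⟩
  let cL := ContinuousLinearMap.compL ℝ (Vec n) (Vec n) (Vec n)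
  obtain ⟨Z, hZa, hZ⟩ := exists_linear_ode hab (fun s => cL (M s))
    (cL.continuous.comp_continuousOn hM) ha (ContinuousLinearMap.id ℝ (Vec n))
  obtain ⟨W, hWa, hW⟩ := exists_linear_ode hab (fun s => -(cL.flip (M s)))
    (cL.flip.continuous.comp_continuousOn hM).neg ha (ContinuousLinearMap.id ℝ (Vec n))
  have hZ' : ∀ s ∈ Icc a b, HasDerivWithinAt Z (M s ∘L Z s) (Icc a b) s := hZ
  have hW' : ∀ s ∈ Icc a b, HasDerivWithinAt W (-(W s ∘L M s)) (Icc a b) s := hW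
  have hWZ : ∀ s ∈ Icc a b, W s ∘L Z s = ContinuousLinearMap.id ℝ _ := by
    intro s hs
    have h0 : ∀ s ∈ Icc a b, HasDerivWithinAt (fun s => W s ∘L Z s) 0 (Icc a b) s := by
      intro s hs
      refine ((hW' s hs).clm_comp (hZ' s hs)).congr_deriv ?_
      ext1 v
      simp
    rw [eq_left_of_hasDerivWithinAt_zero h0 hs, hZa, hWa]
    rfl
  refine ⟨Z, W, hZ', hW', hWZ, fun s hs => ?_⟩
  have h1 := hWZ s hs
  have h2 : (W s : Vec n →ₗ[ℝ] Vec n) * (Z s : Vec n →ₗ[ℝ] Vec n) = 1 := by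
    ext1 v
    exact congrArg (fun L : Vec n →L[ℝ] Vec n => L v) h1
  have h3 := mul_eq_one_comm.1 h2
  ext1 v
  exact congrArg (fun L : Vec n →ₗ[ℝ] Vec n => L v) h3

end LinearODE

end AQ

namespace AQ

open Filter Topology

/-! ### The Hilbert-Schmidt type estimate -/

section Gram

variable {n m : ℕ} {a b : ℝ}

lemma integral_inner_kernel_le (hab : a ≤ b) {κ : ℝ → ℝ → Vec m →L[ℝ] Vec m}
    (hκ : Continuous fun q : ℝ × ℝ => κ q.1 q.2) {v : ℝ → Vec m} (hv : Continuous v) :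
    ∫ r in a..b, ⟪∫ r' in a..b, κ r r' (v r'), v r⟫ ≤
      √(∫ r in a..b, ∫ r' in a..b, ‖κ r r'‖ ^ 2) * ∫ r in a..b, ‖v r‖ ^ 2 := by
  have hκ1 : ∀ r, Continuous (κ r) := fun r => hκ.comp (Continuous.prodMk_right r)
  have hκn : Continuous fun q : ℝ × ℝ => ‖κ q.1 q.2‖ ^ 2 := hκ.norm.pow 2
  have hnn : ∀ r, 0 ≤ ∫ r' in a..b, ‖κ r r'‖ ^ 2 := fun r =>
    intervalIntegral.integral_nonneg hab fun _ _ => sq_nonneg _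
  have hA2 : Continuous fun r => ∫ r' in a..b, ‖κ r r'‖ ^ 2 :=
    intervalIntegral.continuous_parametric_intervalIntegral_of_continuous' hκn a b
  obtain ⟨A, hAdef⟩ : ∃ A : ℝ → ℝ, A = fun r => √(∫ r' in a..b, ‖κ r r'‖ ^ 2) := ⟨_, rfl⟩
  have hA : Continuous A := by rw [hAdef]; exact hA2.sqrt
  obtain ⟨N, hN⟩ : ∃ N, N = √(∫ r in a..b, ‖v r‖ ^ 2) := ⟨_, rfl⟩
  have hN0 : 0 ≤ N := by rw [hN]; exact Real.sqrt_nonneg _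
  have hNN : N * N = ∫ r in a..b, ‖v r‖ ^ 2 := by
    rw [hN]
    exact Real.mul_self_sqrt (intervalIntegral.integral_nonneg hab fun _ _ => sq_nonneg _)
  have hκv : Continuous fun q : ℝ × ℝ => κ q.1 q.2 (v q.2) :=
    hκ.clm_apply (hv.comp continuous_snd)
  have hI : Continuous fun r => ∫ r' in a..b, κ r r' (v r') :=
    intervalIntegral.continuous_parametric_intervalIntegral_of_continuous' hκv a b
  have h2 : ∀ r ∈ Icc a b, ⟪∫ r' in a..b, κ r r' (v r'), v r⟫ ≤ N * (A r * ‖v r‖) := by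
    intro r _
    refine (real_inner_le_norm _ _).trans ?_
    have c1 : Continuous fun r' => κ r r' (v r') := (hκ1 r).clm_apply hv
    have h4 : ‖∫ r' in a..b, κ r r' (v r')‖ ≤ A r * N := by
      refine (intervalIntegral.norm_integral_le_integral_norm hab).trans ?_
      rw [hAdef, hN]
      refine le_trans ?_ (integral_mul_le_sqrt hab (hκ1 r).norm.continuousOn hv.norm.continuousOn)
      exact intervalIntegral.integral_mono_on hab (c1.norm.intervalIntegrable _ _)
        (((hκ1 r).norm.mul hv.norm).intervalIntegrable _ _)
        (fun r' _ => ContinuousLinearMap.le_opNorm _ _)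
    calc ‖∫ r' in a..b, κ r r' (v r')‖ * ‖v r‖ ≤ (A r * N) * ‖v r‖ := by gcongr
      _ = _ := by ring
  have h5 : ∫ r in a..b, ⟪∫ r' in a..b, κ r r' (v r'), v r⟫ ≤
      ∫ r in a..b, N * (A r * ‖v r‖) :=
    intervalIntegral.integral_mono_on hab ((hI.inner hv).intervalIntegrable _ _)
      ((continuous_const.mul (hA.mul hv.norm)).intervalIntegrable _ _) h2
  have h6 := integral_mul_le_sqrt hab hA.continuousOn hv.norm.continuousOn
  have h7 : ∫ r in a..b, A r ^ 2 = ∫ r in a..b, ∫ r' in a..b, ‖κ r r'‖ ^ 2 := by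
    congr 1
    ext r
    rw [hAdef]
    exact Real.sq_sqrt (hnn r)
  rw [h7, ← hN] at h6
  refine h5.trans ?_
  rw [intervalIntegral.integral_const_mul, ← hNN]
  calc N * ∫ r in a..b, A r * ‖v r‖ ≤ N * (√(∫ r in a..b, ∫ r' in a..b, ‖κ r r'‖ ^ 2) * N) :=
        mul_le_mul_of_nonneg_left h6 hN0
    _ = _ := by ring

lemma inner_integral_le_gram_of_continuous (hab : a ≤ b) (P : Vec n →L[ℝ] Vec n)
    {ψ : ℝ → Vec m →L[ℝ] Vec n} (hψ : Continuous ψ) {v : ℝ → Vec m} (hv : Continuous v) :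
    ⟪P (∫ r in a..b, ψ r (v r)), ∫ r in a..b, ψ r (v r)⟫ ≤
      √(∫ r in a..b, ∫ r' in a..b, ‖ContinuousLinearMap.adjoint (ψ r) ∘L P ∘L ψ r'‖ ^ 2) *
        ∫ r in a..b, ‖v r‖ ^ 2 := by
  have hadj : Continuous fun r => ContinuousLinearMap.adjoint (ψ r) :=
    ContinuousLinearMap.adjoint.continuous.comp hψ
  have hPψ : Continuous fun r => P ∘L ψ r :=
    (ContinuousLinearMap.compL ℝ (Vec m) (Vec n) (Vec n) P).continuous.comp hψ
  have hadj1 : Continuous fun q : ℝ × ℝ => ContinuousLinearMap.adjoint (ψ q.1) :=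
    hadj.comp continuous_fst
  have hPψ2 : Continuous fun q : ℝ × ℝ => P ∘L ψ q.2 := hPψ.comp continuous_snd
  have hκ : Continuous fun q : ℝ × ℝ =>
      ContinuousLinearMap.adjoint (ψ q.1) ∘L (P ∘L ψ q.2) := hadj1.clm_comp hPψ2
  refine le_of_eq_of_le ?_ (integral_inner_kernel_le
    (κ := fun r r' => ContinuousLinearMap.adjoint (ψ r) ∘L (P ∘L ψ r')) hab hκ hv)
  have hψv : IntervalIntegrable (fun r => ψ r (v r)) volume a b :=
    (hψ.clm_apply hv).intervalIntegrable a b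
  have h1 := (innerSL ℝ (P (∫ r in a..b, ψ r (v r)))).intervalIntegral_comp_comm hψv
  simp only [innerSL_apply_apply] at h1
  rw [← h1]
  refine intervalIntegral.integral_congr fun r _ => ?_
  have h3 := (ContinuousLinearMap.adjoint (ψ r) ∘L P).intervalIntegral_comp_comm hψv
  simp only [ContinuousLinearMap.comp_apply] at h3 ⊢
  rw [h3, ContinuousLinearMap.adjoint_inner_left]

lemma inner_integral_le_gram (hab : a ≤ b) (P : Vec n →L[ℝ] Vec n)
    {ψ : ℝ → Vec m →L[ℝ] Vec n} (hψ : ContinuousOn ψ (Icc a b)) {v : ℝ → Vec m}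
    (hv : ContinuousOn v (Icc a b)) :
    ⟪P (∫ r in a..b, ψ r (v r)), ∫ r in a..b, ψ r (v r)⟫ ≤
      √(∫ r in a..b, ∫ r' in a..b, ‖ContinuousLinearMap.adjoint (ψ r) ∘L P ∘L ψ r'‖ ^ 2) *
        ∫ r in a..b, ‖v r‖ ^ 2 := by
  have h := inner_integral_le_gram_of_continuous hab P
    (hψ.domRestrict.Icc_extend' (h := hab)) (hv.domRestrict.Icc_extend' (h := hab))
  have eψ : ∀ r ∈ Icc a b, IccExtend hab ((Icc a b).domRestrict ψ) r = ψ r := fun r hr => by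
    rw [IccExtend_of_mem _ _ hr]; rfl
  have ev : ∀ r ∈ Icc a b, IccExtend hab ((Icc a b).domRestrict v) r = v r := fun r hr => by
    rw [IccExtend_of_mem _ _ hr]; rfl
  have hu : uIcc a b = Icc a b := uIcc_of_le hab
  have e1 : ∫ r in a..b, IccExtend hab ((Icc a b).domRestrict ψ) r
      (IccExtend hab ((Icc a b).domRestrict v) r) = ∫ r in a..b, ψ r (v r) :=
    intervalIntegral.integral_congr fun r hr => by
      rw [hu] at hr; simp only [eψ r hr, ev r hr]
  have e2 : ∫ r in a..b, ‖IccExtend hab ((Icc a b).domRestrict v) r‖ ^ 2 =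
      ∫ r in a..b, ‖v r‖ ^ 2 :=
    intervalIntegral.integral_congr fun r hr => by
      rw [hu] at hr; simp only [ev r hr]
  have e3 : (∫ r in a..b, ∫ r' in a..b,
      ‖ContinuousLinearMap.adjoint (IccExtend hab ((Icc a b).domRestrict ψ) r) ∘L P ∘L
        IccExtend hab ((Icc a b).domRestrict ψ) r'‖ ^ 2) =
      ∫ r in a..b, ∫ r' in a..b, ‖ContinuousLinearMap.adjoint (ψ r) ∘L P ∘L ψ r'‖ ^ 2 :=
    intervalIntegral.integral_congr fun r hr => by
      rw [hu] at hr
      refine intervalIntegral.integral_congr fun r' hr' => ?_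
      rw [hu] at hr'
      simp only [eψ r hr, eψ r' hr']
  rw [e1, e2, e3] at h
  exact h

end Gram

namespace Problem

variable {n m : ℕ} {p : Problem n m} {T : ℝ}

/-! ### The second variation -/

/-- The second variation of the cost along the extremal `(X,Y)` in the direction `v`, whose
linearized state is `ξ`. -/
def secondVariation (p : Problem n m) (T t : ℝ) (X Y ξ : ℝ → Vec n) (v : ℝ → Vec m) : ℝ :=
  (∫ s in t..T, (p.Qxx s (X s) (ξ s) (ξ s) +
      ⟪p.feedback s (X s) (Y s), p.Sxx s (X s) (ξ s) (ξ s)⟫ +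
      ⟪Y s, p.Axx s (X s) (ξ s) (ξ s)⟫ + 2 * ⟪p.Sx s (X s) (ξ s), v s⟫ +
      ⟪p.R s (v s), v s⟫)) +
    p.Gxx (X T) (ξ T) (ξ T)

lemma completing_square (hC : p.CostHyp T) {s : ℝ} (hs : s ∈ Icc 0 T) {β : ℝ} (hβ : 0 < β)
    (z w : Vec m) :
    0 ≤ 2 * ⟪z, w⟫ + β * ⟪p.R s w, w⟫ + β⁻¹ * ⟪p.Rinv s z, z⟫ := by
  have h1 := inner_R_nonneg hC hs (β • w + p.Rinv s z)
  have e0 : ⟪p.R s w, p.Rinv s z⟫ = ⟪w, z⟫ := by rw [inner_R_comm hC hs, R_Rinv hC hs]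
  rw [map_add, map_smul, R_Rinv hC hs, inner_add_left, inner_add_right, inner_add_right,
    inner_smul_left, inner_smul_right, inner_smul_left, inner_smul_right, e0] at h1
  simp only [conj_trivial] at h1
  have h2 : 0 ≤ β⁻¹ * (β * (β * ⟪p.R s w, w⟫) + β * ⟪w, z⟫ + (β * ⟪w, z⟫ + ⟪p.Rinv s z, z⟫)) := by
    have : 0 ≤ β * (β * ⟪p.R s w, w⟫) + β * ⟪w, z⟫ + (β * ⟪w, z⟫ + ⟪p.Rinv s z, z⟫) := by
      have e1 : ⟪z, w⟫ = ⟪w, z⟫ := real_inner_comm _ _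
      have e2 : ⟪z, p.Rinv s z⟫ = ⟪p.Rinv s z, z⟫ := real_inner_comm _ _
      rw [e1, e2] at h1
      exact h1
    positivity
  have h3 : β⁻¹ * (β * (β * ⟪p.R s w, w⟫) + β * ⟪w, z⟫ + (β * ⟪w, z⟫ + ⟪p.Rinv s z, z⟫)) =
      2 * ⟪w, z⟫ + β * ⟪p.R s w, w⟫ + β⁻¹ * ⟪p.Rinv s z, z⟫ := by
    field_simp
    ring
  rw [real_inner_comm w z]
  linarith

lemma integrand_ge (hC : p.CostHyp T) {K₀ α : ℝ} (hK₀ : 0 < K₀) (hα : α ∈ Ioo (0:ℝ) 1)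
    {Qbar : ℝ → Vec n →L[ℝ] Vec n} (hR : p.RunningSemiconvex T K₀ α Qbar) {s : ℝ}
    (hs : s ∈ Icc 0 T) {x y ξ : Vec n} (hy : ‖y‖ ≤ K₀ * (1 + ‖x‖)) (v : Vec m) :
    α * ⟪p.R s v, v⟫ - ⟪Qbar s ξ, ξ⟫ ≤
      p.Qxx s x ξ ξ + ⟪p.feedback s x y, p.Sxx s x ξ ξ⟫ + ⟪y, p.Axx s x ξ ξ⟫ +
        2 * ⟪p.Sx s x ξ, v⟫ + ⟪p.R s v, v⟫ := by
  have h1 := hR s hs x ξ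
  have h2 := completing_square hC hs (sub_pos.2 hα.2) (p.Sx s x ξ) v
  have h3 : ⟪p.feedback s x y, p.Sxx s x ξ ξ⟫ + ⟪y, p.Axx s x ξ ξ⟫ =
      ⟪y, p.driftHess s x ξ ξ⟫ - ⟪p.Rinv s (p.S s x), p.Sxx s x ξ ξ⟫ := by
    have e1 : p.driftHess s x ξ ξ = p.Axx s x ξ ξ - p.B s (p.Rinv s (p.Sxx s x ξ ξ)) := rfl
    rw [e1, feedback, map_add, inner_neg_left, inner_add_left, inner_sub_right,
      inner_Rinv_comm hC hs (ContinuousLinearMap.adjoint (p.B s) y),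
      ContinuousLinearMap.adjoint_inner_left]
    ring
  have h4 : -(K₀ * (1 + ‖x‖) * ‖p.driftHess s x‖ * ‖ξ‖ ^ 2) ≤ ⟪y, p.driftHess s x ξ ξ⟫ := by
    refine neg_le_of_abs_le ((abs_real_inner_le_norm _ _).trans ?_)
    have e2 : ‖p.driftHess s x ξ ξ‖ ≤ ‖p.driftHess s x‖ * ‖ξ‖ * ‖ξ‖ :=
      ContinuousLinearMap.le_opNorm₂ _ _ _
    calc ‖y‖ * ‖p.driftHess s x ξ ξ‖ ≤ (K₀ * (1 + ‖x‖)) * (‖p.driftHess s x‖ * ‖ξ‖ * ‖ξ‖) := by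
          gcongr
      _ = _ := by ring
  linarith

variable {t : ℝ} {x : Vec n} {X Y : ℝ → Vec n}

lemma continuousOn_slab_comp {F : Type*} [TopologicalSpace F] {f : ℝ → Vec n → F}
    (hf : ContinuousOn (fun z : ℝ × Vec n => f z.1 z.2) (Icc 0 T ×ˢ univ)) {I : Set ℝ}
    (hI : I ⊆ Icc 0 T) {X : ℝ → Vec n} (hX : ContinuousOn X I) :
    ContinuousOn (fun s => f s (X s)) I :=
  hf.comp (continuousOn_id.prodMk hX) fun _ hs => ⟨hI hs, mem_univ _⟩

lemma continuousOn_feedback (h : p.StandingHyp T) {I : Set ℝ} (hI : I ⊆ Icc 0 T)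
    (hX : ContinuousOn X I) (hY : ContinuousOn Y I) :
    ContinuousOn (fun s => p.feedback s (X s) (Y s)) I := by
  have h1 : ContinuousOn (fun s => ContinuousLinearMap.adjoint (p.B s)) I :=
    ContinuousLinearMap.adjoint.continuous.comp_continuousOn
      (h.smooth.smoothB.continuousOn.mono hI)
  exact (((contDiffOn_Rinv h.cost h.smooth).continuousOn.mono hI).clm_apply
    ((h1.clm_apply hY).add (continuousOn_slab_comp h.smooth.smoothS.continuousOn hI hX))).neg

lemma continuousOn_secondVariation (h : p.StandingHyp T) {I : Set ℝ} (hI : I ⊆ Icc 0 T)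
    (hX : ContinuousOn X I) (hY : ContinuousOn Y I) {ξ : ℝ → Vec n} {v : ℝ → Vec m}
    (hξ : ContinuousOn ξ I) (hv : ContinuousOn v I) :
    ContinuousOn (fun s => p.Qxx s (X s) (ξ s) (ξ s) +
      ⟪p.feedback s (X s) (Y s), p.Sxx s (X s) (ξ s) (ξ s)⟫ +
      ⟪Y s, p.Axx s (X s) (ξ s) (ξ s)⟫ + 2 * ⟪p.Sx s (X s) (ξ s), v s⟫ +
      ⟪p.R s (v s), v s⟫) I := by
  have c1 := continuousOn_slab_comp (continuousOn_Qxx h.pos h.smooth) hI hX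
  have c2 := continuousOn_slab_comp (continuousOn_Sxx h.pos h.smooth) hI hX
  have c3 := continuousOn_slab_comp (continuousOn_Axx h.pos h.smooth) hI hX
  have c4 := continuousOn_slab_comp (contDiffOn_Sx h.pos h.smooth).continuousOn hI hX
  have c5 := h.smooth.smoothR.continuousOn.mono hI
  have c6 := continuousOn_feedback h hI hX hY
  have d1 := (c1.clm_apply hξ).clm_apply hξ
  have d2 := c6.inner ((c2.clm_apply hξ).clm_apply hξ) (𝕜 := ℝ)
  have d3 := hY.inner ((c3.clm_apply hξ).clm_apply hξ) (𝕜 := ℝ)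
  have d4 := (c4.clm_apply hξ).inner hv (𝕜 := ℝ)
  have d5 := (c5.clm_apply hv).inner hv (𝕜 := ℝ)
  exact (((d1.add d2).add d3).add (continuousOn_const.mul d4)).add d5

/-- The second variation is coercive under the semi-convexity conditions. -/
theorem secondVariation_ge (h : p.StandingHyp T) (ht : t ∈ Icc 0 T) {K₀ α δ : ℝ} (hK₀ : 0 < K₀)
    (hK : p.AdjointBound T K₀) (hα : α ∈ Ioo (0:ℝ) 1) {Gbar : Vec n →L[ℝ] Vec n}
    {Qbar : ℝ → Vec n →L[ℝ] Vec n} (hG : p.TerminalSemiconvex Gbar)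
    (hW : p.ControlWeightPositive T α δ Gbar Qbar) (hR : p.RunningSemiconvex T K₀ α Qbar)
    (hE : p.IsExtremal T t x X Y) {ξ : ℝ → Vec n} {v : ℝ → Vec m}
    (hv : ContinuousOn v (Icc t T)) (hξt : ξ t = 0)
    (hξ : ∀ s ∈ Icc t T, HasDerivWithinAt ξ (p.Ax s (X s) (ξ s) + p.B s (v s)) (Icc t T) s) :
    δ * ∫ s in t..T, ‖v s‖ ^ 2 ≤ p.secondVariation T t X Y ξ v := by
  have hsub : Icc t T ⊆ Icc 0 T := Icc_subset_Icc_left ht.1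
  have htt : t ∈ Icc t T := ⟨le_rfl, ht.2⟩
  have hTT : T ∈ Icc t T := ⟨ht.2, le_rfl⟩
  have hXc := hE.continuousOn_state
  have hYc := hE.continuousOn_adjoint
  have hξc : ContinuousOn ξ (Icc t T) := fun s hs => (hξ s hs).continuousWithinAt
  have hBc := h.smooth.smoothB.continuousOn.mono hsub
  have hMc := continuousOn_slab_comp (contDiffOn_Ax h.pos h.smooth).continuousOn hsub hXc
  obtain ⟨Z, W, hZ, hWd, hWZ, hZW⟩ := exists_fundamental ht.2 (fun s => p.Ax s (X s)) hMc
  have hWc : ContinuousOn W (Icc t T) := fun s hs => (hWd s hs).continuousWithinAt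
  let Φ : ℝ → ℝ → Vec n →L[ℝ] Vec n := fun s τ => Z s ∘L W τ
  have hΦ : IsFundamental (fun s => p.Ax s (X s)) T t Φ := by
    intro τ hτ
    refine ⟨hZW τ hτ, fun s hs => ?_⟩
    have hs' : s ∈ Icc t T := ⟨hτ.1.trans hs.1, hs.2⟩
    have h1 := ((hZ s hs').mono (Icc_subset_Icc_left hτ.1)).clm_comp
      (hasDerivWithinAt_const s (Icc τ T) (W τ))
    refine h1.congr_deriv ?_
    ext1 w
    simp [Φ]
  have hξrep : ∀ τ ∈ Icc t T, ξ τ = ∫ r in t..τ, (Φ τ r ∘L p.B r) (v r) := by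
    intro τ hτ
    have h1 : ∀ s ∈ Icc t T, HasDerivWithinAt (fun s => W s (ξ s)) (W s (p.B s (v s)))
        (Icc t T) s := by
      intro s hs
      refine ((hWd s hs).clm_apply (hξ s hs)).congr_deriv ?_
      simp
    have h2 := integral_eq_sub_of_hasDerivWithinAt_Icc h1 (hWc.clm_apply (hBc.clm_apply hv))
      htt hτ hτ.1
    rw [hξt, map_zero, sub_zero] at h2
    have h3 : ContinuousOn (fun s => W s (p.B s (v s))) (uIcc t τ) := by
      rw [uIcc_of_le hτ.1]
      exact (hWc.clm_apply (hBc.clm_apply hv)).mono (Icc_subset_Icc_right hτ.2)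
    have h4 := (Z τ).intervalIntegral_comp_comm (h3.intervalIntegrable (μ := volume))
    have h5 : ξ τ = Z τ (W τ (ξ τ)) := by
      have := congrArg (fun L : Vec n →L[ℝ] Vec n => L (ξ τ)) (hZW τ hτ)
      exact this.symm
    rw [h5, ← h2, ← h4]
    rfl
  have hgram : ∀ (P : Vec n →L[ℝ] Vec n), ∀ τ ∈ Icc t T, ⟪P (ξ τ), ξ τ⟫ ≤
      p.gram t τ Φ P * ∫ r in t..τ, ‖v r‖ ^ 2 := by
    intro P τ hτ
    have hs' : Icc t τ ⊆ Icc t T := Icc_subset_Icc_right hτ.2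
    have h1 := inner_integral_le_gram hτ.1 P (ψ := fun r => Φ τ r ∘L p.B r) (v := v)
      ((continuousOn_const.clm_comp (hWc.mono hs')).clm_comp (hBc.mono hs')) (hv.mono hs')
    rw [hξrep τ hτ]
    refine h1.trans (le_of_eq ?_)
    rw [gram]
    congr 3
    ext r
    congr 1
    ext r'
    rw [ContinuousLinearMap.adjoint_comp]
    rfl
  obtain ⟨hint, hpos⟩ := hW t ht x X Y Φ hE hΦ
  set N : ℝ → ℝ := fun τ => ∫ r in t..τ, ‖v r‖ ^ 2 with hN
  set g : ℝ → ℝ := fun τ => p.gram t τ Φ (Qbar τ) with hg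
  have hu : uIcc t T = Icc t T := uIcc_of_le ht.2
  have hv2 : IntervalIntegrable (fun r => ‖v r‖ ^ 2) volume t T :=
    ContinuousOn.intervalIntegrable (by rw [hu]; exact hv.norm.pow 2)
  have hNc : ContinuousOn N (uIcc t T) :=
    intervalIntegral.continuousOn_primitive_interval' hv2 left_mem_uIcc
  have hgN : IntervalIntegrable (fun s => g s * N s) volume t T := hint.mul_continuousOn hNc
  have hRv : IntervalIntegrable (fun s => ⟪p.R s (v s), v s⟫) volume t T := by
    apply ContinuousOn.intervalIntegrable
    rw [hu]
    exact ((h.smooth.smoothR.continuousOn.mono hsub).clm_apply hv).inner hv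
  have hlow : ∫ s in t..T, (α * ⟪p.R s (v s), v s⟫ - g s * N s) ≤
      ∫ s in t..T, (p.Qxx s (X s) (ξ s) (ξ s) +
      ⟪p.feedback s (X s) (Y s), p.Sxx s (X s) (ξ s) (ξ s)⟫ +
      ⟪Y s, p.Axx s (X s) (ξ s) (ξ s)⟫ + 2 * ⟪p.Sx s (X s) (ξ s), v s⟫ +
      ⟪p.R s (v s), v s⟫) := by
    refine intervalIntegral.integral_mono_on ht.2 ((hRv.const_mul α).sub hgN) ?_ ?_
    · apply ContinuousOn.intervalIntegrable
      rw [hu]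
      exact continuousOn_secondVariation h hsub hXc hYc hξc hv
    · intro s hs
      refine le_trans ?_ (integrand_ge h.cost hK₀ hα hR (hsub hs) (hK t ht x X Y hE s hs) (v s))
      have := hgram (Qbar s) s hs
      linarith
  have hterm : -(p.Ghat T t Φ Gbar * N T) ≤ p.Gxx (X T) (ξ T) (ξ T) := by
    have h1 := hG (X T) (ξ T)
    have h2 := hgram Gbar T hTT
    change -(p.gram t T Φ Gbar * N T) ≤ _
    linarith
  have hfub : ∫ s in t..T, g s * N s = ∫ s in t..T, p.Qhat T s t Φ Qbar * ‖v s‖ ^ 2 :=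
    integral_mul_primitive ht.2 hint hv2
  have hQc : ContinuousOn (fun s => p.Qhat T s t Φ Qbar) (uIcc t T) := by
    have h1 := (intervalIntegral.continuousOn_primitive_interval' (a := T) hint
      right_mem_uIcc).neg
    refine h1.congr fun s _ => ?_
    rw [Qhat, intervalIntegral.integral_symm]
    rfl
  have hQv : IntervalIntegrable (fun s => p.Qhat T s t Φ Qbar * ‖v s‖ ^ 2) volume t T :=
    hv2.continuousOn_mul hQc
  have hfin : ∫ s in t..T, δ * ‖v s‖ ^ 2 ≤ ∫ s in t..T, (α * ⟪p.R s (v s), v s⟫ -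
      (p.Ghat T t Φ Gbar * ‖v s‖ ^ 2 + p.Qhat T s t Φ Qbar * ‖v s‖ ^ 2)) := by
    refine intervalIntegral.integral_mono_on ht.2 (hv2.const_mul δ)
      ((hRv.const_mul α).sub ((hv2.const_mul _).add hQv)) ?_
    intro s hs
    have := hpos s hs (v s)
    linarith
  rw [intervalIntegral.integral_const_mul,
    intervalIntegral.integral_sub (hRv.const_mul α) ((hv2.const_mul _).add hQv),
    intervalIntegral.integral_add (hv2.const_mul _) hQv, intervalIntegral.integral_const_mul,
    intervalIntegral.integral_const_mul] at hfin
  rw [intervalIntegral.integral_sub (hRv.const_mul α) hgN, intervalIntegral.integral_const_mul,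
    hfub] at hlow
  rw [secondVariation]
  have hNT : N T = ∫ s in t..T, ‖v s‖ ^ 2 := rfl
  rw [hNT] at hterm
  linarith

end Problem

end AQ

namespace AQ

open Filter Topology

lemma hasDerivWithinAt_of_eq_integral {E : Type*} [NormedAddCommGroup E] [NormedSpace ℝ E]
    [CompleteSpace E] {a b : ℝ} (hab : a ≤ b) {f X : ℝ → E} {z : E}
    (hf : ContinuousOn f (Icc a b)) (hX : ∀ s ∈ Icc a b, X s = z + ∫ r in a..s, f r) {s : ℝ}
    (hs : s ∈ Icc a b) : HasDerivWithinAt X (f s) (Icc a b) s := by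
  let F : C(Icc a b, E) := ⟨_, hf.domRestrict⟩
  have hF : ∀ r ∈ Icc a b, IccExtend hab F r = f r := fun r hr => by
    rw [IccExtend_of_mem _ _ hr]; rfl
  have h1 := (hasDerivAt_primitive_IccExtend hab a z F s).hasDerivWithinAt (s := Icc a b)
  rw [hF s hs] at h1
  have h2 : ∀ r ∈ Icc a b, X r = z + ∫ r in a..r, IccExtend hab F r := by
    intro r hr
    rw [hX r hr]
    congr 1
    refine intervalIntegral.integral_congr fun q hq => ?_
    exact (hF q (uIcc_subset_Icc ⟨le_rfl, hab⟩ hr hq)).symm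
  exact h1.congr h2 (h2 s hs)

lemma norm_toL2_sq {m : ℕ} {a b : ℝ} (hab : a ≤ b) (v : C(Icc a b, Vec m)) :
    ‖toL2 hab v‖ ^ 2 = ∫ s in a..b, ‖IccExtend hab v s‖ ^ 2 := by
  rw [← real_inner_self_eq_norm_sq, L2.inner_def, intervalIntegral.integral_of_le hab,
    ← integral_Icc_eq_integral_Ioc]
  apply integral_congr_ae
  filter_upwards [coeFn_toL2 hab v] with s hs
  rw [hs, real_inner_self_eq_norm_sq]

lemma denseRange_toL2 {m : ℕ} {a b : ℝ} (hab : a ≤ b) :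
    DenseRange (toL2 (E := Vec m) hab) := by
  have h1 := Lp.boundedContinuousFunction_dense (E := Vec m) (p := 2)
    (μ := volume.restrict (Icc a b)) (by norm_num)
  refine h1.mono ?_
  intro u hu
  obtain ⟨f, hf⟩ := Lp.mem_boundedContinuousFunction_iff.1 hu
  refine ⟨⟨fun s => f s, by fun_prop⟩, ?_⟩
  apply Lp.ext
  refine (coeFn_toL2 hab _).trans ?_
  rw [← hf]
  filter_upwards [f.toContinuousMap.coeFn_toAEEqFun (volume.restrict (Icc a b)),
    ae_restrict_mem measurableSet_Icc] with s hs hsm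
  rw [hs, IccExtend_of_mem _ _ hsm]
  rfl

/-- A twice differentiable function whose increments are `ε² q(ε)` has second derivative
`2 q(0)`. -/
lemma second_deriv_eq_of_tendsto {φ φ' : ℝ → ℝ} {j q : ℝ} (h1 : ∀ ε, HasDerivAt φ (φ' ε) ε)
    (h2 : HasDerivAt φ' j 0)
    (hq : Tendsto (fun ε => (φ ε - φ 0) / ε ^ 2) (𝓝[≠] 0) (𝓝 q)) : j = 2 * q := by
  have h0 : φ' 0 = 0 := by
    have h3 := hasDerivAt_iff_tendsto_slope.1 (h1 0)
    have h4 : Tendsto (fun ε : ℝ => ε * ((φ ε - φ 0) / ε ^ 2)) (𝓝[≠] 0) (𝓝 (0 * q)) :=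
      (tendsto_id.mono_left nhdsWithin_le_nhds).mul hq
    rw [zero_mul] at h4
    refine tendsto_nhds_unique (h3.congr' ?_) h4
    filter_upwards [self_mem_nhdsWithin] with ε hε
    have : ε ≠ 0 := hε
    rw [slope_def_field]
    field_simp
    simp
  have h5 := hasDerivAt_iff_tendsto_slope.1 h2
  have h6 : Tendsto (fun ε => φ' ε / (2 * ε)) (𝓝[>] 0) (𝓝 (j / 2)) := by
    have h7 := (h5.mono_left (nhdsWithin_mono 0 (fun ε hε => ne_of_gt (mem_Ioi.1 hε)))).div_const 2
    refine h7.congr' ?_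
    filter_upwards [self_mem_nhdsWithin] with ε hε
    have : ε ≠ 0 := (hε : 0 < ε).ne'
    rw [slope_def_field, h0]
    field_simp
    simp
  have h8 : Tendsto (fun ε => (φ ε - φ 0) / ε ^ 2) (𝓝[>] 0) (𝓝 (j / 2)) := by
    refine HasDerivAt.lhopital_zero_nhdsGT (f' := φ') (g' := fun ε => 2 * ε) ?_ ?_ ?_ ?_ ?_ h6
    · exact Eventually.of_forall fun ε => (h1 ε).sub_const _
    · exact Eventually.of_forall fun ε => by simpa using hasDerivAt_pow 2 ε
    · filter_upwards [self_mem_nhdsWithin] with ε hε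
      have : 0 < ε := hε
      positivity
    · have : Tendsto (fun ε => φ ε - φ 0) (𝓝 0) (𝓝 (φ 0 - φ 0)) :=
        (h1 0).continuousAt.tendsto.sub_const (φ 0)
      rw [sub_self] at this
      exact this.mono_left nhdsWithin_le_nhds
    · have : Tendsto (fun ε : ℝ => ε ^ 2) (𝓝 0) (𝓝 (0 ^ 2)) := (continuous_pow 2).tendsto 0
      rw [zero_pow (by norm_num)] at this
      exact this.mono_left nhdsWithin_le_nhds
  have h9 := tendsto_nhds_unique h8
    (hq.mono_left (nhdsWithin_mono 0 (fun ε hε => ne_of_gt (mem_Ioi.1 hε))))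
  linarith

lemma segmentAverage_taylorWeight_zero {K E F : Type*} [TopologicalSpace K] [CompactSpace K]
    [LocallyCompactSpace K] [FirstCountableTopology K] [NormedAddCommGroup E] [NormedSpace ℝ E]
    [LocallyCompactSpace E] [NormedAddCommGroup F] [NormedSpace ℝ F] [CompleteSpace F]
    (f : C(K × E, F)) (s : K) (x : E) :
    segmentAverage taylorWeight f (s, (x, 0)) = (1 / 2 : ℝ) • f (s, x) := by
  change (∫ θ in (0:ℝ)..1, (1 - θ) • f (s, x + θ • (0 : E))) = _
  simp only [smul_zero, add_zero]
  rw [intervalIntegral.integral_smul_const]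
  congr 1
  rw [intervalIntegral.integral_sub (by simp) (by simp)]
  norm_num

lemma segmentAverage_one_zero {K E F : Type*} [TopologicalSpace K] [CompactSpace K]
    [LocallyCompactSpace K] [FirstCountableTopology K] [NormedAddCommGroup E] [NormedSpace ℝ E]
    [LocallyCompactSpace E] [NormedAddCommGroup F] [NormedSpace ℝ F] [CompleteSpace F]
    (f : C(K × E, F)) (s : K) (x : E) :
    segmentAverage 1 f (s, (x, 0)) = f (s, x) := by
  change (∫ θ in (0:ℝ)..1, (1 : C(ℝ, ℝ)) θ • f (s, x + θ • (0 : E))) = _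
  simp

namespace Problem

variable {n m : ℕ} {p : Problem n m} {T : ℝ} (h : p.StandingHyp T) {t : ℝ} (ht : t ∈ Icc 0 T)
  {x : Vec n} {X Y : ℝ → Vec n}

lemma isTrajectory_of_hasDerivWithinAt (h : p.StandingHyp T) (ht : t ∈ Icc 0 T)
    {u w : ℝ → Vec m} (hw : ContinuousOn w (Icc t T))
    (huw : u =ᵐ[volume.restrict (Icc t T)] w) (hXt : X t = x)
    (hX : ∀ s ∈ Icc t T, HasDerivWithinAt X (p.A s (X s) + p.B s (w s)) (Icc t T) s) :
    p.IsTrajectory T t x u X := by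
  have hsub : Icc t T ⊆ Icc 0 T := Icc_subset_Icc_left ht.1
  have hXc : ContinuousOn X (Icc t T) := fun s hs => (hX s hs).continuousWithinAt
  have htt : t ∈ Icc t T := ⟨le_rfl, ht.2⟩
  refine ⟨hXc, fun s hs => ?_⟩
  have hc : ContinuousOn (fun s => p.A s (X s) + p.B s (w s)) (Icc t T) :=
    (continuousOn_A_comp h hsub hXc).add ((h.smooth.smoothB.continuousOn.mono hsub).clm_apply hw)
  have h1 := integral_eq_sub_of_hasDerivWithinAt_Icc hX hc htt hs hs.1
  have h2 : ∫ r in t..s, (p.A r (X r) + p.B r (u r)) = ∫ r in t..s, (p.A r (X r) + p.B r (w r)) := by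
    apply intervalIntegral.integral_congr_ae
    filter_upwards [(ae_restrict_iff' measurableSet_Icc).1 huw] with r hr hrs
    rw [hr ((uIoc_subset_uIcc.trans (uIcc_subset_Icc htt hs)) hrs)]
  rw [h2, h1, hXt]
  abel

/-- The running cost rate. -/
def lagrangian (p : Problem n m) (s : ℝ) (x : Vec n) (w : Vec m) : ℝ :=
  p.Q s x + ⟪p.S s x, w⟫ + (1 / 2) * ⟪p.R s w, w⟫

lemma continuousOn_lagrangian (h : p.StandingHyp T) {I : Set ℝ} (hI : I ⊆ Icc 0 T)
    {w : ℝ → Vec m} (hX : ContinuousOn X I) (hw : ContinuousOn w I) :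
    ContinuousOn (fun s => p.lagrangian s (X s) (w s)) I := by
  have c1 := continuousOn_slab_comp h.smooth.smoothQ.continuousOn hI hX
  have c2 := continuousOn_slab_comp h.smooth.smoothS.continuousOn hI hX
  have c3 := ((h.smooth.smoothR.continuousOn.mono hI).clm_apply hw).inner hw (𝕜 := ℝ)
  exact (c1.add (c2.inner hw)).add (continuousOn_const.mul c3)

lemma cost_eq_of_trajectory (h : p.StandingHyp T) (ht : t ∈ Icc 0 T) (u : Control m t T)
    {w : ℝ → Vec m} (huw : u =ᵐ[volume.restrict (Icc t T)] w) (hX : p.IsTrajectory T t x u X) :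
    p.cost T t x u = (∫ s in t..T, p.lagrangian s (X s) (w s)) + p.G (X T) := by
  have h1 : EqOn (p.trajectory T t x u) X (Icc t T) :=
    (trajectory_eq h ht x u).trans ((isTrajectory_iff h ht x u X).1 hX).symm
  rw [cost, h1 ⟨ht.2, le_rfl⟩]
  congr 1
  apply intervalIntegral.integral_congr_ae
  filter_upwards [(ae_restrict_iff' measurableSet_Icc).1 huw] with r hr hrs
  have hr' : r ∈ Icc t T := by
    rw [uIoc_of_le ht.2] at hrs
    exact Ioc_subset_Icc_self hrs
  rw [hr hr', h1 hr']
  rfl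

lemma hasDerivWithinAt_stateMap {u : Control m t T} {w : ℝ → Vec m}
    (hw : ContinuousOn w (Icc t T)) (huw : u =ᵐ[volume.restrict (Icc t T)] w) {s : ℝ}
    (hs : s ∈ Icc t T) :
    HasDerivWithinAt (IccExtend ht.2 (stateMap h ht x u))
      (p.A s (IccExtend ht.2 (stateMap h ht x u) s) + p.B s (w s)) (Icc t T) s := by
  have hsub : Icc t T ⊆ Icc 0 T := Icc_subset_Icc_left ht.1
  obtain ⟨hc, hi⟩ := (isTrajectory_iff h ht x u _).2 (eqOn_refl _ _)
  have hc' : ContinuousOn (fun s => p.A s (IccExtend ht.2 (stateMap h ht x u) s) + p.B s (w s))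
      (Icc t T) :=
    (continuousOn_A_comp h hsub hc).add ((h.smooth.smoothB.continuousOn.mono hsub).clm_apply hw)
  refine hasDerivWithinAt_of_eq_integral ht.2 hc' (z := x) (fun s hs => ?_) hs
  rw [hi s hs]
  congr 1
  apply intervalIntegral.integral_congr_ae
  filter_upwards [(ae_restrict_iff' measurableSet_Icc).1 huw] with r hr hrs
  rw [hr ((uIoc_subset_uIcc.trans (uIcc_subset_Icc ⟨le_rfl, ht.2⟩ hs)) hrs)]

lemma stateMap_initial (u : Control m t T) :
    IccExtend ht.2 (stateMap h ht x u) t = x := by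
  obtain ⟨_, hi⟩ := (isTrajectory_iff h ht x u _).2 (eqOn_refl _ _)
  rw [hi t ⟨le_rfl, ht.2⟩]
  simp

/-- The increment of the cost at an extremal control is of second order. -/
lemma cost_sub_eq (h : p.StandingHyp T) (ht : t ∈ Icc 0 T) (hE : p.IsExtremal T t x X Y)
    {u u₁ : Control m t T} {w : ℝ → Vec m} {X₁ : ℝ → Vec n}
    (hu : u =ᵐ[volume.restrict (Icc t T)] fun s => p.feedback s (X s) (Y s))
    (hu₁ : u₁ =ᵐ[volume.restrict (Icc t T)] fun s => p.feedback s (X s) (Y s) + w s)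
    (hw : ContinuousOn w (Icc t T)) (hX₁t : X₁ t = x)
    (hX₁ : ∀ s ∈ Icc t T, HasDerivWithinAt X₁
      (p.A s (X₁ s) + p.B s (p.feedback s (X s) (Y s) + w s)) (Icc t T) s) :
    p.cost T t x u₁ - p.cost T t x u =
      (∫ s in t..T, ((p.Q s (X₁ s) - p.Q s (X s) - fderiv ℝ (p.Q s) (X s) (X₁ s - X s)) +
        ⟪p.feedback s (X s) (Y s), p.S s (X₁ s) - p.S s (X s) - p.Sx s (X s) (X₁ s - X s)⟫ +
        ⟪Y s, p.A s (X₁ s) - p.A s (X s) - p.Ax s (X s) (X₁ s - X s)⟫ +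
        ⟪p.S s (X₁ s) - p.S s (X s), w s⟫ + (1 / 2) * ⟪p.R s (w s), w s⟫)) +
      (p.G (X₁ T) - p.G (X T) - fderiv ℝ p.G (X T) (X₁ T - X T)) := by
  have hsub : Icc t T ⊆ Icc 0 T := Icc_subset_Icc_left ht.1
  have htt : t ∈ Icc t T := ⟨le_rfl, ht.2⟩
  have hTT : T ∈ Icc t T := ⟨ht.2, le_rfl⟩
  have hu' : uIcc t T = Icc t T := uIcc_of_le ht.2
  have hXc := hE.continuousOn_state
  have hYc := hE.continuousOn_adjoint
  have hX₁c : ContinuousOn X₁ (Icc t T) := fun s hs => (hX₁ s hs).continuousWithinAt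
  have hfc := continuousOn_feedback h hsub hXc hYc
  have hfw := hfc.add hw
  rw [cost_eq_of_trajectory h ht u hu (isTrajectory_of_hasDerivWithinAt h ht hfc hu hE.initial
    hE.state), cost_eq_of_trajectory h ht u₁ hu₁ (isTrajectory_of_hasDerivWithinAt h ht hfw hu₁
    hX₁t hX₁)]
  have l0 := continuousOn_lagrangian h hsub hXc hfc
  have l1 := continuousOn_lagrangian h hsub hX₁c hfw
  have hder : ∀ s ∈ Icc t T, HasDerivWithinAt (fun s => ⟪Y s, X₁ s - X s⟫)
      (⟪Y s, (p.A s (X₁ s) + p.B s (p.feedback s (X s) (Y s) + w s)) -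
          (p.A s (X s) + p.B s (p.feedback s (X s) (Y s)))⟫ +
        ⟪-ContinuousLinearMap.adjoint (p.driftJac s (X s)) (Y s) - p.costGrad s (X s),
          X₁ s - X s⟫) (Icc t T) s := fun s hs =>
    (hE.adjoint s hs).inner ℝ ((hX₁ s hs).sub (hE.state s hs))
  have hpt : ∀ s ∈ Icc t T,
      ⟪Y s, (p.A s (X₁ s) + p.B s (p.feedback s (X s) (Y s) + w s)) -
          (p.A s (X s) + p.B s (p.feedback s (X s) (Y s)))⟫ +
        ⟪-ContinuousLinearMap.adjoint (p.driftJac s (X s)) (Y s) - p.costGrad s (X s),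
          X₁ s - X s⟫ =
      ((p.Q s (X₁ s) - p.Q s (X s) - fderiv ℝ (p.Q s) (X s) (X₁ s - X s)) +
        ⟪p.feedback s (X s) (Y s), p.S s (X₁ s) - p.S s (X s) - p.Sx s (X s) (X₁ s - X s)⟫ +
        ⟪Y s, p.A s (X₁ s) - p.A s (X s) - p.Ax s (X s) (X₁ s - X s)⟫ +
        ⟪p.S s (X₁ s) - p.S s (X s), w s⟫ + (1 / 2) * ⟪p.R s (w s), w s⟫) -
      (p.lagrangian s (X₁ s) (p.feedback s (X s) (Y s) + w s) -
        p.lagrangian s (X s) (p.feedback s (X s) (Y s))) := by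
    intro s hs
    have hs' := hsub hs
    generalize hd : X₁ s - X s = d
    have hRf : p.R s (p.feedback s (X s) (Y s)) =
        -(ContinuousLinearMap.adjoint (p.B s) (Y s) + p.S s (X s)) := by
      rw [feedback, map_neg, R_Rinv h.cost hs']
    have e1 : ⟪ContinuousLinearMap.adjoint (p.driftJac s (X s)) (Y s), d⟫ =
        ⟪Y s, p.Ax s (X s) d⟫ + ⟪p.feedback s (X s) (Y s), p.Sx s (X s) d⟫ +
          ⟪p.Rinv s (p.S s (X s)), p.Sx s (X s) d⟫ := by
      rw [ContinuousLinearMap.adjoint_inner_left]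
      have : p.driftJac s (X s) d = p.Ax s (X s) d - p.B s (p.Rinv s (p.Sx s (X s) d)) := rfl
      rw [this, feedback, map_add, inner_neg_left, inner_add_left, inner_sub_right,
        inner_Rinv_comm h.cost hs' (ContinuousLinearMap.adjoint (p.B s) (Y s)),
        ContinuousLinearMap.adjoint_inner_left]
      ring
    have e2 : ⟪p.costGrad s (X s), d⟫ = fderiv ℝ (p.Q s) (X s) d -
        ⟪p.Rinv s (p.S s (X s)), p.Sx s (X s) d⟫ := by
      rw [costGrad, inner_sub_left, inner_gradient, ContinuousLinearMap.adjoint_inner_left]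
    have e3 : ⟪p.R s (p.feedback s (X s) (Y s)), w s⟫ = -⟪Y s, p.B s (w s)⟫ - ⟪p.S s (X s), w s⟫ := by
      rw [hRf, inner_neg_left, inner_add_left, ContinuousLinearMap.adjoint_inner_left]
      ring
    have e4 : ⟪p.R s (w s), p.feedback s (X s) (Y s)⟫ = ⟪p.R s (p.feedback s (X s) (Y s)), w s⟫ := by
      rw [inner_R_comm h.cost hs', real_inner_comm]
    have e5 : ⟪p.feedback s (X s) (Y s), p.S s (X₁ s)⟫ = ⟪p.S s (X₁ s), p.feedback s (X s) (Y s)⟫ :=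
      real_inner_comm _ _
    have e6 : ⟪p.feedback s (X s) (Y s), p.S s (X s)⟫ = ⟪p.S s (X s), p.feedback s (X s) (Y s)⟫ :=
      real_inner_comm _ _
    simp only [lagrangian, map_add, inner_add_left, inner_add_right, inner_sub_left,
      inner_sub_right, inner_neg_left, e1, e2, e3, e4, e5, e6]
    ring
  have hdc : ContinuousOn (fun s => X₁ s - X s) (Icc t T) := hX₁c.sub hXc
  have q1 := continuousOn_slab_comp h.smooth.smoothQ.continuousOn hsub hX₁c
  have q0 := continuousOn_slab_comp h.smooth.smoothQ.continuousOn hsub hXc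
  have qx := continuousOn_slab_comp (f := fun s => fderiv ℝ (p.Q s))
    (contDiffOn_fderiv_Q h.pos h.smooth).continuousOn hsub hXc
  have s1 := continuousOn_slab_comp h.smooth.smoothS.continuousOn hsub hX₁c
  have s0 := continuousOn_slab_comp h.smooth.smoothS.continuousOn hsub hXc
  have sx := continuousOn_slab_comp (contDiffOn_Sx h.pos h.smooth).continuousOn hsub hXc
  have a1 := continuousOn_slab_comp h.smooth.smoothA.continuousOn hsub hX₁c
  have a0 := continuousOn_slab_comp h.smooth.smoothA.continuousOn hsub hXc
  have ax := continuousOn_slab_comp (contDiffOn_Ax h.pos h.smooth).continuousOn hsub hXc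
  have rw' := ((h.smooth.smoothR.continuousOn.mono hsub).clm_apply hw).inner hw (𝕜 := ℝ)
  have c1 := (q1.sub q0).sub (qx.clm_apply hdc)
  have c2 := hfc.inner ((s1.sub s0).sub (sx.clm_apply hdc)) (𝕜 := ℝ)
  have c3 := hYc.inner ((a1.sub a0).sub (ax.clm_apply hdc)) (𝕜 := ℝ)
  have c4 := (s1.sub s0).inner hw (𝕜 := ℝ)
  have c5 := (continuousOn_const (c := (1 / 2 : ℝ))).mul rw'
  have cR := (((c1.add c2).add c3).add c4).add c5
  have hint := integral_eq_sub_of_hasDerivWithinAt_Icc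
    (fun s hs => (hder s hs).congr_deriv (hpt s hs)) (cR.sub (l1.sub l0)) htt hTT ht.2
  have iR := ContinuousOn.intervalIntegrable (μ := volume) (a := t) (b := T) (by rw [hu']; exact cR)
  have i1 := ContinuousOn.intervalIntegrable (μ := volume) (a := t) (b := T) (by rw [hu']; exact l1)
  have i0 := ContinuousOn.intervalIntegrable (μ := volume) (a := t) (b := T) (by rw [hu']; exact l0)
  have k1 := intervalIntegral.integral_sub iR (i1.sub i0)
  have k2 := intervalIntegral.integral_sub i1 i0
  have hYT : ⟪Y T, X₁ T - X T⟫ = fderiv ℝ p.G (X T) (X₁ T - X T) := by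
    rw [hE.terminal, inner_gradient]
  have h0 : ⟪Y t, X₁ t - X t⟫ = 0 := by rw [hX₁t, hE.initial, sub_self, inner_zero_right]
  simp only [Pi.add_apply, Pi.sub_apply, Pi.mul_apply] at hint k1 k2 ⊢
  rw [hYT, h0, sub_zero] at hint
  linarith


/-- The linearized state in the direction of a continuous control. -/
lemma hasDerivWithinAt_fderiv_stateMap (u : Control m t T) (v : C(Icc t T, Vec m)) :
    let ξ := IccExtend ht.2 (fderiv ℝ (stateMap h ht x) u (toL2 ht.2 v))
    ξ t = 0 ∧ ∀ s ∈ Icc t T, HasDerivWithinAt ξ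
      (p.Ax s (IccExtend ht.2 (stateMap h ht x u) s) (ξ s) + p.B s (IccExtend ht.2 v s))
      (Icc t T) s := by
  intro ξ
  obtain ⟨L, hL, hLip⟩ := exists_lipschitz_drift h (Icc t T)
  have hsub : Icc t T ⊆ Icc 0 T := Icc_subset_Icc_left ht.1
  let ℓ : L2 (Vec m) t T →L[ℝ] C(Icc t T, Vec n) :=
    primitiveL2 ht.2 ∘L mulL2 ht.2 (controlC h (Icc t T))
  have hd1 : HasFDerivAt (fun u : L2 (Vec m) t T => ContinuousMap.const (Icc t T) x + ℓ u) ℓ u :=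
    ℓ.hasFDerivAt.const_add _
  have hd2 : DifferentiableAt ℝ (volterraSol ht.2 ⟨t, le_rfl, ht.2⟩ (driftC h (Icc t T)))
      (ContinuousMap.const (Icc t T) x + ℓ u) :=
    (contDiff_volterraSol ht.2 ⟨t, le_rfl, ht.2⟩ (driftC h (Icc t T)) (driftC' h _) hL hLip
      (hasFDerivAt_driftC h _) le_rfl (contDiff_one_superpose _ (driftC' h _)
        (hasFDerivAt_driftC h _))).differentiable (by simp) _
  have hd3 : fderiv ℝ (stateMap h ht x) u = fderiv ℝ (volterraSol ht.2 ⟨t, le_rfl, ht.2⟩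
      (driftC h (Icc t T))) (ContinuousMap.const (Icc t T) x + ℓ u) ∘L ℓ :=
    (hd2.hasFDerivAt.comp u hd1).fderiv
  have hspec := fderiv_volterraSol_spec ht.2 ⟨t, le_rfl, ht.2⟩ (driftC h (Icc t T)) (driftC' h _)
    hL hLip (hasFDerivAt_driftC h _) (ContinuousMap.const (Icc t T) x + ℓ u) (ℓ (toL2 ht.2 v))
  have hξ0 : fderiv ℝ (stateMap h ht x) u (toL2 ht.2 v) = fderiv ℝ (volterraSol ht.2
      ⟨t, le_rfl, ht.2⟩ (driftC h (Icc t T))) (ContinuousMap.const (Icc t T) x + ℓ u)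
      (ℓ (toL2 ht.2 v)) := by rw [hd3]; rfl
  have hVc : Continuous (IccExtend ht.2 v) := v.continuous.Icc_extend' (h := ht.2)
  have hSc : Continuous (IccExtend ht.2 (stateMap h ht x u)) :=
    (stateMap h ht x u).continuous.Icc_extend' (h := ht.2)
  have hξc : Continuous ξ :=
    (fderiv ℝ (stateMap h ht x) u (toL2 ht.2 v)).continuous.Icc_extend' (h := ht.2)
  have c1 := (continuousOn_slab_comp (contDiffOn_Ax h.pos h.smooth).continuousOn hsub
    hSc.continuousOn).clm_apply hξc.continuousOn
  have c2 := (h.smooth.smoothB.continuousOn.mono hsub).clm_apply hVc.continuousOn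
  have hrep : ∀ s ∈ Icc t T, ξ s = 0 + ∫ r in t..s,
      (p.Ax r (IccExtend ht.2 (stateMap h ht x u) r) (ξ r) + p.B r (IccExtend ht.2 v r)) := by
    intro s hs
    have hst : uIcc t s ⊆ Icc t T := uIcc_subset_Icc ⟨le_rfl, ht.2⟩ hs
    have i1 := ContinuousOn.intervalIntegrable (μ := volume) (c1.mono hst)
    have i2 := ContinuousOn.intervalIntegrable (μ := volume) (c2.mono hst)
    have e1 : ℓ (toL2 ht.2 v) ⟨s, hs⟩ = ∫ r in t..s, p.B r (IccExtend ht.2 v r) := by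
      change ∫ r in t..s, mulL2 ht.2 (controlC h (Icc t T)) (toL2 ht.2 v) r = _
      rw [← (integrable_control h ht (toL2 ht.2 v)).2 s hs]
      apply intervalIntegral.integral_congr_ae
      filter_upwards [(ae_restrict_iff' measurableSet_Icc).1 (coeFn_toL2 ht.2 v)] with r hr hrs
      rw [hr (hst (uIoc_subset_uIcc hrs))]
    have e2 : ξ s = fderiv ℝ (stateMap h ht x) u (toL2 ht.2 v) ⟨s, hs⟩ :=
      IccExtend_of_mem _ _ hs
    rw [e2, hξ0, hspec ⟨s, hs⟩, e1, zero_add, intervalIntegral.integral_add i1 i2, add_comm]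
    congr 1
    refine intervalIntegral.integral_congr fun r hr => ?_
    have hr' := hst hr
    rw [← hξ0, IccExtend_of_mem _ _ hr', pointwiseApply_apply, superpose_apply, coeff_apply,
      clamp_eq (hsub hr'), IccExtend_of_mem _ _ hr']
    simp only [ξ]
    rw [IccExtend_of_mem _ _ hr']
    rfl
  refine ⟨?_, fun s hs => hasDerivWithinAt_of_eq_integral ht.2 (c1.add c2) hrep hs⟩
  rw [hrep t ⟨le_rfl, ht.2⟩]
  simp

end Problem

end AQ

namespace AQ

open Filter Topology

namespace Problem

variable {n m : ℕ} {p : Problem n m} {T : ℝ} (h : p.StandingHyp T) {t : ℝ} (ht : t ∈ Icc 0 T)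
  {x : Vec n} {X Y : ℝ → Vec n}

/-! ### The second derivative of the cost at a candidate optimal control -/

/-- The terminal Hessian as a continuous function on a slab. -/
abbrev terminalC (h : p.StandingHyp T) (K : Set ℝ) : C(K × Vec n, Vec n →L[ℝ] Vec n →L[ℝ] ℝ) :=
  ⟨fun q => p.Gxx q.2, by
    have h1 : Continuous p.Gxx := (contDiff_fderiv_G h.smooth).continuous_fderiv (by simp)
    exact h1.comp continuous_snd⟩

/-- Second-order remainder along segments of `Q`. -/
abbrev remainderQ (h : p.StandingHyp T) (K : Set ℝ) [CompactSpace K] :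
    C(K × (Vec n × Vec n), Vec n →L[ℝ] Vec n →L[ℝ] ℝ) :=
  segmentAverage (F := Vec n →L[ℝ] Vec n →L[ℝ] ℝ) taylorWeight
    (coeff h.pos K p.Qxx (continuousOn_Qxx h.pos h.smooth))

/-- Second-order remainder along segments of `S`. -/
abbrev remainderS (h : p.StandingHyp T) (K : Set ℝ) [CompactSpace K] :
    C(K × (Vec n × Vec n), Vec n →L[ℝ] Vec n →L[ℝ] Vec m) :=
  segmentAverage (F := Vec n →L[ℝ] Vec n →L[ℝ] Vec m) taylorWeight
    (coeff h.pos K p.Sxx (continuousOn_Sxx h.pos h.smooth))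

/-- Second-order remainder along segments of `A`. -/
abbrev remainderA (h : p.StandingHyp T) (K : Set ℝ) [CompactSpace K] :
    C(K × (Vec n × Vec n), Vec n →L[ℝ] Vec n →L[ℝ] Vec n) :=
  segmentAverage (F := Vec n →L[ℝ] Vec n →L[ℝ] Vec n) taylorWeight
    (coeff h.pos K p.Axx (continuousOn_Axx h.pos h.smooth))

/-- The average slope of `S` along segments. -/
abbrev slopeS (h : p.StandingHyp T) (K : Set ℝ) [CompactSpace K] :
    C(K × (Vec n × Vec n), Vec n →L[ℝ] Vec m) :=
  segmentAverage (F := Vec n →L[ℝ] Vec m) 1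
    (coeff h.pos K p.Sx (contDiffOn_Sx h.pos h.smooth).continuousOn)

/-- Second-order remainder along segments of `G`. -/
abbrev remainderG (h : p.StandingHyp T) (K : Set ℝ) [CompactSpace K] :
    C(K × (Vec n × Vec n), Vec n →L[ℝ] Vec n →L[ℝ] ℝ) :=
  segmentAverage (F := Vec n →L[ℝ] Vec n →L[ℝ] ℝ) taylorWeight (terminalC h K)

/-- The integrand of the second-order remainder of the cost, in the direction `v`, at a state
increment `d` and a scaled state increment `ξ`. -/
def remainderIntegrand (h : p.StandingHyp T) (XC YC : C(Icc t T, Vec n))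
    (U v : C(Icc t T, Vec m)) : C(Icc t T × (Vec n × Vec n), ℝ) :=
  ⟨fun q => remainderQ h (Icc t T) (q.1, (XC q.1, q.2.1)) q.2.2 q.2.2 +
    ⟪U q.1, remainderS h (Icc t T) (q.1, (XC q.1, q.2.1)) q.2.2 q.2.2⟫ +
    ⟪YC q.1, remainderA h (Icc t T) (q.1, (XC q.1, q.2.1)) q.2.2 q.2.2⟫ +
    ⟪slopeS h (Icc t T) (q.1, (XC q.1, q.2.1)) q.2.2, v q.1⟫ +
    (1 / 2) * ⟪p.R (clamp T q.1) (v q.1), v q.1⟫, by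
    have e1 : Continuous fun q : Icc t T × (Vec n × Vec n) => q.1 := continuous_fst
    have e2 : Continuous fun q : Icc t T × (Vec n × Vec n) => q.2.2 :=
      continuous_snd.comp continuous_snd
    have e3 : Continuous fun q : Icc t T × (Vec n × Vec n) => (q.1, (XC q.1, q.2.1)) :=
      e1.prodMk ((XC.continuous.comp e1).prodMk (continuous_fst.comp continuous_snd))
    have ev : Continuous fun q : Icc t T × (Vec n × Vec n) => v q.1 := v.continuous.comp e1
    have c1 := (((remainderQ h (Icc t T)).continuous.comp e3).clm_apply e2).clm_apply e2
    have c2 := (((remainderS h (Icc t T)).continuous.comp e3).clm_apply e2).clm_apply e2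
    have c3 := (((remainderA h (Icc t T)).continuous.comp e3).clm_apply e2).clm_apply e2
    have c4 := ((slopeS h (Icc t T)).continuous.comp e3).clm_apply e2
    have c5 := ((weightC h (Icc t T)).continuous.comp e1).clm_apply ev
    exact ((((c1.add ((U.continuous.comp e1).inner c2 (𝕜 := ℝ))).add
      ((YC.continuous.comp e1).inner c3 (𝕜 := ℝ))).add (c4.inner ev (𝕜 := ℝ))).add
      (continuous_const.mul (c5.inner ev (𝕜 := ℝ))))⟩

/-- The second-order remainder of the cost. -/
def costRemainder (h : p.StandingHyp T) (ht : t ∈ Icc 0 T) (XC YC : C(Icc t T, Vec n))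
    (U v : C(Icc t T, Vec m)) (q : C(Icc t T, Vec n × Vec n)) : ℝ :=
  volterra (E := ℝ) ht.2 ⟨t, le_rfl, ht.2⟩ (superpose (remainderIntegrand h XC YC U v) q)
      ⟨T, ht.2, le_rfl⟩ +
    remainderG h (Icc t T) (⟨T, ht.2, le_rfl⟩, (XC ⟨T, ht.2, le_rfl⟩, (q ⟨T, ht.2, le_rfl⟩).1))
      (q ⟨T, ht.2, le_rfl⟩).2 (q ⟨T, ht.2, le_rfl⟩).2

lemma continuous_costRemainder (XC YC : C(Icc t T, Vec n)) (U v : C(Icc t T, Vec m)) :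
    Continuous (costRemainder h ht XC YC U v) := by
  have e0 : Continuous fun q : C(Icc t T, Vec n × Vec n) => q ⟨T, ht.2, le_rfl⟩ :=
    continuous_eval_const _
  have c1 : Continuous fun q : C(Icc t T, Vec n × Vec n) =>
      volterra (E := ℝ) ht.2 ⟨t, le_rfl, ht.2⟩
        (superpose (remainderIntegrand h XC YC U v) q) :=
    (volterra (E := ℝ) ht.2 ⟨t, le_rfl, ht.2⟩).continuous.comp (continuous_superpose _)
  have c2 := (continuous_eval_const (F := C(Icc t T, ℝ))
    (⟨T, ht.2, le_rfl⟩ : Icc t T)).comp c1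
  have e2 : Continuous fun q : C(Icc t T, Vec n × Vec n) => (q ⟨T, ht.2, le_rfl⟩).2 :=
    continuous_snd.comp e0
  have e3 : Continuous fun q : C(Icc t T, Vec n × Vec n) =>
      ((⟨T, ht.2, le_rfl⟩ : Icc t T), (XC ⟨T, ht.2, le_rfl⟩, (q ⟨T, ht.2, le_rfl⟩).1)) :=
    continuous_const.prodMk (continuous_const.prodMk (continuous_fst.comp e0))
  exact c2.add ((((remainderG h (Icc t T)).continuous.comp e3).clm_apply e2).clm_apply e2)

lemma costRemainder_zero {XC YC ξ : C(Icc t T, Vec n)}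
    {U v : C(Icc t T, Vec m)} (hX : ∀ s, XC s = X s) (hY : ∀ s, YC s = Y s)
    (hU : ∀ s : Icc t T, U s = p.feedback s (X s) (Y s)) :
    2 * costRemainder h ht XC YC U v ((0 : C(Icc t T, Vec n)).prodMk ξ) =
      p.secondVariation T t X Y (IccExtend ht.2 ξ) (IccExtend ht.2 v) := by
  have hsub : Icc t T ⊆ Icc 0 T := Icc_subset_Icc_left ht.1
  have hTT : T ∈ Icc t T := ⟨ht.2, le_rfl⟩
  have e1 : remainderG h (Icc t T) (⟨T, ht.2, le_rfl⟩, (XC ⟨T, ht.2, le_rfl⟩, 0)) =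
      (1 / 2 : ℝ) • p.Gxx (X T) := by
    rw [segmentAverage_taylorWeight_zero (F := Vec n →L[ℝ] Vec n →L[ℝ] ℝ), hX]
    rfl
  rw [costRemainder, secondVariation, volterra_apply, mul_add, ← intervalIntegral.integral_const_mul]
  simp only [ContinuousMap.prod_eval, ContinuousMap.zero_apply]
  rw [e1, IccExtend_of_mem _ _ hTT]
  congr 1
  · refine intervalIntegral.integral_congr fun s hs => ?_
    rw [uIcc_of_le ht.2] at hs
    have hs' := hsub hs
    rw [IccExtend_of_mem _ _ hs, IccExtend_of_mem _ _ hs, IccExtend_of_mem _ _ hs,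
      superpose_apply]
    change 2 * (remainderQ h (Icc t T) (⟨s, hs⟩, (XC ⟨s, hs⟩, 0)) (ξ ⟨s, hs⟩) (ξ ⟨s, hs⟩) +
      ⟪U ⟨s, hs⟩, remainderS h (Icc t T) (⟨s, hs⟩, (XC ⟨s, hs⟩, 0)) (ξ ⟨s, hs⟩) (ξ ⟨s, hs⟩)⟫ +
      ⟪YC ⟨s, hs⟩, remainderA h (Icc t T) (⟨s, hs⟩, (XC ⟨s, hs⟩, 0)) (ξ ⟨s, hs⟩) (ξ ⟨s, hs⟩)⟫ +
      ⟪slopeS h (Icc t T) (⟨s, hs⟩, (XC ⟨s, hs⟩, 0)) (ξ ⟨s, hs⟩), v ⟨s, hs⟩⟫ +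
      (1 / 2) * ⟪p.R (clamp T s) (v ⟨s, hs⟩), v ⟨s, hs⟩⟫) = _
    rw [segmentAverage_taylorWeight_zero (F := Vec n →L[ℝ] Vec n →L[ℝ] ℝ),
      segmentAverage_taylorWeight_zero (F := Vec n →L[ℝ] Vec n →L[ℝ] Vec m),
      segmentAverage_taylorWeight_zero (F := Vec n →L[ℝ] Vec n →L[ℝ] Vec n),
      segmentAverage_one_zero (F := Vec n →L[ℝ] Vec m)]
    simp only [coeff_apply, clamp_eq hs', hX, hY, hU, smul_apply, inner_smul_right,
      smul_eq_mul]
    ring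
  · simp only [smul_apply, smul_eq_mul]
    ring

lemma cost_sub_eq_costRemainder (hE : p.IsExtremal T t x X Y) {XC YC : C(Icc t T, Vec n)}
    {U v : C(Icc t T, Vec m)} (hX : ∀ s, XC s = X s) (hY : ∀ s, YC s = Y s)
    (hU : ∀ s : Icc t T, U s = p.feedback s (X s) (Y s)) {u : Control m t T}
    (hu : u =ᵐ[volume.restrict (Icc t T)] fun s => p.feedback s (X s) (Y s)) {ε : ℝ} (hε : ε ≠ 0) :
    p.cost T t x (u + ε • toL2 ht.2 v) - p.cost T t x u =
      ε ^ 2 * costRemainder h ht XC YC U v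
        ((stateMap h ht x (u + ε • toL2 ht.2 v) - XC).prodMk
          (ε⁻¹ • (stateMap h ht x (u + ε • toL2 ht.2 v) - XC))) := by
  have hsub : Icc t T ⊆ Icc 0 T := Icc_subset_Icc_left ht.1
  have hTT : T ∈ Icc t T := ⟨ht.2, le_rfl⟩
  obtain ⟨w, hwdef⟩ : ∃ w : ℝ → Vec m, w = fun s => ε • IccExtend ht.2 v s := ⟨_, rfl⟩
  have hw : ContinuousOn w (Icc t T) := by
    rw [hwdef]
    exact ((v.continuous.Icc_extend' (h := ht.2)).const_smul ε).continuousOn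
  have hfc := continuousOn_feedback h hsub hE.continuousOn_state hE.continuousOn_adjoint
  have hu₁ : (u + ε • toL2 ht.2 v : Control m t T) =ᵐ[volume.restrict (Icc t T)]
      fun s => p.feedback s (X s) (Y s) + w s := by
    filter_upwards [hu, coeFn_toL2 ht.2 v, Lp.coeFn_add u (ε • toL2 ht.2 v),
      Lp.coeFn_smul ε (toL2 ht.2 v)] with s h1 h2 h3 h4
    rw [h3, Pi.add_apply, h4, Pi.smul_apply, h1, h2, hwdef]
  obtain ⟨X₁, hX₁⟩ : ∃ X₁, X₁ = stateMap h ht x (u + ε • toL2 ht.2 v) := ⟨_, rfl⟩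
  have hfw : ContinuousOn (fun s => p.feedback s (X s) (Y s) + w s) (Icc t T) := hfc.add hw
  rw [cost_sub_eq h ht hE hu hu₁ hw (stateMap_initial h ht _)
    (fun s hs => hasDerivWithinAt_stateMap h ht hfw hu₁ hs)]
  rw [costRemainder, volterra_apply, mul_add, ← intervalIntegral.integral_const_mul, ← hX₁]
  have hsc : ∀ {F : Type} [NormedAddCommGroup F] [NormedSpace ℝ F]
      (L : Vec n →L[ℝ] Vec n →L[ℝ] F) (d : Vec n), L d d = ε ^ 2 • L (ε⁻¹ • d) (ε⁻¹ • d) := by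
    intro F _ _ L d
    rw [map_smul, map_smul, smul_apply, smul_smul, smul_smul]
    field_simp
    simp
  have hsc1 : ∀ {F : Type} [NormedAddCommGroup F] [NormedSpace ℝ F]
      (L : Vec n →L[ℝ] F) (d : Vec n), L d = ε • L (ε⁻¹ • d) := by
    intro F _ _ L d
    rw [map_smul, smul_smul, mul_inv_cancel₀ hε, one_smul]
  congr 1
  · refine intervalIntegral.integral_congr fun s hs => ?_
    rw [uIcc_of_le ht.2] at hs
    have hs' := hsub hs
    obtain ⟨d, hd⟩ : ∃ d, d = X₁ ⟨s, hs⟩ - X s := ⟨_, rfl⟩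
    have hXd : X₁ ⟨s, hs⟩ = X s + d := by rw [hd]; abel
    have k1 := segmentAverage_taylor_apply (F := ℝ) (costC h (Icc t T))
      (coeff h.pos _ (fun s x => fderiv ℝ (p.Q s) x)
        (contDiffOn_fderiv_Q h.pos h.smooth).continuousOn)
      (coeff h.pos _ p.Qxx (continuousOn_Qxx h.pos h.smooth))
      (fun s x => hasFDerivAt_Q h.smooth (clamp_mem h.pos (s : ℝ)) x)
      (fun s x => hasFDerivAt_fderiv_Q h.pos h.smooth (clamp_mem h.pos (s : ℝ)) x) ⟨s, hs⟩ (X s) d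
    have k2 := segmentAverage_taylor_apply (F := Vec m) (couplingC h (Icc t T))
      (coeff h.pos _ p.Sx (contDiffOn_Sx h.pos h.smooth).continuousOn)
      (coeff h.pos _ p.Sxx (continuousOn_Sxx h.pos h.smooth))
      (fun s x => hasFDerivAt_S h.smooth (clamp_mem h.pos (s : ℝ)) x)
      (fun s x => hasFDerivAt_Sx h.pos h.smooth (clamp_mem h.pos (s : ℝ)) x) ⟨s, hs⟩ (X s) d
    have k3 := segmentAverage_taylor_apply (F := Vec n) (driftC h (Icc t T)) (driftC' h _)
      (driftC'' h _) (hasFDerivAt_driftC h _) (hasFDerivAt_driftC' h _) ⟨s, hs⟩ (X s) d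
    have k4 := segmentAverage_one_apply (F := Vec m) (couplingC h (Icc t T))
      (coeff h.pos _ p.Sx (contDiffOn_Sx h.pos h.smooth).continuousOn)
      (fun s x => hasFDerivAt_S h.smooth (clamp_mem h.pos (s : ℝ)) x) ⟨s, hs⟩ (X s) d
    rw [hsc] at k1 k2 k3
    rw [hsc1] at k4
    simp only [coeff_apply, clamp_eq hs'] at k1 k2 k3 k4
    rw [IccExtend_of_mem _ _ hs, IccExtend_of_mem _ _ hs, superpose_apply, ContinuousMap.prod_eval]
    change _ = ε ^ 2 * (remainderQ h (Icc t T) (⟨s, hs⟩, (XC ⟨s, hs⟩, X₁ ⟨s, hs⟩ - XC ⟨s, hs⟩))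
        (ε⁻¹ • (X₁ ⟨s, hs⟩ - XC ⟨s, hs⟩)) (ε⁻¹ • (X₁ ⟨s, hs⟩ - XC ⟨s, hs⟩)) +
      ⟪U ⟨s, hs⟩, remainderS h (Icc t T) (⟨s, hs⟩, (XC ⟨s, hs⟩, X₁ ⟨s, hs⟩ - XC ⟨s, hs⟩))
        (ε⁻¹ • (X₁ ⟨s, hs⟩ - XC ⟨s, hs⟩)) (ε⁻¹ • (X₁ ⟨s, hs⟩ - XC ⟨s, hs⟩))⟫ +
      ⟪YC ⟨s, hs⟩, remainderA h (Icc t T) (⟨s, hs⟩, (XC ⟨s, hs⟩, X₁ ⟨s, hs⟩ - XC ⟨s, hs⟩))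
        (ε⁻¹ • (X₁ ⟨s, hs⟩ - XC ⟨s, hs⟩)) (ε⁻¹ • (X₁ ⟨s, hs⟩ - XC ⟨s, hs⟩))⟫ +
      ⟪slopeS h (Icc t T) (⟨s, hs⟩, (XC ⟨s, hs⟩, X₁ ⟨s, hs⟩ - XC ⟨s, hs⟩))
        (ε⁻¹ • (X₁ ⟨s, hs⟩ - XC ⟨s, hs⟩)), v ⟨s, hs⟩⟫ +
      (1 / 2) * ⟪p.R (clamp T s) (v ⟨s, hs⟩), v ⟨s, hs⟩⟫)
    have hwv : w s = ε • v ⟨s, hs⟩ := by rw [hwdef]; simp only [IccExtend_of_mem _ _ hs]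
    rw [clamp_eq hs', hX ⟨s, hs⟩, hY ⟨s, hs⟩, hU ⟨s, hs⟩]
    simp only
    have hRw : ⟪p.R s (w s), w s⟫ = ε ^ 2 * ⟪p.R s (v ⟨s, hs⟩), v ⟨s, hs⟩⟫ := by
      rw [hwv, (p.R s).map_smul, inner_smul_left, inner_smul_right, conj_trivial]
      ring
    rw [← hd, hXd, hRw, ← k1, ← k2, ← k3, ← k4, hwv]
    simp only [inner_smul_left, inner_smul_right, smul_eq_mul, conj_trivial]
    ring
  · obtain ⟨d, hd⟩ : ∃ d, d = X₁ ⟨T, hTT⟩ - X T := ⟨_, rfl⟩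
    have hXd : X₁ ⟨T, hTT⟩ = X T + d := by rw [hd]; abel
    have k1 := segmentAverage_taylor_apply (K := Icc t T) (F := ℝ)
      ⟨fun q => p.G q.2, h.smooth.smoothG.continuous.comp continuous_snd⟩
      ⟨fun q => fderiv ℝ p.G q.2, (contDiff_fderiv_G h.smooth).continuous.comp continuous_snd⟩
      (terminalC h (Icc t T)) (fun s x => hasFDerivAt_G h.smooth x)
      (fun s x => hasFDerivAt_fderiv_G h.smooth x) ⟨T, hTT⟩ (X T) d
    rw [hsc] at k1
    simp only [ContinuousMap.coe_mk] at k1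
    rw [IccExtend_of_mem _ _ hTT]
    simp only [ContinuousMap.prod_eval, ContinuousMap.sub_apply, ContinuousMap.smul_apply]
    rw [hX ⟨T, hTT⟩]
    simp only
    rw [← hd, hXd, ← k1, smul_eq_mul]


lemma cost_hessian_eq (hE : p.IsExtremal T t x X Y) {u : Control m t T}
    (hu : u =ᵐ[volume.restrict (Icc t T)] fun s => p.feedback s (X s) (Y s))
    (v : C(Icc t T, Vec m)) :
    fderiv ℝ (fderiv ℝ (p.cost T t x)) u (toL2 ht.2 v) (toL2 ht.2 v) =
      p.secondVariation T t X Y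
        (IccExtend ht.2 (fderiv ℝ (stateMap h ht x) u (toL2 ht.2 v))) (IccExtend ht.2 v) := by
  have hsub : Icc t T ⊆ Icc 0 T := Icc_subset_Icc_left ht.1
  have hJ := contDiff_cost h ht x
  have hfc := continuousOn_feedback h hsub hE.continuousOn_state hE.continuousOn_adjoint
  obtain ⟨XC, hXC⟩ : ∃ XC : C(Icc t T, Vec n), ∀ s, XC s = X s :=
    ⟨⟨_, hE.continuousOn_state.domRestrict⟩, fun _ => rfl⟩
  obtain ⟨YC, hYC⟩ : ∃ YC : C(Icc t T, Vec n), ∀ s, YC s = Y s :=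
    ⟨⟨_, hE.continuousOn_adjoint.domRestrict⟩, fun _ => rfl⟩
  obtain ⟨U, hU⟩ : ∃ U : C(Icc t T, Vec m), ∀ s : Icc t T, U s = p.feedback s (X s) (Y s) :=
    ⟨⟨_, hfc.domRestrict⟩, fun _ => rfl⟩
  have hXS : stateMap h ht x u = XC := by
    have h1 := (isTrajectory_iff h ht x u X).1
      (isTrajectory_of_hasDerivWithinAt h ht hfc hu hE.initial hE.state)
    ext1 s
    rw [hXC, h1 s.2, IccExtend_of_mem _ _ s.2]
  obtain ⟨V, hV⟩ : ∃ V : Control m t T, V = toL2 ht.2 v := ⟨_, rfl⟩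
  have hline : ∀ ε : ℝ, HasDerivAt (fun ε : ℝ => u + ε • V) V ε := fun ε => by
    simpa using ((hasDerivAt_id ε).smul_const V).const_add u
  have hd1 : ∀ ε : ℝ, HasDerivAt (fun ε : ℝ => p.cost T t x (u + ε • V))
      (fderiv ℝ (p.cost T t x) (u + ε • V) V) ε := fun ε => by
    have h1 := (hJ.differentiable (by simp) (u + ε • V)).hasFDerivAt
    exact h1.comp_hasDerivAt ε (hline ε)
  have hJ' : ContDiff ℝ 1 (fderiv ℝ (p.cost T t x)) := hJ.fderiv_right (by norm_num)
  have hu0 : u + (0:ℝ) • V = u := by simp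
  have hd2 : HasDerivAt (fun ε : ℝ => fderiv ℝ (p.cost T t x) (u + ε • V) V)
      (fderiv ℝ (fderiv ℝ (p.cost T t x)) u V V) 0 := by
    have h1 := (hJ'.differentiable (by simp) (u + (0:ℝ) • V)).hasFDerivAt.comp_hasDerivAt
      (0:ℝ) (hline 0)
    rw [hu0] at h1
    have h2 := h1.clm_apply (hasDerivAt_const (0:ℝ) V)
    simpa using h2
  have hs1 : HasDerivAt (fun ε : ℝ => stateMap h ht x (u + ε • V))
      (fderiv ℝ (stateMap h ht x) u V) 0 := by
    have h1 := ((contDiff_stateMap h ht x).differentiable (by simp)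
      (u + (0:ℝ) • V)).hasFDerivAt.comp_hasDerivAt (0:ℝ) (hline 0)
    rw [hu0] at h1
    exact h1
  have hs2 : Tendsto (fun ε : ℝ => stateMap h ht x (u + ε • V) - XC) (𝓝[≠] 0) (𝓝 0) := by
    have h1 := hs1.continuousAt.tendsto.sub_const XC
    rw [hu0, hXS, sub_self] at h1
    exact h1.mono_left nhdsWithin_le_nhds
  have hs3 : Tendsto (fun ε : ℝ => ε⁻¹ • (stateMap h ht x (u + ε • V) - XC)) (𝓝[≠] 0)
      (𝓝 (fderiv ℝ (stateMap h ht x) u V)) := by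
    refine (hasDerivAt_iff_tendsto_slope.1 hs1).congr fun ε => ?_
    rw [slope_def_module, hu0, hXS, sub_zero]
  have hpm : Continuous fun q : C(Icc t T, Vec n) × C(Icc t T, Vec n) => q.1.prodMk q.2 :=
    ContinuousMap.continuous_of_continuous_uncurry _ (by
      simp only [Function.uncurry_def, ContinuousMap.prod_eval]
      fun_prop)
  have hlim := (((continuous_costRemainder h ht XC YC U v).comp hpm).tendsto
    ((0 : C(Icc t T, Vec n)), fderiv ℝ (stateMap h ht x) u V)).comp (hs2.prodMk_nhds hs3)
  have hq : Tendsto (fun ε : ℝ => (p.cost T t x (u + ε • V) - p.cost T t x (u + (0:ℝ) • V)) / ε ^ 2)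
      (𝓝[≠] 0) (𝓝 (costRemainder h ht XC YC U v
        ((0 : C(Icc t T, Vec n)).prodMk (fderiv ℝ (stateMap h ht x) u V)))) := by
    refine hlim.congr' ?_
    filter_upwards [self_mem_nhdsWithin] with ε hε
    have hε' : ε ≠ 0 := hε
    rw [hu0, hV, cost_sub_eq_costRemainder h ht hE hXC hYC hU hu hε', mul_comm,
      mul_div_cancel_right₀ _ (pow_ne_zero 2 hε')]
    rfl
  have hfin := second_deriv_eq_of_tendsto hd1 hd2 hq
  rw [costRemainder_zero h ht hXC hYC hU] at hfin
  rw [← hV]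
  exact hfin

theorem hessianCoercive (h : p.StandingHyp T) {K₀ α δ : ℝ} (hK₀ : 0 < K₀)
    (hK : p.AdjointBound T K₀) (hα : α ∈ Ioo (0:ℝ) 1) {Gbar : Vec n →L[ℝ] Vec n}
    {Qbar : ℝ → Vec n →L[ℝ] Vec n} (hG : p.TerminalSemiconvex Gbar)
    (hW : p.ControlWeightPositive T α δ Gbar Qbar) (hR : p.RunningSemiconvex T K₀ α Qbar) :
    p.HessianCoercive T δ := by
  intro t ht x X Y hE u hu
  have hJ := contDiff_cost h ht x
  refine ⟨hJ.contDiffAt, ?_⟩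
  have hsub : Icc t T ⊆ Icc 0 T := Icc_subset_Icc_left ht.1
  have hfc := continuousOn_feedback h hsub hE.continuousOn_state hE.continuousOn_adjoint
  have hXS := (isTrajectory_iff h ht x u X).1
    (isTrajectory_of_hasDerivWithinAt h ht hfc hu hE.initial hE.state)
  intro v
  refine (denseRange_toL2 (m := m) ht.2).induction_on v ?_ fun v => ?_
  · refine isClosed_le ((continuous_norm.pow 2).const_mul δ) ?_
    exact ((fderiv ℝ (fderiv ℝ (p.cost T t x)) u).continuous).clm_apply continuous_id
  · rw [cost_hessian_eq h ht hE hu, norm_toL2_sq]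
    obtain ⟨h1, h2⟩ := hasDerivWithinAt_fderiv_stateMap h ht (x := x) u v
    refine secondVariation_ge h ht hK₀ hK hα hG hW hR hE
      (v.continuous.Icc_extend' (h := ht.2)).continuousOn h1 fun s hs => ?_
    rw [hXS hs]
    exact h2 s hs

end Problem

end AQ

namespace AQ

open Filter Topology

/-! ### Joint differentiability of parametrized curves -/

section Eval

variable {Z F : Type*} [NormedAddCommGroup Z] [NormedSpace ℝ Z] [FiniteDimensional ℝ Z]
  [NormedAddCommGroup F]
  [NormedSpace ℝ F] {a b : ℝ}

lemma continuous_IccExtend_eval (hab : a ≤ b) {A : Type*} [TopologicalSpace A]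
    {H : A → C(Icc a b, F)} (hH : Continuous H) :
    Continuous fun q : ℝ × A => IccExtend hab (H q.2) q.1 := by
  have h1 : Continuous fun q : ℝ × A => (H q.2, projIcc a b hab q.1) :=
    (hH.comp continuous_snd).prodMk (continuous_projIcc.comp continuous_fst)
  have h2 : Continuous fun q : C(Icc a b, F) × Icc a b => q.1 q.2 := continuous_eval
  exact h2.comp h1

lemma hasStrictFDerivAt_IccExtend_eval (hab : a ≤ b) {H D : Z → C(Icc a b, F)}
    (hH : ContDiff ℝ 1 H) (hD : Continuous D)
    (hHD : ∀ z, ∀ s ∈ Icc a b, HasDerivWithinAt (IccExtend hab (H z)) (IccExtend hab (D z) s)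
      (Icc a b) s) {s : ℝ} (hs : s ∈ Ioo a b) (z : Z) :
    HasStrictFDerivAt (fun q : ℝ × Z => IccExtend hab (H q.2) q.1)
      ((ContinuousLinearMap.toSpanSingleton ℝ (IccExtend hab (D z) s)).coprod
        (ContinuousMap.evalCLM ℝ (projIcc a b hab s) ∘L fderiv ℝ H z)) (s, z) := by
  let f₁ : ℝ → Z → ℝ →L[ℝ] F := fun s z =>
    ContinuousLinearMap.toSpanSingleton ℝ (IccExtend hab (D z) s)
  let f₂ : ℝ → Z → Z →L[ℝ] F := fun s z =>
    ContinuousMap.evalCLM ℝ (projIcc a b hab s) ∘L fderiv ℝ H z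
  have hnhds : ∀ᶠ q : ℝ × Z in 𝓝 (s, z), q.1 ∈ Ioo a b :=
    continuous_fst.continuousAt.eventually_mem (isOpen_Ioo.mem_nhds hs)
  have c1 : Continuous fun q : ℝ × Z => f₁ q.1 q.2 :=
    (ContinuousLinearMap.toSpanSingletonCLE (𝕜 := ℝ) (E := F)).continuous.comp
      (continuous_IccExtend_eval hab hD)
  have c2 : Continuous fun q : ℝ × Z => f₂ q.1 q.2 := by
    refine continuous_clm_apply.2 fun ζ => ?_
    have hc : Continuous fun z => fderiv ℝ H z ζ :=
      (hH.continuous_fderiv (by simp)).clm_apply continuous_const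
    exact continuous_IccExtend_eval hab hc
  have hmain := hasStrictFDerivAt_uncurry_coprod (𝕜 := ℝ) (u := (s, z))
    (f := fun s z => IccExtend hab (H z) s) (f₁ := f₁) (f₂ := f₂) ?_ ?_ c1.continuousAt
    c2.continuousAt
  · exact hmain
  · filter_upwards [hnhds] with q hq
    exact ((hHD q.2 q.1 (Ioo_subset_Icc_self hq)).hasDerivAt
      (Icc_mem_nhds hq.1 hq.2)).hasFDerivAt
  · refine Eventually.of_forall fun q => ?_
    exact (ContinuousMap.evalCLM ℝ (projIcc a b hab q.1)).hasFDerivAt.comp q.2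
      (hH.differentiable (by simp) q.2).hasFDerivAt

end Eval

lemma hasDerivWithinAt_IccExtend_of_eq {E : Type*} [NormedAddCommGroup E] [NormedSpace ℝ E]
    [CompleteSpace E] {a b : ℝ} (hab : a ≤ b) {c : ℝ} {X D : C(Icc a b, E)} {z : E}
    (h : ∀ s : Icc a b, X s = z + ∫ r in c..s, IccExtend hab D r) {s : ℝ} (hs : s ∈ Icc a b) :
    HasDerivWithinAt (IccExtend hab X) (IccExtend hab D s) (Icc a b) s := by
  have h1 := (hasDerivAt_primitive_IccExtend hab c z D s).hasDerivWithinAt (s := Icc a b)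
  have h2 : ∀ r ∈ Icc a b, IccExtend hab X r = z + ∫ r in c..r, IccExtend hab D r := by
    intro r hr
    rw [IccExtend_of_mem _ _ hr, h]
  exact h1.congr h2 (h2 s hs)

/-! ### Flows of time-dependent vector fields -/

section Flow

variable {E : Type*} [NormedAddCommGroup E] [NormedSpace ℝ E] [FiniteDimensional ℝ E]
  {a b : ℝ}

/-- A vector field multiplied by a bump function of the space variable. -/
def cutField (χ : ContDiffBump (0 : E)) (g : C(Icc a b × E, E)) : C(Icc a b × E, E) :=
  ⟨fun q => χ q.2 • g q, (χ.continuous.comp continuous_snd).smul g.continuous⟩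

/-- The space derivative of `cutField`. -/
def cutField' (χ : ContDiffBump (0 : E)) (g : C(Icc a b × E, E)) (g' : C(Icc a b × E, E →L[ℝ] E)) :
    C(Icc a b × E, E →L[ℝ] E) :=
  ⟨fun q => χ q.2 • g' q + (fderiv ℝ χ q.2).smulRight (g q), by
    have h1 : Continuous fun q : Icc a b × E => χ q.2 • g' q :=
      (χ.continuous.comp continuous_snd).smul g'.continuous
    have h2 : Continuous fun q : Icc a b × E => fderiv ℝ χ q.2 :=
      ((χ.contDiff (n := 1)).continuous_fderiv (by simp)).comp continuous_snd
    have h3 : Continuous fun q : Icc a b × E =>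
        ContinuousLinearMap.smulRightL ℝ E E (fderiv ℝ χ q.2) (g q) :=
      ((ContinuousLinearMap.smulRightL ℝ E E).continuous.comp h2).clm_apply g.continuous
    exact h1.add h3⟩

lemma hasFDerivAt_cutField (χ : ContDiffBump (0 : E)) (g : C(Icc a b × E, E))
    (g' : C(Icc a b × E, E →L[ℝ] E)) (hg : ∀ s e, HasFDerivAt (fun e => g (s, e)) (g' (s, e)) e)
    (s : Icc a b) (e : E) :
    HasFDerivAt (fun e => cutField χ g (s, e)) (cutField' χ g g' (s, e)) e :=
  (((χ.contDiff (n := 1)).differentiable (by simp) e).hasFDerivAt).smul (hg s e)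

lemma exists_lipschitz_cutField (χ : ContDiffBump (0 : E)) (g : C(Icc a b × E, E))
    (g' : C(Icc a b × E, E →L[ℝ] E)) (hg : ∀ s e, HasFDerivAt (fun e => g (s, e)) (g' (s, e)) e) :
    ∃ L, 0 ≤ L ∧ ∀ (s : Icc a b) (x y : E),
      ‖cutField χ g (s, x) - cutField χ g (s, y)‖ ≤ L * ‖x - y‖ := by
  have hK : IsCompact ((univ : Set (Icc a b)) ×ˢ Metric.closedBall (0 : E) χ.rOut) :=
    isCompact_univ.prod (isCompact_closedBall _ _)
  obtain ⟨C, hC⟩ := hK.exists_bound_of_continuousOn (cutField' χ g g').continuous.continuousOn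
  have hbd : ∀ (s : Icc a b) (e : E), ‖cutField' χ g g' (s, e)‖ ≤ max C 0 := by
    intro s e
    by_cases he : e ∈ Metric.closedBall (0 : E) χ.rOut
    · exact (hC (s, e) ⟨mem_univ _, he⟩).trans (le_max_left _ _)
    · have h0 : e ∉ tsupport χ := by rwa [χ.tsupport_eq]
      have h1 : χ e = 0 := image_eq_zero_of_notMem_tsupport h0
      have h2 : fderiv ℝ χ e = 0 := by
        have := fun h' => h0 (support_fderiv_subset ℝ h' : e ∈ tsupport χ)
        simpa using this
      have h3 : cutField' χ g g' (s, e) = 0 := by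
        change χ e • g' (s, e) + (fderiv ℝ χ e).smulRight (g (s, e)) = 0
        rw [h1, h2, zero_smul, zero_add]
        ext w
        simp
      rw [h3, norm_zero]
      exact le_max_right _ _
  refine ⟨max C 0, le_max_right _ _, fun s x y => ?_⟩
  exact convex_univ.norm_image_sub_le_of_norm_hasFDerivWithin_le
    (fun e _ => (hasFDerivAt_cutField χ g g' hg s e).hasFDerivWithinAt)
    (fun e _ => hbd s e) (mem_univ y) (mem_univ x)

variable (hab : a ≤ b) (c : Icc a b) (f : C(Icc a b × E, E)) {L : ℝ} (hL : 0 ≤ L)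
  (hf : ∀ s x y, ‖f (s, x) - f (s, y)‖ ≤ L * ‖x - y‖)

/-- The trajectory of the vector field `f` passing through `e` at the time `c`. -/
def flowCurve (hab : a ≤ b) (c : Icc a b) (f : C(Icc a b × E, E)) (e : E) : C(Icc a b, E) :=
  volterraSol hab c f (ContinuousMap.const _ e)

include hL hf

lemma flowCurve_spec (e : E) (s : Icc a b) :
    flowCurve hab c f e s = e + ∫ r in (c:ℝ)..s, IccExtend hab (superpose f (flowCurve hab c f e)) r :=
  volterraSol_spec hab c f hL hf _ s

lemma flowCurve_base (e : E) : flowCurve hab c f e c = e := by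
  rw [flowCurve_spec hab c f hL hf]
  simp

lemma hasDerivWithinAt_flowCurve (e : E) {s : ℝ} (hs : s ∈ Icc a b) :
    HasDerivWithinAt (IccExtend hab (flowCurve hab c f e))
      (IccExtend hab (superpose f (flowCurve hab c f e)) s) (Icc a b) s :=
  hasDerivWithinAt_IccExtend_of_eq hab (flowCurve_spec hab c f hL hf e) hs

lemma eqOn_flowCurve {Z : ℝ → E} {t : ℝ} (ht : t ∈ Icc a b)
    (hZ : ∀ s (hs : s ∈ Icc t c), HasDerivWithinAt Z
      (f (⟨s, ht.1.trans hs.1, hs.2.trans c.2.2⟩, Z s)) (Icc t c) s) :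
    EqOn Z (IccExtend hab (flowCurve hab c f (Z c))) (Icc t c) := by
  have hsub : Icc t (c:ℝ) ⊆ Icc a b := Icc_subset_Icc ht.1 c.2.2
  refine ODE_solution_unique_of_mem_Icc_left (v := fun s e => f (projIcc a b hab s, e))
    (s := fun _ => univ) (K := L.toNNReal) (fun s _ => ?_)
    (fun s hs => (hZ s hs).continuousWithinAt) (fun s hs => ?_) (fun _ _ => mem_univ _)
    ((flowCurve hab c f (Z c)).continuous.Icc_extend' (h := hab)).continuousOn (fun s hs => ?_)
    (fun _ _ => mem_univ _) ?_
  · refine LipschitzOnWith.of_dist_le_mul fun x _ y _ => ?_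
    rw [dist_eq_norm, dist_eq_norm, Real.coe_toNNReal _ hL]
    exact hf _ _ _
  · have hs' := Ioc_subset_Icc_self hs
    rw [projIcc_of_mem hab (hsub hs')]
    exact (hZ s hs').mono_of_mem_nhdsWithin (Icc_mem_nhdsLE_of_mem hs)
  · have hs' := hsub (Ioc_subset_Icc_self hs)
    have h1 := hasDerivWithinAt_flowCurve hab c f hL hf (Z c) hs'
    have h2 := h1.mono hsub
    exact h2.mono_of_mem_nhdsWithin (Icc_mem_nhdsLE_of_mem hs)
  · rw [IccExtend_of_mem _ _ c.2]
    exact (flowCurve_base hab c f hL hf _).symm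

variable (f' : C(Icc a b × E, E →L[ℝ] E))
  (h : ∀ s x, HasFDerivAt (fun x => f (s, x)) (f' (s, x)) x)

include h

lemma contDiff_flowCurve : ContDiff ℝ 1 (flowCurve hab c f) := by
  have h1 := contDiff_volterraSol hab c f f' hL hf h le_rfl (contDiff_one_superpose f f' h)
  let ℓ : E →L[ℝ] C(Icc a b, E) := ContinuousLinearMap.const ℝ (Icc a b)
  exact h1.comp ℓ.contDiff

lemma fderiv_flowCurve_spec (e ζ : E) (s : Icc a b) :
    fderiv ℝ (flowCurve hab c f) e ζ s = ζ + ∫ r in (c:ℝ)..s,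
      IccExtend hab (pointwiseApply (superpose f' (flowCurve hab c f e))
        (fderiv ℝ (flowCurve hab c f) e ζ)) r := by
  have h1 := contDiff_volterraSol hab c f f' hL hf h le_rfl (contDiff_one_superpose f f' h)
  let ℓ : E →L[ℝ] C(Icc a b, E) := ContinuousLinearMap.const ℝ (Icc a b)
  have h2 : fderiv ℝ (flowCurve hab c f) e ζ =
      fderiv ℝ (volterraSol hab c f) (ContinuousMap.const _ e) (ContinuousMap.const _ ζ) := by
    have h3 := (h1.differentiable (by simp) (ℓ e)).hasFDerivAt.comp e ℓ.hasFDerivAt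
    have h4 : fderiv ℝ (flowCurve hab c f) e = _ := h3.fderiv
    rw [h4]
    rfl
  rw [h2]
  exact fderiv_volterraSol_spec hab c f f' hL hf h _ _ s

end Flow

end AQ

namespace AQ

open Filter Topology

/-- The adjoint of real operators as a continuous linear map. -/
def adjointL (E F : Type*) [NormedAddCommGroup E] [InnerProductSpace ℝ E] [CompleteSpace E]
    [NormedAddCommGroup F] [InnerProductSpace ℝ F] [CompleteSpace F] :
    (E →L[ℝ] F) →L[ℝ] (F →L[ℝ] E) :=
  LinearMap.mkContinuous
    { toFun := fun M => ContinuousLinearMap.adjoint M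
      map_add' := fun M N => map_add _ M N
      map_smul' := fun c M => by rw [map_smulₛₗ]; simp } 1
    (fun M => by
      rw [one_mul]
      exact (LinearIsometryEquiv.norm_map _ M).le)

lemma one_add_norm_sq_le {E : Type*} [NormedAddCommGroup E] [InnerProductSpace ℝ E] {a b C : ℝ}
    {X X' : ℝ → E} (hX : ∀ s ∈ Icc a b, HasDerivWithinAt X (X' s) (Icc a b) s) (hC : 0 ≤ C)
    (hb : ∀ s ∈ Icc a b, ‖X' s‖ ≤ C * (1 + ‖X s‖)) {r s : ℝ} (hr : r ∈ Icc a b)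
    (hs : s ∈ Icc a b) :
    1 + ‖X s‖ ^ 2 ≤ (1 + ‖X r‖ ^ 2) * Real.exp (4 * C * (b - a)) := by
  have hφ : ∀ q ∈ Icc a b, HasDerivWithinAt (fun q => 1 + ‖X q‖ ^ 2) (2 * ⟪X q, X' q⟫)
      (Icc a b) q := fun q hq => ((hX q hq).norm_sq).const_add 1
  have hbd : ∀ q ∈ Icc a b, |2 * ⟪X q, X' q⟫| ≤ 4 * C * (1 + ‖X q‖ ^ 2) := by
    intro q hq
    rw [abs_mul, abs_two]
    have h1 := (abs_real_inner_le_norm (X q) (X' q)).trans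
      (mul_le_mul_of_nonneg_left (hb q hq) (norm_nonneg _))
    have h2 : ‖X q‖ * (1 + ‖X q‖) ≤ 2 * (1 + ‖X q‖ ^ 2) := by
      nlinarith [sq_nonneg (‖X q‖ - 1), norm_nonneg (X q)]
    have h3 : ‖X q‖ * (C * (1 + ‖X q‖)) ≤ C * (2 * (1 + ‖X q‖ ^ 2)) := by
      calc _ = C * (‖X q‖ * (1 + ‖X q‖)) := by ring
        _ ≤ _ := by gcongr
    linarith
  have key : ∀ σ : ℝ, |σ| ≤ 4 * C → ∀ q ∈ Icc a b,
      HasDerivWithinAt (fun q => (1 + ‖X q‖ ^ 2) * Real.exp (σ * q))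
        (2 * ⟪X q, X' q⟫ * Real.exp (σ * q) + (1 + ‖X q‖ ^ 2) * (Real.exp (σ * q) * σ))
        (Icc a b) q := by
    intro σ _ q hq
    have h1 : HasDerivAt (fun q => Real.exp (σ * q)) (Real.exp (σ * q) * σ) q := by
      simpa using ((hasDerivAt_id q).const_mul σ).exp
    exact (hφ q hq).mul h1.hasDerivWithinAt
  have hint : interior (Icc a b) = Ioo a b := interior_Icc
  have hle : |r - s| ≤ b - a := by
    rw [abs_le]; constructor <;> linarith [hr.1, hr.2, hs.1, hs.2]
  have hpos : 0 ≤ 1 + ‖X r‖ ^ 2 := by positivity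
  rcases le_total r s with hrs | hsr
  · have hanti : AntitoneOn (fun q => (1 + ‖X q‖ ^ 2) * Real.exp (-(4 * C) * q)) (Icc a b) := by
      have hk := key (-(4 * C)) (by rw [abs_neg, abs_of_nonneg (by positivity)])
      refine antitoneOn_of_deriv_nonpos (convex_Icc a b)
        (fun q hq => (hk q hq).continuousWithinAt) (fun q hq => ?_) (fun q hq => ?_)
      · rw [hint] at hq
        exact ((hk q (Ioo_subset_Icc_self hq)).hasDerivAt
          (Icc_mem_nhds hq.1 hq.2)).differentiableAt.differentiableWithinAt
      · rw [hint] at hq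
        rw [((hk q (Ioo_subset_Icc_self hq)).hasDerivAt (Icc_mem_nhds hq.1 hq.2)).deriv]
        have h1 := (abs_le.1 (hbd q (Ioo_subset_Icc_self hq))).2
        have h2 := Real.exp_pos (-(4 * C) * q)
        nlinarith
    have h1 := hanti hr hs hrs
    simp only at h1
    have h2 : (1 + ‖X s‖ ^ 2) ≤ (1 + ‖X r‖ ^ 2) * Real.exp (4 * C * (s - r)) := by
      have h3 : Real.exp (4 * C * (s - r)) =
          Real.exp (-(4 * C) * r) / Real.exp (-(4 * C) * s) := by
        rw [← Real.exp_sub]; ring_nf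
      rw [h3, ← mul_div_assoc, le_div_iff₀ (Real.exp_pos _)]
      exact h1
    refine h2.trans ?_
    gcongr
    · exact hs.2
    · exact hr.1
  · have hmono : MonotoneOn (fun q => (1 + ‖X q‖ ^ 2) * Real.exp (4 * C * q)) (Icc a b) := by
      have hk := key (4 * C) (by rw [abs_of_nonneg (by positivity)])
      refine monotoneOn_of_deriv_nonneg (convex_Icc a b)
        (fun q hq => (hk q hq).continuousWithinAt) (fun q hq => ?_) (fun q hq => ?_)
      · rw [hint] at hq
        exact ((hk q (Ioo_subset_Icc_self hq)).hasDerivAt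
          (Icc_mem_nhds hq.1 hq.2)).differentiableAt.differentiableWithinAt
      · rw [hint] at hq
        rw [((hk q (Ioo_subset_Icc_self hq)).hasDerivAt (Icc_mem_nhds hq.1 hq.2)).deriv]
        have h1 := (abs_le.1 (hbd q (Ioo_subset_Icc_self hq))).1
        have h2 := Real.exp_pos (4 * C * q)
        nlinarith
    have h1 := hmono hs hr hsr
    simp only at h1
    have h2 : (1 + ‖X s‖ ^ 2) ≤ (1 + ‖X r‖ ^ 2) * Real.exp (4 * C * (r - s)) := by
      have h3 : Real.exp (4 * C * (r - s)) =
          Real.exp (4 * C * r) / Real.exp (4 * C * s) := by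
        rw [← Real.exp_sub]; ring_nf
      rw [h3, ← mul_div_assoc, le_div_iff₀ (Real.exp_pos _)]
      exact h1
    refine h2.trans ?_
    gcongr
    · exact hr.2
    · exact hs.1

namespace Problem

variable {n m : ℕ} {p : Problem n m} {T : ℝ} (h : p.StandingHyp T) {t : ℝ}
  {x : Vec n} {X Y : ℝ → Vec n}

/-! ### The Hamiltonian vector field -/

/-- The negative of the right-hand side of the adjoint equation. -/
def adjointRHS (p : Problem n m) (s : ℝ) (x y : Vec n) : Vec n :=
  ContinuousLinearMap.adjoint (p.Ax s x) y + gradient (p.Q s) x +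
    ContinuousLinearMap.adjoint (p.Sx s x) (p.feedback s x y)

lemma inner_adjointRHS (p : Problem n m) (s : ℝ) (x y w : Vec n) :
    ⟪p.adjointRHS s x y, w⟫ =
      ⟪y, p.Ax s x w⟫ + fderiv ℝ (p.Q s) x w + ⟪p.feedback s x y, p.Sx s x w⟫ := by
  rw [adjointRHS, inner_add_left, inner_add_left, ContinuousLinearMap.adjoint_inner_left,
    ContinuousLinearMap.adjoint_inner_left, inner_gradient]

lemma neg_adjointRHS (h : p.StandingHyp T) {s : ℝ} (hs : s ∈ Icc 0 T) (x y : Vec n) :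
    -ContinuousLinearMap.adjoint (p.driftJac s x) y - p.costGrad s x = -p.adjointRHS s x y := by
  refine ext_inner_right ℝ fun w => ?_
  rw [inner_neg_left, inner_adjointRHS, inner_sub_left, inner_neg_left,
    ContinuousLinearMap.adjoint_inner_left, costGrad, inner_sub_left, inner_gradient,
    ContinuousLinearMap.adjoint_inner_left]
  have e : p.driftJac s x w = p.Ax s x w - p.B s (p.Rinv s (p.Sx s x w)) := rfl
  rw [e, feedback, map_add, inner_neg_left, inner_add_left, inner_sub_right,
    inner_Rinv_comm h.cost hs (ContinuousLinearMap.adjoint (p.B s) y),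
    ContinuousLinearMap.adjoint_inner_left]
  ring

/-- The vector field of the optimality system on pairs (state, adjoint). -/
def hamField (p : Problem n m) (s : ℝ) (e : Vec n × Vec n) : Vec n × Vec n :=
  (p.A s e.1 + p.B s (p.feedback s e.1 e.2), -p.adjointRHS s e.1 e.2)

lemma contDiffOn_comp_fst {F : Type*} [NormedAddCommGroup F] [NormedSpace ℝ F] {f : ℝ → Vec n → F}
    {k : WithTop ℕ∞} (hf : ContDiffOn ℝ k (fun z : ℝ × Vec n => f z.1 z.2) (Icc 0 T ×ˢ univ)) :
    ContDiffOn ℝ k (fun q : ℝ × (Vec n × Vec n) => f q.1 q.2.1) (Icc 0 T ×ˢ univ) := by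
  have h1 : ContDiff ℝ k fun q : ℝ × (Vec n × Vec n) => (q.1, q.2.1) :=
    contDiff_fst.prodMk (contDiff_fst.comp contDiff_snd)
  exact hf.comp h1.contDiffOn fun q hq => ⟨hq.1, mem_univ _⟩

lemma contDiffOn_comp_time {F : Type*} [NormedAddCommGroup F] [NormedSpace ℝ F] {f : ℝ → F}
    {k : WithTop ℕ∞} (hf : ContDiffOn ℝ k f (Icc 0 T)) :
    ContDiffOn ℝ k (fun q : ℝ × (Vec n × Vec n) => f q.1) (Icc 0 T ×ˢ univ) :=
  hf.comp contDiff_fst.contDiffOn fun _ hq => hq.1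

lemma contDiffOn_adjoint {E F : Type*} [NormedAddCommGroup E] [InnerProductSpace ℝ E]
    [CompleteSpace E] [NormedAddCommGroup F] [InnerProductSpace ℝ F] [CompleteSpace F] {D : Type*}
    [NormedAddCommGroup D] [NormedSpace ℝ D] {M : D → E →L[ℝ] F} {I : Set D} {k : WithTop ℕ∞}
    (hM : ContDiffOn ℝ k M I) :
    ContDiffOn ℝ k (fun q => ContinuousLinearMap.adjoint (M q)) I :=
  (adjointL E F).contDiff.comp_contDiffOn hM

lemma contDiffOn_feedback (h : p.StandingHyp T) :
    ContDiffOn ℝ 1 (fun q : ℝ × (Vec n × Vec n) => p.feedback q.1 q.2.1 q.2.2)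
      (Icc 0 T ×ˢ univ) := by
  have h1 := contDiffOn_comp_time (n := n) ((contDiffOn_Rinv h.cost h.smooth).of_le
    (m := 1) (by norm_num))
  have h2 := contDiffOn_adjoint
    (contDiffOn_comp_time (n := n) (h.smooth.smoothB.of_le (m := 1) (by norm_num)))
  have h3 := contDiffOn_comp_fst (h.smooth.smoothS.of_le (m := 1) (by norm_num))
  have h4 : ContDiffOn ℝ 1 (fun q : ℝ × (Vec n × Vec n) => q.2.2) (Icc 0 T ×ˢ univ) :=
    (contDiff_snd.comp contDiff_snd).contDiffOn
  have h5 := (h2.clm_apply h4).add h3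
  exact (h1.clm_apply h5).neg

lemma gradient_eq_adjoint (f : Vec n → ℝ) (x : Vec n) :
    gradient f x = ContinuousLinearMap.adjoint (fderiv ℝ f x) 1 := by
  refine ext_inner_right ℝ fun w => ?_
  rw [inner_gradient, ContinuousLinearMap.adjoint_inner_left]
  simp

lemma contDiffOn_adjointRHS (h : p.StandingHyp T) :
    ContDiffOn ℝ 1 (fun q : ℝ × (Vec n × Vec n) => p.adjointRHS q.1 q.2.1 q.2.2)
      (Icc 0 T ×ˢ univ) := by
  have h1 := contDiffOn_adjoint (contDiffOn_comp_fst (contDiffOn_Ax h.pos h.smooth))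
  have h2 := contDiffOn_adjoint (contDiffOn_comp_fst (f := fun s => fderiv ℝ (p.Q s))
    (contDiffOn_fderiv_Q h.pos h.smooth))
  have h3 := contDiffOn_adjoint (contDiffOn_comp_fst (contDiffOn_Sx h.pos h.smooth))
  have h4 : ContDiffOn ℝ 1 (fun q : ℝ × (Vec n × Vec n) => q.2.2) (Icc 0 T ×ˢ univ) :=
    (contDiff_snd.comp contDiff_snd).contDiffOn
  have h5 : ContDiffOn ℝ 1 (fun q : ℝ × (Vec n × Vec n) => gradient (p.Q q.1) q.2.1)
      (Icc 0 T ×ˢ univ) :=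
    (h2.clm_apply (contDiffOn_const (c := (1 : ℝ)))).congr fun q _ => gradient_eq_adjoint _ _
  exact ((h1.clm_apply h4).add h5).add (h3.clm_apply (contDiffOn_feedback h))

lemma contDiffOn_hamField (h : p.StandingHyp T) :
    ContDiffOn ℝ 1 (fun q : ℝ × (Vec n × Vec n) => p.hamField q.1 q.2) (Icc 0 T ×ˢ univ) := by
  have h1 := contDiffOn_comp_fst (h.smooth.smoothA.of_le (m := 1) (by norm_num))
  have h2 := contDiffOn_comp_time (n := n) (h.smooth.smoothB.of_le (m := 1) (by norm_num))
  exact (h1.add (h2.clm_apply (contDiffOn_feedback h))).prodMk (contDiffOn_adjointRHS h).neg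

lemma IsExtremal.hamField (hE : p.IsExtremal T t x X Y) (h : p.StandingHyp T) (ht : t ∈ Icc 0 T)
    {s : ℝ} (hs : s ∈ Icc t T) :
    HasDerivWithinAt (fun s => (X s, Y s)) (p.hamField s (X s, Y s)) (Icc t T) s := by
  have h2 := hE.adjoint s hs
  rw [neg_adjointRHS h ⟨ht.1.trans hs.1, hs.2⟩] at h2
  exact (hE.state s hs).prodMk h2

lemma isExtremal_of_hamField (h : p.StandingHyp T) (ht : t ∈ Icc 0 T) {e : ℝ → Vec n × Vec n}
    (he : ∀ s ∈ Icc t T, HasDerivWithinAt e (p.hamField s (e s)) (Icc t T) s)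
    (hT : (e T).2 = gradient p.G (e T).1) :
    p.IsExtremal T t (e t).1 (fun s => (e s).1) (fun s => (e s).2) where
  state s hs := (ContinuousLinearMap.fst ℝ (Vec n) (Vec n)).hasFDerivAt.comp_hasDerivWithinAt s
    (he s hs)
  adjoint s hs := by
    rw [neg_adjointRHS h ⟨ht.1.trans hs.1, hs.2⟩]
    exact (ContinuousLinearMap.snd ℝ (Vec n) (Vec n)).hasFDerivAt.comp_hasDerivWithinAt s
      (he s hs)
  initial := rfl
  terminal := hT

/-! ### A priori bounds -/

lemma exists_norm_drift_le (h : p.StandingHyp T) {K₀ : ℝ} (hK₀ : 0 < K₀) :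
    ∃ C, 0 ≤ C ∧ ∀ s ∈ Icc 0 T, ∀ x y, ‖y‖ ≤ K₀ * (1 + ‖x‖) →
      ‖p.A s x + p.B s (p.feedback s x y)‖ ≤ C * (1 + ‖x‖) := by
  obtain ⟨L, hL, hA⟩ := h.dynamics.lipA
  obtain ⟨_, _, _, _, σ, hσ, hS⟩ := h.cost.above
  have hA0 : ContinuousOn (fun s => p.A s 0) (Icc 0 T) :=
    continuousOn_slab_comp (X := fun _ => 0) h.smooth.smoothA.continuousOn subset_rfl
      continuousOn_const
  obtain ⟨a, ha⟩ := isCompact_Icc.exists_bound_of_continuousOn hA0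
  obtain ⟨b, hb⟩ := isCompact_Icc.exists_bound_of_continuousOn h.smooth.smoothB.continuousOn
  obtain ⟨r, hr⟩ := isCompact_Icc.exists_bound_of_continuousOn
    (contDiffOn_Rinv h.cost h.smooth).continuousOn
  have h0 : (0:ℝ) ∈ Icc 0 T := ⟨le_rfl, h.pos.le⟩
  have ha0 : 0 ≤ a := (norm_nonneg _).trans (ha 0 h0)
  have hb0 : 0 ≤ b := (norm_nonneg _).trans (hb 0 h0)
  have hr0 : 0 ≤ r := (norm_nonneg _).trans (hr 0 h0)
  refine ⟨L + a + b * (r * (b * K₀ + σ)), by positivity, fun s hs x y hy => ?_⟩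
  have h1 : ‖p.A s x‖ ≤ (L + a) * (1 + ‖x‖) := by
    have h2 := hA s hs x 0
    rw [sub_zero] at h2
    have h3 := norm_le_norm_add_norm_sub' (p.A s x) (p.A s 0)
    have h4 := ha s hs
    nlinarith [norm_nonneg x]
  have h2 : ‖p.feedback s x y‖ ≤ r * ((b * K₀ + σ) * (1 + ‖x‖)) := by
    rw [feedback, norm_neg]
    refine (ContinuousLinearMap.le_of_opNorm_le _ (hr s hs) _).trans ?_
    gcongr
    refine (norm_add_le _ _).trans ?_
    have h3 : ‖ContinuousLinearMap.adjoint (p.B s) y‖ ≤ b * (K₀ * (1 + ‖x‖)) := by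
      refine (ContinuousLinearMap.le_opNorm _ _).trans ?_
      rw [LinearIsometryEquiv.norm_map]
      gcongr
      exact hb s hs
    have h4 := (hS s hs x).2.2
    linarith
  have h3 : ‖p.B s (p.feedback s x y)‖ ≤ b * (r * ((b * K₀ + σ) * (1 + ‖x‖))) := by
    refine (ContinuousLinearMap.le_of_opNorm_le _ (hb s hs) _).trans ?_
    gcongr
  refine (norm_add_le _ _).trans ?_
  linarith

/-- Gronwall estimate along extremals. -/
lemma exists_one_add_norm_sq_le (h : p.StandingHyp T) {K₀ : ℝ} (hK₀ : 0 < K₀)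
    (hK : p.AdjointBound T K₀) :
    ∃ M, 1 ≤ M ∧ ∀ t ∈ Icc 0 T, ∀ x X Y, p.IsExtremal T t x X Y → ∀ r ∈ Icc t T, ∀ s ∈ Icc t T,
      1 + ‖X s‖ ^ 2 ≤ (1 + ‖X r‖ ^ 2) * M := by
  obtain ⟨C, hC, hb⟩ := exists_norm_drift_le h hK₀
  have hT := h.pos
  refine ⟨Real.exp (4 * C * T), Real.one_le_exp (by positivity), ?_⟩
  intro t ht x X Y hE r hr s hs
  refine (one_add_norm_sq_le hE.state hC (fun q hq => hb q ⟨ht.1.trans hq.1, hq.2⟩ _ _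
    (hK t ht x X Y hE q hq)) hr hs).trans ?_
  gcongr
  linarith [ht.1]

lemma norm_gradient_G_le (h : p.StandingHyp T) {K₀ : ℝ} (hK : p.AdjointBound T K₀) (z : Vec n) :
    ‖gradient p.G z‖ ≤ K₀ * (1 + ‖z‖) := by
  have hTT : T ∈ Icc 0 T := ⟨h.pos.le, le_rfl⟩
  refine hK T hTT z (fun _ => z) (fun _ => gradient p.G z) ⟨?_, ?_, rfl, rfl⟩ T ⟨le_rfl, le_rfl⟩ <;>
  · intro s hs
    rw [Icc_self] at hs ⊢
    rw [hs]
    exact HasFDerivWithinAt.of_subsingleton subsingleton_singleton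

lemma exists_extremal_bound (h : p.StandingHyp T) {K₀ : ℝ} (hK₀ : 0 < K₀)
    (hK : p.AdjointBound T K₀) (R : ℝ) :
    ∃ ρ > 0, (∀ z, ‖z‖ ≤ R → ‖(z, gradient p.G z)‖ < ρ) ∧
      ∀ t ∈ Icc 0 T, ∀ x X Y, p.IsExtremal T t x X Y → ‖X T‖ ≤ R →
        ∀ s ∈ Icc t T, ‖(X s, Y s)‖ < ρ := by
  obtain ⟨M, hM, hb⟩ := exists_one_add_norm_sq_le h hK₀ hK
  let N := (1 + R ^ 2) * M
  have hN : 0 ≤ N := by positivity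
  refine ⟨1 + N + K₀ * (1 + N), by positivity, fun z hz => ?_, fun t ht x X Y hE hXT s hs => ?_⟩
  · have h1 := norm_gradient_G_le h hK z
    have h2 : ‖z‖ ≤ N := by
      have h3 : ‖z‖ ^ 2 ≤ R ^ 2 := by gcongr
      have : 1 + ‖z‖ ^ 2 ≤ N := by
        calc 1 + ‖z‖ ^ 2 ≤ (1 + R ^ 2) * 1 := by linarith
          _ ≤ N := mul_le_mul_of_nonneg_left hM (by positivity)
      nlinarith [sq_nonneg (‖z‖ - 1)]
    rw [Prod.norm_mk, max_lt_iff]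
    have h4 : K₀ * (1 + ‖z‖) ≤ K₀ * (1 + N) := by gcongr
    have h5 : 0 ≤ K₀ * (1 + N) := by positivity
    constructor <;> linarith
  · have h1 := hb t ht x X Y hE T ⟨ht.2, le_rfl⟩ s hs
    have h2 : ‖X s‖ ≤ N := by
      have h3 : ‖X T‖ ^ 2 ≤ R ^ 2 := by gcongr
      have : (1 + ‖X T‖ ^ 2) * M ≤ N :=
        mul_le_mul_of_nonneg_right (by linarith) (by linarith)
      nlinarith [sq_nonneg (‖X s‖ - 1)]
    have h3 := hK t ht x X Y hE s hs
    rw [Prod.norm_mk, max_lt_iff]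
    have h4 : K₀ * (1 + ‖X s‖) ≤ K₀ * (1 + N) := by gcongr
    have h5 : 0 ≤ K₀ * (1 + N) := by positivity
    constructor <;> linarith

end Problem

end AQ

namespace AQ

open Filter Topology

namespace Problem

variable {n m : ℕ} {p : Problem n m} {T : ℝ} (h : p.StandingHyp T) {t : ℝ}
  {x : Vec n} {X Y : ℝ → Vec n}

/-! ### Linearization of the optimality system -/

/-- The derivative of the feedback in the direction `(ξ,η)`. -/
def feedbackDeriv (p : Problem n m) (s : ℝ) (x ξ η : Vec n) : Vec m :=
  -p.Rinv s (ContinuousLinearMap.adjoint (p.B s) η + p.Sx s x ξ)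

lemma hasFDerivAt_feedback (h : p.StandingHyp T) {s : ℝ} (hs : s ∈ Icc 0 T) (e : Vec n × Vec n) :
    HasFDerivAt (fun e : Vec n × Vec n => p.feedback s e.1 e.2)
      (-(p.Rinv s ∘L (ContinuousLinearMap.adjoint (p.B s) ∘L ContinuousLinearMap.snd ℝ _ _ +
        p.Sx s e.1 ∘L ContinuousLinearMap.fst ℝ _ _))) e := by
  have h1 : HasFDerivAt (fun e : Vec n × Vec n => ContinuousLinearMap.adjoint (p.B s) e.2)
      (ContinuousLinearMap.adjoint (p.B s) ∘L ContinuousLinearMap.snd ℝ _ _) e :=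
    (ContinuousLinearMap.adjoint (p.B s)).hasFDerivAt.comp e hasFDerivAt_snd
  have h2 : HasFDerivAt (fun e : Vec n × Vec n => p.S s e.1)
      (p.Sx s e.1 ∘L ContinuousLinearMap.fst ℝ _ _) e :=
    (hasFDerivAt_S h.smooth hs e.1).comp e hasFDerivAt_fst
  exact ((p.Rinv s).hasFDerivAt.comp e (h1.add h2)).neg

lemma hasFDerivAt_hamField (h : p.StandingHyp T) {s : ℝ} (hs : s ∈ Icc 0 T) (e : Vec n × Vec n) :
    HasFDerivAt (p.hamField s) (fderiv ℝ (p.hamField s) e) e :=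
  hasFDerivAt_slice (f := p.hamField) (contDiffOn_hamField h) hs e

lemma fderiv_hamField_fst (h : p.StandingHyp T) {s : ℝ} (hs : s ∈ Icc 0 T) (x y ξ η : Vec n) :
    (fderiv ℝ (p.hamField s) (x, y) (ξ, η)).1 =
      p.Ax s x ξ + p.B s (p.feedbackDeriv s x ξ η) := by
  have h1 := (hasFDerivAt_hamField h hs (x, y)).fst
  have h2 : HasFDerivAt (fun e : Vec n × Vec n => p.A s e.1)
      (p.Ax s x ∘L ContinuousLinearMap.fst ℝ _ _) (x, y) :=
    (hasFDerivAt_A h.smooth hs x).comp (x, y) hasFDerivAt_fst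
  have h3 := h2.add ((p.B s).hasFDerivAt.comp (x, y) (hasFDerivAt_feedback h hs (x, y)))
  have h4 := congrArg (fun L : Vec n × Vec n →L[ℝ] Vec n => L (ξ, η)) (h1.unique h3)
  exact h4

lemma inner_fderiv_hamField_snd (h : p.StandingHyp T) {s : ℝ} (hs : s ∈ Icc 0 T)
    (x y ξ η w : Vec n) :
    ⟪(fderiv ℝ (p.hamField s) (x, y) (ξ, η)).2, w⟫ =
      -(⟪η, p.Ax s x w⟫ + ⟪y, p.Axx s x ξ w⟫ + p.Qxx s x ξ w +
        ⟪p.feedbackDeriv s x ξ η, p.Sx s x w⟫ + ⟪p.feedback s x y, p.Sxx s x ξ w⟫) := by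
  have h1 := (hasFDerivAt_hamField h hs (x, y)).snd.inner ℝ (hasFDerivAt_const w (x, y))
  have a1 : HasFDerivAt (fun e : Vec n × Vec n => p.Ax s e.1)
      (p.Axx s x ∘L ContinuousLinearMap.fst ℝ _ _) (x, y) :=
    (hasFDerivAt_Ax h.pos h.smooth hs x).comp (x, y) hasFDerivAt_fst
  have a2 : HasFDerivAt (fun e : Vec n × Vec n => p.Sx s e.1)
      (p.Sxx s x ∘L ContinuousLinearMap.fst ℝ _ _) (x, y) :=
    (hasFDerivAt_Sx h.pos h.smooth hs x).comp (x, y) hasFDerivAt_fst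
  have a3 : HasFDerivAt (fun e : Vec n × Vec n => fderiv ℝ (p.Q s) e.1)
      (p.Qxx s x ∘L ContinuousLinearMap.fst ℝ _ _) (x, y) :=
    (hasFDerivAt_fderiv_Q h.pos h.smooth hs x).comp (x, y) hasFDerivAt_fst
  have b1 := a1.clm_apply (hasFDerivAt_const w (x, y))
  have b2 := a2.clm_apply (hasFDerivAt_const w (x, y))
  have b3 := a3.clm_apply (hasFDerivAt_const w (x, y))
  have c1 := (hasFDerivAt_snd (𝕜 := ℝ) (p := (x, y))).inner ℝ b1
  have c2 := (hasFDerivAt_feedback h hs (x, y)).inner ℝ b2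
  have h2 := ((c1.add b3).add c2).neg
  have h3 : (fun e : Vec n × Vec n => ⟪(p.hamField s e).2, w⟫) =
      fun e => -(⟪e.2, p.Ax s e.1 w⟫ + fderiv ℝ (p.Q s) e.1 w +
        ⟪p.feedback s e.1 e.2, p.Sx s e.1 w⟫) := by
    ext e
    change ⟪-p.adjointRHS s e.1 e.2, w⟫ = _
    rw [inner_neg_left, inner_adjointRHS]
  rw [h3] at h1
  have h4 := congrArg (fun L : Vec n × Vec n →L[ℝ] ℝ => L (ξ, η)) (h1.unique h2)
  simp [fderivInnerCLM_apply] at h4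
  rw [h4, feedbackDeriv]
  simp
  ring

/-- The running cost rate under the feedback. -/
def feedbackCost (p : Problem n m) (s : ℝ) (e : Vec n × Vec n) : ℝ :=
  p.lagrangian s e.1 (p.feedback s e.1 e.2)

lemma contDiffOn_feedbackCost (h : p.StandingHyp T) :
    ContDiffOn ℝ 1 (fun q : ℝ × (Vec n × Vec n) => p.feedbackCost q.1 q.2) (Icc 0 T ×ˢ univ) := by
  have h1 := contDiffOn_comp_fst (h.smooth.smoothQ.of_le (m := 1) (by norm_num))
  have h2 := contDiffOn_comp_fst (h.smooth.smoothS.of_le (m := 1) (by norm_num))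
  have h3 := contDiffOn_comp_time (n := n) (h.smooth.smoothR.of_le (m := 1) (by norm_num))
  have h4 := contDiffOn_feedback h
  exact (h1.add (h2.inner ℝ h4)).add (contDiffOn_const.mul ((h3.clm_apply h4).inner ℝ h4))

lemma hasFDerivAt_feedbackCost (h : p.StandingHyp T) {s : ℝ} (hs : s ∈ Icc 0 T)
    (e : Vec n × Vec n) :
    HasFDerivAt (p.feedbackCost s) (fderiv ℝ (p.feedbackCost s) e) e :=
  hasFDerivAt_slice (f := p.feedbackCost) (contDiffOn_feedbackCost h) hs e

lemma fderiv_feedbackCost (h : p.StandingHyp T) {s : ℝ} (hs : s ∈ Icc 0 T) (x y ξ η : Vec n) :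
    fderiv ℝ (p.feedbackCost s) (x, y) (ξ, η) =
      ⟪p.adjointRHS s x y, ξ⟫ - ⟪y, p.Ax s x ξ + p.B s (p.feedbackDeriv s x ξ η)⟫ := by
  have a1 : HasFDerivAt (fun e : Vec n × Vec n => p.Q s e.1)
      (fderiv ℝ (p.Q s) x ∘L ContinuousLinearMap.fst ℝ _ _) (x, y) :=
    (hasFDerivAt_Q h.smooth hs x).comp (x, y) hasFDerivAt_fst
  have a2 : HasFDerivAt (fun e : Vec n × Vec n => p.S s e.1)
      (p.Sx s x ∘L ContinuousLinearMap.fst ℝ _ _) (x, y) :=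
    (hasFDerivAt_S h.smooth hs x).comp (x, y) hasFDerivAt_fst
  have a3 := hasFDerivAt_feedback h hs (x, y)
  have a4 := (p.R s).hasFDerivAt.comp (x, y) a3
  have a5 := (a1.add (a2.inner ℝ a3)).add ((a4.inner ℝ a3).const_mul (1 / 2))
  have h4 := congrArg (fun L : Vec n × Vec n →L[ℝ] ℝ => L (ξ, η))
    ((hasFDerivAt_feedbackCost h hs (x, y)).unique a5)
  obtain ⟨υ, hυ⟩ : ∃ υ, υ = p.feedbackDeriv s x ξ η := ⟨_, rfl⟩
  have e1 : (-(p.Rinv s ∘L (ContinuousLinearMap.adjoint (p.B s) ∘L ContinuousLinearMap.snd ℝ _ _ +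
        p.Sx s x ∘L ContinuousLinearMap.fst ℝ _ _)) : Vec n × Vec n →L[ℝ] Vec m) (ξ, η) = υ := by
    rw [hυ]; rfl
  have h5 : fderiv ℝ (p.feedbackCost s) (x, y) (ξ, η) = fderiv ℝ (p.Q s) x ξ +
      (⟪p.S s x, υ⟫ + ⟪p.Sx s x ξ, p.feedback s x y⟫) +
      1 / 2 * (⟪p.R s (p.feedback s x y), υ⟫ + ⟪p.R s υ, p.feedback s x y⟫) := by
    rw [← e1]
    exact h4
  have hRf : p.R s (p.feedback s x y) = -(ContinuousLinearMap.adjoint (p.B s) y + p.S s x) := by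
    rw [feedback, map_neg, R_Rinv h.cost hs]
  have e2 : ⟪p.R s υ, p.feedback s x y⟫ = ⟪p.R s (p.feedback s x y), υ⟫ := by
    rw [inner_R_comm h.cost hs, real_inner_comm]
  have e3 : ⟪p.R s (p.feedback s x y), υ⟫ = -⟪y, p.B s υ⟫ - ⟪p.S s x, υ⟫ := by
    rw [hRf, inner_neg_left, inner_add_left, ContinuousLinearMap.adjoint_inner_left]
    ring
  rw [h5, e2, e3, ← hυ, inner_adjointRHS, inner_add_right,
    real_inner_comm (p.feedback s x y) (p.Sx s x ξ)]
  ring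

/-- `(ξ,η)` is a solution of the linearized optimality system along `(X,Y)`. -/
structure IsJacobi (p : Problem n m) (T : ℝ) (X Y ξ η : ℝ → Vec n) : Prop where
  state : ∀ s ∈ Icc 0 T, HasDerivWithinAt ξ
    (p.Ax s (X s) (ξ s) + p.B s (p.feedbackDeriv s (X s) (ξ s) (η s))) (Icc 0 T) s
  adjoint : ∀ s ∈ Icc 0 T, HasDerivWithinAt η
    (fderiv ℝ (p.hamField s) (X s, Y s) (ξ s, η s)).2 (Icc 0 T) s
  terminal : ∀ w, ⟪η T, w⟫ = p.Gxx (X T) (ξ T) w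

/-- A Jacobi field whose state component vanishes at some time vanishes at the final time. -/
lemma IsJacobi.state_terminal_eq_zero (h : p.StandingHyp T) (ht : t ∈ Icc 0 T) {K₀ α δ : ℝ}
    (hK₀ : 0 < K₀) (hK : p.AdjointBound T K₀) (hα : α ∈ Ioo (0:ℝ) 1) (hδ : 0 < δ)
    {Gbar : Vec n →L[ℝ] Vec n} {Qbar : ℝ → Vec n →L[ℝ] Vec n} (hG : p.TerminalSemiconvex Gbar)
    (hW : p.ControlWeightPositive T α δ Gbar Qbar) (hR : p.RunningSemiconvex T K₀ α Qbar)
    (hE : p.IsExtremal T t x X Y) {ξ η : ℝ → Vec n} (hJ : p.IsJacobi T X Y ξ η)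
    (hξ : ξ t = 0) : ξ T = 0 := by
  have hsub : Icc t T ⊆ Icc 0 T := Icc_subset_Icc_left ht.1
  have htt : t ∈ Icc t T := ⟨le_rfl, ht.2⟩
  have hTT : T ∈ Icc t T := ⟨ht.2, le_rfl⟩
  have hu : uIcc t T = Icc t T := uIcc_of_le ht.2
  have hXc := hE.continuousOn_state
  have hYc := hE.continuousOn_adjoint
  have hξ' : ∀ s ∈ Icc t T, HasDerivWithinAt ξ (p.Ax s (X s) (ξ s) +
      p.B s (p.feedbackDeriv s (X s) (ξ s) (η s))) (Icc t T) s := fun s hs =>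
    (hJ.state s (hsub hs)).mono hsub
  have hη' := fun s (hs : s ∈ Icc t T) => (hJ.adjoint s (hsub hs)).mono hsub
  have hξc : ContinuousOn ξ (Icc t T) := fun s hs => (hξ' s hs).continuousWithinAt
  have hηc : ContinuousOn η (Icc t T) := fun s hs => (hη' s hs).continuousWithinAt
  have hBc := h.smooth.smoothB.continuousOn.mono hsub
  have hSx := continuousOn_slab_comp (contDiffOn_Sx h.pos h.smooth).continuousOn hsub hXc
  have hAx := continuousOn_slab_comp (contDiffOn_Ax h.pos h.smooth).continuousOn hsub hXc
  have hBa : ContinuousOn (fun s => ContinuousLinearMap.adjoint (p.B s)) (Icc t T) :=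
    ContinuousLinearMap.adjoint.continuous.comp_continuousOn hBc
  have hvc : ContinuousOn (fun s => p.feedbackDeriv s (X s) (ξ s) (η s)) (Icc t T) :=
    (((contDiffOn_Rinv h.cost h.smooth).continuousOn.mono hsub).clm_apply
      ((hBa.clm_apply hηc).add (hSx.clm_apply hξc))).neg
  obtain ⟨v, hv⟩ : ∃ v : ℝ → Vec m, v = fun s => p.feedbackDeriv s (X s) (ξ s) (η s) := ⟨_, rfl⟩
  have hvs : ∀ s, v s = p.feedbackDeriv s (X s) (ξ s) (η s) := fun s => by rw [hv]
  rw [← hv] at hvc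
  have hge := secondVariation_ge h ht hK₀ hK hα hG hW hR hE hvc hξ
    (fun s hs => by rw [hvs]; exact hξ' s hs)
  have hder : ∀ s ∈ Icc t T, HasDerivWithinAt (fun s => ⟪η s, ξ s⟫)
      (-(p.Qxx s (X s) (ξ s) (ξ s) + ⟪p.feedback s (X s) (Y s), p.Sxx s (X s) (ξ s) (ξ s)⟫ +
      ⟪Y s, p.Axx s (X s) (ξ s) (ξ s)⟫ + 2 * ⟪p.Sx s (X s) (ξ s), v s⟫ + ⟪p.R s (v s), v s⟫))
      (Icc t T) s := by
    intro s hs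
    refine ((hη' s hs).inner ℝ (hξ' s hs)).congr_deriv ?_
    rw [inner_fderiv_hamField_snd h (hsub hs), ← hvs, inner_add_right]
    have e1 : ContinuousLinearMap.adjoint (p.B s) (η s) =
        -p.R s (v s) - p.Sx s (X s) (ξ s) := by
      rw [hvs, feedbackDeriv, map_neg, R_Rinv h.cost (hsub hs)]
      abel
    have e2 : ⟪η s, p.B s (v s)⟫ = -⟪p.R s (v s), v s⟫ - ⟪p.Sx s (X s) (ξ s), v s⟫ := by
      rw [← ContinuousLinearMap.adjoint_inner_left, e1, inner_sub_left, inner_neg_left]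
    rw [e2, real_inner_comm (p.Sx s (X s) (ξ s)) (v s)]
    ring
  have hsc := continuousOn_secondVariation h hsub hXc hYc hξc hvc
  have hint := integral_eq_sub_of_hasDerivWithinAt_Icc hder hsc.neg htt hTT ht.2
  rw [intervalIntegral.integral_neg, hξ, inner_zero_right, sub_zero, hJ.terminal] at hint
  have hzero : p.secondVariation T t X Y ξ v = 0 := by
    rw [secondVariation]
    linarith
  rw [hzero] at hge
  have hv2c : ContinuousOn (fun s => ‖v s‖ ^ 2) (Icc t T) := hvc.norm.pow 2
  have hle : ∫ s in t..T, ‖v s‖ ^ 2 ≤ 0 := by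
    by_contra hcon
    push Not at hcon
    have := mul_pos hδ hcon
    linarith
  have hv0 : ∀ s ∈ Icc t T, t < T → v s = 0 := by
    intro s hs htT
    by_contra hne
    have hpos : 0 < ∫ s in t..T, ‖v s‖ ^ 2 :=
      intervalIntegral.integral_pos htT hv2c (fun _ _ => sq_nonneg _)
        ⟨s, hs, by positivity⟩
    linarith
  rcases ht.2.eq_or_lt with hEq | hlt
  · rw [← hEq, hξ]
  obtain ⟨Z, W, -, hWd, -, hZW⟩ := exists_fundamental ht.2 (fun s => p.Ax s (X s)) hAx
  have hWξ : ∀ s ∈ Icc t T, HasDerivWithinAt (fun s => W s (ξ s)) 0 (Icc t T) s := by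
    intro s hs
    refine ((hWd s hs).clm_apply (hξ' s hs)).congr_deriv ?_
    rw [← hvs, hv0 s hs hlt]
    simp
  have h1 := eq_left_of_hasDerivWithinAt_zero hWξ hTT
  simp only [hξ, map_zero] at h1
  have h2 := congrArg (fun L : Vec n →L[ℝ] Vec n => L (ξ T)) (hZW T hTT)
  simp only [ContinuousLinearMap.comp_apply, h1, map_zero, ContinuousLinearMap.id_apply] at h2
  exact h2.symm

end Problem

end AQ

namespace AQ

open Filter Topology

namespace Problem

variable {n m : ℕ} {p : Problem n m} {T : ℝ} (h : p.StandingHyp T) {t : ℝ}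
  {x : Vec n} {X Y : ℝ → Vec n}

/-! ### The flow of extremals -/

/-- The Hamiltonian vector field on a neighbourhood of the time interval. -/
abbrev hamC (h : p.StandingHyp T) : C(Icc (-1) (T + 1) × (Vec n × Vec n), Vec n × Vec n) :=
  coeff h.pos _ p.hamField (contDiffOn_hamField h).continuousOn

/-- The derivative of the Hamiltonian vector field. -/
abbrev hamC' (h : p.StandingHyp T) :
    C(Icc (-1) (T + 1) × (Vec n × Vec n), Vec n × Vec n →L[ℝ] Vec n × Vec n) :=
  coeff h.pos _ (fun s => fderiv ℝ (p.hamField s))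
    (contDiffOn_fderiv_slice (k := 0) (f := p.hamField) h.pos (by norm_num)
      (contDiffOn_hamField h)).continuousOn

lemma hasFDerivAt_hamC (h : p.StandingHyp T) (s : Icc (-1) (T + 1)) (e : Vec n × Vec n) :
    HasFDerivAt (fun e => hamC h (s, e)) (hamC' h (s, e)) e :=
  hasFDerivAt_hamField h (clamp_mem h.pos (s : ℝ)) e

lemma flow_le (h : p.StandingHyp T) : (-1 : ℝ) ≤ T + 1 := by linarith [h.pos]

/-- The final time as a point of the enlarged time interval. -/
def finalTime (h : p.StandingHyp T) : Icc (-1 : ℝ) (T + 1) :=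
  ⟨T, by linarith [h.pos], by linarith⟩

/-- A bump function equal to one on the ball of radius `r`. -/
def ballBump (n : ℕ) {r : ℝ} (hr : 0 < r) : ContDiffBump (0 : Vec n × Vec n) :=
  ⟨r, r + 1, hr, by linarith⟩

/-- The Hamiltonian vector field cut off outside the ball of radius `r`. -/
abbrev cutHam (h : p.StandingHyp T) {r : ℝ} (hr : 0 < r) :
    C(Icc (-1) (T + 1) × (Vec n × Vec n), Vec n × Vec n) :=
  cutField (ballBump n hr) (hamC h)

/-- The derivative of the cut-off Hamiltonian vector field. -/
abbrev cutHam' (h : p.StandingHyp T) {r : ℝ} (hr : 0 < r) :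
    C(Icc (-1) (T + 1) × (Vec n × Vec n), Vec n × Vec n →L[ℝ] Vec n × Vec n) :=
  cutField' (ballBump n hr) (hamC h) (hamC' h)

lemma cutHam_apply {r : ℝ} (hr : 0 < r) {s : ℝ} (hs : s ∈ Icc 0 T) (hs' : s ∈ Icc (-1) (T + 1))
    {e : Vec n × Vec n} (he : ‖e‖ ≤ r) : cutHam h hr (⟨s, hs'⟩, e) = p.hamField s e := by
  have h1 : ballBump n hr e = 1 :=
    (ballBump n hr).one_of_mem_closedBall (by rw [mem_closedBall_zero_iff]; exact he)
  change ballBump n hr e • p.hamField (clamp T s) e = _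
  rw [h1, one_smul, clamp_eq hs]

lemma cutHam'_apply {r : ℝ} (hr : 0 < r) {s : ℝ} (hs : s ∈ Icc 0 T) (hs' : s ∈ Icc (-1) (T + 1))
    {e : Vec n × Vec n} (he : ‖e‖ < r) :
    cutHam' h hr (⟨s, hs'⟩, e) = fderiv ℝ (p.hamField s) e := by
  have hball : e ∈ Metric.ball (0 : Vec n × Vec n) (ballBump n hr).rIn := by
    rw [mem_ball_zero_iff]; exact he
  have h1 : ballBump n hr e = 1 :=
    (ballBump n hr).one_of_mem_closedBall (Metric.ball_subset_closedBall hball)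
  have h2 : fderiv ℝ (ballBump n hr) e = 0 := by
    rw [((ballBump n hr).eventuallyEq_one_of_mem_ball hball).fderiv_eq]
    exact fderiv_const_apply (1 : ℝ)
  change ballBump n hr e • fderiv ℝ (p.hamField (clamp T s)) e +
    (fderiv ℝ (ballBump n hr) e).smulRight (p.hamField (clamp T s) e) = _
  rw [h1, h2, one_smul, clamp_eq hs]
  ext w <;> simp

/-- The pair (state, adjoint) reaching the final state `z`, for the cut-off system. -/
def extremalFlow (h : p.StandingHyp T) {r : ℝ} (hr : 0 < r) (z : Vec n) :
    C(Icc (-1) (T + 1), Vec n × Vec n) :=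
  flowCurve (flow_le h) (finalTime h) (cutHam h hr) (z, gradient p.G z)

/-- `extremalFlow` as a curve on the real line. -/
def extremalCurve (h : p.StandingHyp T) {r : ℝ} (hr : 0 < r) (z : Vec n) (s : ℝ) : Vec n × Vec n :=
  IccExtend (flow_le h) (extremalFlow h hr z) s

lemma exists_lipschitz_cutHam {r : ℝ} (hr : 0 < r) :
    ∃ L, 0 ≤ L ∧ ∀ (s : Icc (-1) (T + 1)) (x y : Vec n × Vec n),
      ‖cutHam h hr (s, x) - cutHam h hr (s, y)‖ ≤ L * ‖x - y‖ :=
  exists_lipschitz_cutField _ (hamC h) (hamC' h) (hasFDerivAt_hamC h)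

lemma extremalCurve_final {r : ℝ} (hr : 0 < r) (z : Vec n) :
    extremalCurve h hr z T = (z, gradient p.G z) := by
  obtain ⟨L, hL, hLip⟩ := exists_lipschitz_cutHam h hr
  have hT : T ∈ Icc (-1) (T + 1) := (finalTime h).2
  rw [extremalCurve, IccExtend_of_mem _ _ hT]
  exact flowCurve_base (flow_le h) (finalTime h) (cutHam h hr) hL hLip _

lemma Icc_subset_flow (T : ℝ) : Icc 0 T ⊆ Icc (-1) (T + 1) :=
  Icc_subset_Icc (by norm_num) (by linarith)

lemma hasDerivWithinAt_extremalCurve {r : ℝ} (hr : 0 < r) (z : Vec n) {s : ℝ} (hs : s ∈ Icc 0 T)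
    (hz : ‖extremalCurve h hr z s‖ ≤ r) :
    HasDerivWithinAt (extremalCurve h hr z) (p.hamField s (extremalCurve h hr z s))
      (Icc (-1) (T + 1)) s := by
  obtain ⟨L, hL, hLip⟩ := exists_lipschitz_cutHam h hr
  have hs' := Icc_subset_flow T hs
  have h1 := hasDerivWithinAt_flowCurve (flow_le h) (finalTime h) (cutHam h hr) hL hLip
    (z, gradient p.G z) hs'
  refine h1.congr_deriv ?_
  rw [IccExtend_of_mem _ _ hs', superpose_apply]
  have h2 : flowCurve (flow_le h) (finalTime h) (cutHam h hr) (z, gradient p.G z) ⟨s, hs'⟩ =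
      extremalCurve h hr z s := by
    rw [extremalCurve, IccExtend_of_mem _ _ hs']; rfl
  rw [h2, cutHam_apply h hr hs hs' hz]

lemma continuous_extremalCurve {r : ℝ} (hr : 0 < r) (z : Vec n) :
    Continuous (extremalCurve h hr z) :=
  (extremalFlow h hr z).continuous.Icc_extend' (h := flow_le h)

/-- `r` bounds all extremals with final state in the ball of radius `R`. -/
structure IsExtremalBound (p : Problem n m) (T R r : ℝ) : Prop where
  final : ∀ z, ‖z‖ ≤ R → ‖(z, gradient p.G z)‖ < r
  extremal : ∀ t ∈ Icc 0 T, ∀ x X Y, p.IsExtremal T t x X Y → ‖X T‖ ≤ R →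
    ∀ s ∈ Icc t T, ‖(X s, Y s)‖ < r

lemma norm_extremalCurve_lt {R r : ℝ} (hr : 0 < r) (hb : p.IsExtremalBound T R r) {z : Vec n}
    (hz : ‖z‖ ≤ R) {s : ℝ} (hs : s ∈ Icc 0 T) : ‖extremalCurve h hr z s‖ < r := by
  by_contra hcon
  push Not at hcon
  have hec := continuous_extremalCurve h hr z
  have hcl : IsCompact (Icc 0 T ∩ {s | r ≤ ‖extremalCurve h hr z s‖}) :=
    isCompact_Icc.inter_right (isClosed_le continuous_const hec.norm)
  obtain ⟨q, ⟨hq, hqr⟩, hmax⟩ := hcl.exists_isMaxOn ⟨s, hs, hcon⟩ continuousOn_id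
  have hlt : ∀ s ∈ Ioc q T, ‖extremalCurve h hr z s‖ < r := by
    intro s hs
    by_contra hc
    push Not at hc
    exact absurd (hmax ⟨⟨hq.1.trans hs.1.le, hs.2⟩, hc⟩) (not_le.2 hs.1)
  have hTr : ‖extremalCurve h hr z T‖ < r := by
    rw [extremalCurve_final]; exact hb.final z hz
  have hqr' : r ≤ ‖extremalCurve h hr z q‖ := hqr
  have hqT : q < T := by
    rcases hq.2.eq_or_lt with hE | hlt
    · rw [hE] at hqr'; linarith
    · exact hlt
  have hle : ∀ s ∈ Icc q T, ‖extremalCurve h hr z s‖ ≤ r := by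
    have h1 : closure (Ioc q T) ⊆ {s | ‖extremalCurve h hr z s‖ ≤ r} :=
      closure_minimal (fun s hs => (hlt s hs).le) (isClosed_le hec.norm continuous_const)
    rw [closure_Ioc hqT.ne] at h1
    exact h1
  have hsub : Icc q T ⊆ Icc 0 T := Icc_subset_Icc_left hq.1
  have hE : p.IsExtremal T q (extremalCurve h hr z q).1 (fun s => (extremalCurve h hr z s).1)
      (fun s => (extremalCurve h hr z s).2) :=
    isExtremal_of_hamField h hq (fun s hs => (hasDerivWithinAt_extremalCurve h hr z (hsub hs)
      (hle s hs)).mono (hsub.trans (Icc_subset_flow T))) (by rw [extremalCurve_final])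
  have h2 := hb.extremal q hq _ _ _ hE (by rw [extremalCurve_final]; exact hz) q ⟨le_rfl, hq.2⟩
  exact absurd hqr' (not_le.2 h2)

lemma isExtremal_extremalCurve {R r : ℝ} (hr : 0 < r) (hb : p.IsExtremalBound T R r) {z : Vec n}
    (hz : ‖z‖ ≤ R) (ht : t ∈ Icc 0 T) :
    p.IsExtremal T t (extremalCurve h hr z t).1 (fun s => (extremalCurve h hr z s).1)
      (fun s => (extremalCurve h hr z s).2) := by
  have hsub : Icc t T ⊆ Icc 0 T := Icc_subset_Icc_left ht.1
  exact isExtremal_of_hamField h ht (fun s hs => (hasDerivWithinAt_extremalCurve h hr z (hsub hs)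
      (norm_extremalCurve_lt h hr hb hz (hsub hs)).le).mono (hsub.trans (Icc_subset_flow T)))
      (by rw [extremalCurve_final])

lemma IsExtremal.eqOn_extremalCurve {R r : ℝ} (hr : 0 < r) (hb : p.IsExtremalBound T R r)
    (ht : t ∈ Icc 0 T) (hE : p.IsExtremal T t x X Y) (hz : ‖X T‖ ≤ R) :
    EqOn (fun s => (X s, Y s)) (extremalCurve h hr (X T)) (Icc t T) := by
  have ht' : t ∈ Icc (-1) (T + 1) := Icc_subset_flow T ht
  obtain ⟨L, hL, hLip⟩ := exists_lipschitz_cutHam h hr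
  have hsub : Icc t T ⊆ Icc 0 T := Icc_subset_Icc_left ht.1
  have h1 := eqOn_flowCurve (flow_le h) (finalTime h) (cutHam h hr) hL hLip
    (Z := fun s => (X s, Y s)) ht' (fun s hs => by
      have hs1 : s ∈ Icc t T := hs
      refine (hE.hamField h ht hs1).congr_deriv ?_
      exact (cutHam_apply h hr (hsub hs1) _ (hb.extremal t ht x X Y hE hz s hs1).le).symm)
  have h2 : (X (finalTime h), Y (finalTime h)) = (X T, gradient p.G (X T)) := by
    rw [← hE.terminal]; rfl
  rw [h2] at h1
  exact h1

/-! ### Smoothness of the flow of extremals -/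

lemma contDiff_gradient_G (h : p.StandingHyp T) : ContDiff ℝ 1 (gradient p.G) := by
  have h1 : gradient p.G = fun z => adjointL (Vec n) ℝ (fderiv ℝ p.G z) 1 :=
    funext fun z => gradient_eq_adjoint _ _
  rw [h1]
  exact ((adjointL (Vec n) ℝ).contDiff.comp (contDiff_fderiv_G h.smooth)).clm_apply contDiff_const

lemma inner_fderiv_gradient_G (h : p.StandingHyp T) (z ζ w : Vec n) :
    ⟪fderiv ℝ (gradient p.G) z ζ, w⟫ = p.Gxx z ζ w := by
  have h1 := (((contDiff_gradient_G h).differentiable (by simp) z).hasFDerivAt).inner ℝ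
    (hasFDerivAt_const w z)
  have h2 := (hasFDerivAt_fderiv_G h.smooth z).clm_apply (hasFDerivAt_const w z)
  have h3 : (fun z => ⟪gradient p.G z, w⟫) = fun z => fderiv ℝ p.G z w :=
    funext fun z => inner_gradient _ _ _
  rw [h3] at h1
  have h4 := congrArg (fun L : Vec n →L[ℝ] ℝ => L ζ) (h1.unique h2)
  simpa [fderivInnerCLM_apply] using h4

lemma contDiff_extremalFlow {r : ℝ} (hr : 0 < r) : ContDiff ℝ 1 (extremalFlow h hr) := by
  obtain ⟨L, hL, hLip⟩ := exists_lipschitz_cutHam h hr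
  have h1 := contDiff_flowCurve (flow_le h) (finalTime h) (cutHam h hr) hL hLip (cutHam' h hr)
    (hasFDerivAt_cutField _ _ _ (hasFDerivAt_hamC h))
  have h2 : ContDiff ℝ 1 fun z : Vec n => (z, gradient p.G z) :=
    contDiff_id.prodMk (contDiff_gradient_G h)
  exact h1.comp h2

lemma fderiv_extremalFlow_spec {r : ℝ} (hr : 0 < r) (z ζ : Vec n) (s : Icc (-1) (T + 1)) :
    fderiv ℝ (extremalFlow h hr) z ζ s = (ζ, fderiv ℝ (gradient p.G) z ζ) + ∫ q in T..s,
      IccExtend (flow_le h) (pointwiseApply (superpose (cutHam' h hr) (extremalFlow h hr z))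
        (fderiv ℝ (extremalFlow h hr) z ζ)) q := by
  obtain ⟨L, hL, hLip⟩ := exists_lipschitz_cutHam h hr
  have hd := hasFDerivAt_cutField (ballBump n hr) (hamC h) (hamC' h) (hasFDerivAt_hamC h)
  have h1 := contDiff_flowCurve (flow_le h) (finalTime h) (cutHam h hr) hL hLip (cutHam' h hr) hd
  have h2 : HasFDerivAt (fun z : Vec n => (z, gradient p.G z))
      ((ContinuousLinearMap.id ℝ _).prod (fderiv ℝ (gradient p.G) z)) z :=
    (hasFDerivAt_id z).prodMk ((contDiff_gradient_G h).differentiable (by simp) z).hasFDerivAt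
  have h3 := (h1.differentiable (by simp) (z, gradient p.G z)).hasFDerivAt.comp z h2
  have h4 : fderiv ℝ (extremalFlow h hr) z ζ = fderiv ℝ (flowCurve (flow_le h) (finalTime h)
      (cutHam h hr)) (z, gradient p.G z) (ζ, fderiv ℝ (gradient p.G) z ζ) := by
    have h5 : fderiv ℝ (extremalFlow h hr) z = _ := h3.fderiv
    rw [h5]
    rfl
  rw [h4]
  exact fderiv_flowCurve_spec (flow_le h) (finalTime h) (cutHam h hr) hL hLip (cutHam' h hr) hd
    (z, gradient p.G z) (ζ, fderiv ℝ (gradient p.G) z ζ) s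

/-- The variation of the flow of extremals in the direction `ζ`. -/
def extremalVariation (h : p.StandingHyp T) {r : ℝ} (hr : 0 < r) (z ζ : Vec n) (s : ℝ) :
    Vec n × Vec n :=
  IccExtend (flow_le h) (fderiv ℝ (extremalFlow h hr) z ζ) s

lemma extremalVariation_final {r : ℝ} (hr : 0 < r) (z ζ : Vec n) :
    extremalVariation h hr z ζ T = (ζ, fderiv ℝ (gradient p.G) z ζ) := by
  have hT : T ∈ Icc (-1) (T + 1) := (finalTime h).2
  rw [extremalVariation, IccExtend_of_mem _ _ hT, fderiv_extremalFlow_spec]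
  simp

lemma hasDerivWithinAt_extremalVariation {R r : ℝ} (hr : 0 < r) (hb : p.IsExtremalBound T R r)
    {z : Vec n} (hz : ‖z‖ ≤ R) (ζ : Vec n) {s : ℝ} (hs : s ∈ Icc 0 T) :
    HasDerivWithinAt (extremalVariation h hr z ζ)
      (fderiv ℝ (p.hamField s) (extremalCurve h hr z s) (extremalVariation h hr z ζ s))
      (Icc 0 T) s := by
  have hs' := Icc_subset_flow T hs
  have h1 := (hasDerivWithinAt_IccExtend_of_eq (flow_le h) (fderiv_extremalFlow_spec h hr z ζ)
    hs').mono (Icc_subset_flow T)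
  refine h1.congr_deriv ?_
  rw [IccExtend_of_mem _ _ hs', pointwiseApply_apply, superpose_apply]
  have h2 : extremalFlow h hr z ⟨s, hs'⟩ = extremalCurve h hr z s := by
    rw [extremalCurve, IccExtend_of_mem _ _ hs']
  have h3 : fderiv ℝ (extremalFlow h hr) z ζ ⟨s, hs'⟩ = extremalVariation h hr z ζ s := by
    rw [extremalVariation, IccExtend_of_mem _ _ hs']
  rw [h2, h3, cutHam'_apply h hr hs hs' (norm_extremalCurve_lt h hr hb hz hs)]

lemma isJacobi_extremalVariation {R r : ℝ} (hr : 0 < r) (hb : p.IsExtremalBound T R r)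
    {z : Vec n} (hz : ‖z‖ ≤ R) (ζ : Vec n) :
    p.IsJacobi T (fun s => (extremalCurve h hr z s).1) (fun s => (extremalCurve h hr z s).2)
      (fun s => (extremalVariation h hr z ζ s).1) (fun s => (extremalVariation h hr z ζ s).2) where
  state s hs := by
    rw [← fderiv_hamField_fst h hs _ (extremalCurve h hr z s).2]
    exact (ContinuousLinearMap.fst ℝ (Vec n) (Vec n)).hasFDerivAt.comp_hasDerivWithinAt s
      (hasDerivWithinAt_extremalVariation h hr hb hz ζ hs)
  adjoint s hs := (ContinuousLinearMap.snd ℝ (Vec n) (Vec n)).hasFDerivAt.comp_hasDerivWithinAt s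
      (hasDerivWithinAt_extremalVariation h hr hb hz ζ hs)
  terminal w := by
    rw [extremalVariation_final, extremalCurve_final]
    exact inner_fderiv_gradient_G h z ζ w

lemma hasStrictFDerivAt_extremalCurve {R r : ℝ} (hr : 0 < r) (hb : p.IsExtremalBound T R r)
    {z : Vec n} (hz : ‖z‖ ≤ R) {s : ℝ} (hs : s ∈ Icc 0 T) :
    ∃ L : ℝ × Vec n →L[ℝ] Vec n × Vec n,
      HasStrictFDerivAt (fun q : ℝ × Vec n => extremalCurve h hr q.2 q.1) L (s, z) ∧
      L (1, 0) = p.hamField s (extremalCurve h hr z s) ∧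
      ∀ ζ, L (0, ζ) = extremalVariation h hr z ζ s := by
  obtain ⟨L, hL, hLip⟩ := exists_lipschitz_cutHam h hr
  have hs' := Icc_subset_flow T hs
  have hsI : s ∈ Ioo (-1) (T + 1) := ⟨by linarith [hs.1], by linarith [hs.2]⟩
  have h1 := hasStrictFDerivAt_IccExtend_eval (flow_le h) (contDiff_extremalFlow h hr)
    (D := fun z => superpose (cutHam h hr) (extremalFlow h hr z))
    ((continuous_superpose _).comp (contDiff_extremalFlow h hr).continuous)
    (fun z s hs => hasDerivWithinAt_flowCurve (flow_le h) (finalTime h) (cutHam h hr) hL hLip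
      (z, gradient p.G z) hs) hsI z
  refine ⟨_, h1, ?_, fun ζ => ?_⟩
  · have h2 : extremalFlow h hr z ⟨s, hs'⟩ = extremalCurve h hr z s := by
      rw [extremalCurve, IccExtend_of_mem _ _ hs']
    rw [ContinuousLinearMap.coprod_apply, map_zero, add_zero,
      ContinuousLinearMap.toSpanSingleton_apply, one_smul, IccExtend_of_mem _ _ hs',
      superpose_apply, h2, cutHam_apply h hr hs hs' (norm_extremalCurve_lt h hr hb hz hs).le]
  · rw [ContinuousLinearMap.coprod_apply, map_zero, zero_add]
    rfl

end Problem

end AQ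

namespace AQ

open Filter Topology

namespace Problem

variable {n m : ℕ} {p : Problem n m} {T : ℝ} (h : p.StandingHyp T) {t : ℝ}
  {x : Vec n} {X Y : ℝ → Vec n}

/-! ### The cost along the flow of extremals -/

/-- The negative running cost under the feedback. -/
abbrev negCostC (h : p.StandingHyp T) : C(Icc (-1) (T + 1) × (Vec n × Vec n), ℝ) :=
  coeff h.pos _ (fun s e => -p.feedbackCost s e) (contDiffOn_feedbackCost h).neg.continuousOn

/-- The derivative of `negCostC`. -/
abbrev negCostC' (h : p.StandingHyp T) :
    C(Icc (-1) (T + 1) × (Vec n × Vec n), Vec n × Vec n →L[ℝ] ℝ) :=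
  coeff h.pos _ (fun s e => -fderiv ℝ (p.feedbackCost s) e)
    (contDiffOn_fderiv_slice (k := 0) (f := p.feedbackCost) h.pos (by norm_num)
      (contDiffOn_feedbackCost h)).neg.continuousOn

lemma hasFDerivAt_negCostC (h : p.StandingHyp T) (s : Icc (-1) (T + 1)) (e : Vec n × Vec n) :
    HasFDerivAt (fun e => negCostC h (s, e)) (negCostC' h (s, e)) e :=
  (hasFDerivAt_feedbackCost h (clamp_mem h.pos (s : ℝ)) e).neg

/-- The cost to go along the flow of extremals. -/
def costFlow (h : p.StandingHyp T) {r : ℝ} (hr : 0 < r) (z : Vec n) : C(Icc (-1) (T + 1), ℝ) :=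
  ContinuousMap.const _ (p.G z) +
    volterra (E := ℝ) (flow_le h) (finalTime h) (superpose (negCostC h) (extremalFlow h hr z))

/-- `costFlow` as a function on the real line. -/
def costCurve (h : p.StandingHyp T) {r : ℝ} (hr : 0 < r) (z : Vec n) (s : ℝ) : ℝ :=
  IccExtend (flow_le h) (costFlow h hr z) s

lemma costFlow_spec {r : ℝ} (hr : 0 < r) (z : Vec n) (s : Icc (-1) (T + 1)) :
    costFlow h hr z s = p.G z + ∫ q in T..s,
      IccExtend (flow_le h) (superpose (negCostC h) (extremalFlow h hr z)) q := rfl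

lemma costCurve_eq {r : ℝ} (hr : 0 < r) (z : Vec n) {s : ℝ} (hs : s ∈ Icc 0 T) :
    costCurve h hr z s = (∫ q in s..T, p.feedbackCost q (extremalCurve h hr z q)) + p.G z := by
  have hs' := Icc_subset_flow T hs
  rw [costCurve, IccExtend_of_mem _ _ hs', costFlow_spec, add_comm,
    intervalIntegral.integral_symm, ← intervalIntegral.integral_neg]
  congr 1
  refine intervalIntegral.integral_congr fun q hq => ?_
  rw [uIcc_of_le hs.2] at hq
  have hq1 : q ∈ Icc 0 T := ⟨hs.1.trans hq.1, hq.2⟩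
  have hq' := Icc_subset_flow T hq1
  have e1 : extremalFlow h hr z ⟨q, hq'⟩ = extremalCurve h hr z q := by
    rw [extremalCurve, IccExtend_of_mem _ _ hq']
  simp only [IccExtend_of_mem _ _ hq', superpose_apply, coeff_apply, clamp_eq hq1, e1, neg_neg]

lemma contDiff_costFlow {r : ℝ} (hr : 0 < r) : ContDiff ℝ 1 (costFlow h hr) := by
  have h1 : ContDiff ℝ 1 fun z : Vec n => ContinuousMap.const (Icc (-1 : ℝ) (T + 1)) (p.G z) := by
    let ℓ : ℝ →L[ℝ] C(Icc (-1 : ℝ) (T + 1), ℝ) := ContinuousLinearMap.const ℝ _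
    exact ℓ.contDiff.comp (h.smooth.smoothG.of_le (by norm_num))
  have h2 := (contDiff_one_superpose (negCostC h) (negCostC' h) (hasFDerivAt_negCostC h)).comp
    (contDiff_extremalFlow h hr)
  exact h1.add ((volterra (E := ℝ) (flow_le h) (finalTime h)).contDiff.comp h2)

lemma fderiv_costFlow_spec {r : ℝ} (hr : 0 < r) (z ζ : Vec n) (s : Icc (-1) (T + 1)) :
    fderiv ℝ (costFlow h hr) z ζ s = fderiv ℝ p.G z ζ + ∫ q in T..s,
      IccExtend (flow_le h) (pointwiseApply (superpose (negCostC' h) (extremalFlow h hr z))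
        (fderiv ℝ (extremalFlow h hr) z ζ)) q := by
  let ℓ : ℝ →L[ℝ] C(Icc (-1 : ℝ) (T + 1), ℝ) := ContinuousLinearMap.const ℝ _
  have h1 : HasFDerivAt (fun z : Vec n => ContinuousMap.const (Icc (-1 : ℝ) (T + 1)) (p.G z))
      (ℓ ∘L fderiv ℝ p.G z) z := ℓ.hasFDerivAt.comp z (hasFDerivAt_G h.smooth z)
  have h2 := (hasFDerivAt_superpose (negCostC h) (negCostC' h) (hasFDerivAt_negCostC h)
    (extremalFlow h hr z)).comp z
      ((contDiff_extremalFlow h hr).differentiable (by simp) z).hasFDerivAt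
  have h3 := h1.add ((volterra (E := ℝ) (flow_le h) (finalTime h)).hasFDerivAt.comp z h2)
  have h4 : fderiv ℝ (costFlow h hr) z = _ := h3.fderiv
  rw [h4]
  rfl

lemma fderiv_costFlow_eq_inner {R r : ℝ} (hr : 0 < r) (hb : p.IsExtremalBound T R r)
    {z : Vec n} (hz : ‖z‖ ≤ R) (ζ : Vec n) {s : ℝ} (hs : s ∈ Icc 0 T) :
    IccExtend (flow_le h) (fderiv ℝ (costFlow h hr) z ζ) s =
      ⟪(extremalCurve h hr z s).2, (extremalVariation h hr z ζ s).1⟫ := by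
  have hJ := isJacobi_extremalVariation h hr hb hz ζ
  have hE := isExtremal_extremalCurve h hr hb hz (t := 0) ⟨le_rfl, h.pos.le⟩
  have hTT : T ∈ Icc 0 T := ⟨h.pos.le, le_rfl⟩
  have hder : ∀ q ∈ Icc 0 T, HasDerivWithinAt (fun q =>
      IccExtend (flow_le h) (fderiv ℝ (costFlow h hr) z ζ) q -
        ⟪(extremalCurve h hr z q).2, (extremalVariation h hr z ζ q).1⟫) 0 (Icc 0 T) q := by
    intro q hq
    have hq' := Icc_subset_flow T hq
    have h1 := (hasDerivWithinAt_IccExtend_of_eq (flow_le h) (fderiv_costFlow_spec h hr z ζ)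
      hq').mono (Icc_subset_flow T)
    have h2 : HasDerivWithinAt (fun q => (extremalCurve h hr z q).2)
        (p.hamField q (extremalCurve h hr z q)).2 (Icc 0 T) q :=
      (ContinuousLinearMap.snd ℝ (Vec n) (Vec n)).hasFDerivAt.comp_hasDerivWithinAt q
        (hE.hamField h ⟨le_rfl, h.pos.le⟩ hq)
    have h3 := h2.inner ℝ (hJ.state q hq)
    refine (h1.sub h3).congr_deriv ?_
    have e1 : extremalFlow h hr z ⟨q, hq'⟩ = extremalCurve h hr z q := by
      rw [extremalCurve, IccExtend_of_mem _ _ hq']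
    have e2 : fderiv ℝ (extremalFlow h hr) z ζ ⟨q, hq'⟩ = extremalVariation h hr z ζ q := by
      rw [extremalVariation, IccExtend_of_mem _ _ hq']
    rw [IccExtend_of_mem _ _ hq', pointwiseApply_apply, superpose_apply, coeff_apply, e1, e2]
    simp only [clamp_eq hq, neg_apply]
    have e3 := fderiv_feedbackCost h hq (extremalCurve h hr z q).1 (extremalCurve h hr z q).2
      (extremalVariation h hr z ζ q).1 (extremalVariation h hr z ζ q).2
    rw [Prod.mk.eta, Prod.mk.eta] at e3
    rw [e3]
    change _ - (⟪(extremalCurve h hr z q).2, _⟫ +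
      ⟪-p.adjointRHS q (extremalCurve h hr z q).1 (extremalCurve h hr z q).2, _⟫) = 0
    rw [inner_neg_left]
    ring
  have h1 := eq_left_of_hasDerivWithinAt_zero hder hs
  have h2 := eq_left_of_hasDerivWithinAt_zero hder hTT
  have hT' : T ∈ Icc (-1) (T + 1) := (finalTime h).2
  have h3 : IccExtend (flow_le h) (fderiv ℝ (costFlow h hr) z ζ) T -
      ⟪(extremalCurve h hr z T).2, (extremalVariation h hr z ζ T).1⟫ = 0 := by
    rw [extremalCurve_final, extremalVariation_final, IccExtend_of_mem _ _ hT',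
      fderiv_costFlow_spec, inner_gradient]
    simp
  linarith

lemma hasStrictFDerivAt_costCurve {R r : ℝ} (hr : 0 < r) (hb : p.IsExtremalBound T R r)
    {z : Vec n} (hz : ‖z‖ ≤ R) {s : ℝ} (hs : s ∈ Icc 0 T) :
    ∃ L : ℝ × Vec n →L[ℝ] ℝ,
      HasStrictFDerivAt (fun q : ℝ × Vec n => costCurve h hr q.2 q.1) L (s, z) ∧
      L (1, 0) = -p.feedbackCost s (extremalCurve h hr z s) ∧
      ∀ ζ, L (0, ζ) = ⟪(extremalCurve h hr z s).2, (extremalVariation h hr z ζ s).1⟫ := by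
  have hs' := Icc_subset_flow T hs
  have hsI : s ∈ Ioo (-1) (T + 1) := ⟨by linarith [hs.1], by linarith [hs.2]⟩
  have h1 := hasStrictFDerivAt_IccExtend_eval (flow_le h) (contDiff_costFlow h hr)
    (D := fun z => superpose (negCostC h) (extremalFlow h hr z))
    ((continuous_superpose _).comp (contDiff_extremalFlow h hr).continuous)
    (fun z s hs => hasDerivWithinAt_IccExtend_of_eq (flow_le h) (costFlow_spec h hr z) hs) hsI z
  refine ⟨_, h1, ?_, fun ζ => ?_⟩
  · have h2 : extremalFlow h hr z ⟨s, hs'⟩ = extremalCurve h hr z s := by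
      rw [extremalCurve, IccExtend_of_mem _ _ hs']
    rw [ContinuousLinearMap.coprod_apply, map_zero, add_zero,
      ContinuousLinearMap.toSpanSingleton_apply, one_smul, IccExtend_of_mem _ _ hs',
      superpose_apply, h2, coeff_apply, clamp_eq hs]
  · rw [ContinuousLinearMap.coprod_apply, map_zero, zero_add]
    exact fderiv_costFlow_eq_inner h hr hb hz ζ hs

/-! ### The field of extremals near a given extremal -/

/-- Bounds and nondegeneracy of the extremals. -/
structure RegularHyp (p : Problem n m) (T : ℝ) : Prop where
  standing : p.StandingHyp T
  bound : ∀ R, ∃ r > 0, p.IsExtremalBound T R r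
  final_bound : ∀ R, ∃ R', ∀ t ∈ Icc 0 T, ∀ x X Y, p.IsExtremal T t x X Y → ‖x‖ ≤ R → ‖X T‖ ≤ R'
  nondegenerate : ∀ t ∈ Icc 0 T, ∀ x X Y ξ η, p.IsExtremal T t x X Y → p.IsJacobi T X Y ξ η →
    ξ t = 0 → ξ T = 0

/-- The cost of a pair (state, adjoint) on `[t,T]` under the feedback. -/
def pairCost (p : Problem n m) (T t : ℝ) (X Y : ℝ → Vec n) : ℝ :=
  (∫ s in t..T, p.feedbackCost s (X s, Y s)) + p.G (X T)

/-- The differential of the value function at `(s,x)` when its gradient in `x` is `y`. -/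
def valueDeriv (p : Problem n m) (s : ℝ) (x y : Vec n) : ℝ × Vec n →L[ℝ] ℝ :=
  innerSL ℝ y ∘L ContinuousLinearMap.snd ℝ ℝ (Vec n) -
    (p.feedbackCost s (x, y) + ⟪y, p.A s x + p.B s (p.feedback s x y)⟫) •
      ContinuousLinearMap.fst ℝ ℝ (Vec n)

lemma valueDeriv_apply (p : Problem n m) (s : ℝ) (x y : Vec n) (q : ℝ × Vec n) :
    p.valueDeriv s x y q = ⟪y, q.2⟫ -
      (p.feedbackCost s (x, y) + ⟪y, p.A s x + p.B s (p.feedback s x y)⟫) * q.1 := by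
  simp [valueDeriv]

theorem exists_local_field (hH : p.RegularHyp T) (ht : t ∈ Icc 0 T)
    (hE : p.IsExtremal T t x X Y) :
    ∃ (g : ℝ × Vec n → Vec n) (W : ℝ × Vec n → ℝ), ContinuousAt g (t, x) ∧ g (t, x) = X T ∧
      (∀ᶠ q in 𝓝 (t, x), q.1 ∈ Icc 0 T → ∃ X' Y', p.IsExtremal T q.1 q.2 X' Y' ∧ X' T = g q ∧
        W q = p.pairCost T q.1 X' Y') ∧
      (∃ U ∈ 𝓝 (X T), ∀ᶠ q in 𝓝 (t, x), q.1 ∈ Icc 0 T → ∀ X' Y', p.IsExtremal T q.1 q.2 X' Y' →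
        X' T ∈ U → X' T = g q) ∧
      HasFDerivAt W (p.valueDeriv t x (Y t)) (t, x) := by
  have h := hH.standing
  obtain ⟨z, hz⟩ : ∃ z, z = X T := ⟨_, rfl⟩
  obtain ⟨R, hR⟩ : ∃ R, R = ‖z‖ + 1 := ⟨_, rfl⟩
  have hzR : ‖z‖ ≤ R := by linarith
  obtain ⟨r, hr, hb⟩ := hH.bound R
  have heq := hE.eqOn_extremalCurve h hr hb ht (by rw [← hz]; exact hzR)
  rw [← hz] at heq
  have htt : t ∈ Icc t T := ⟨le_rfl, ht.2⟩
  have hXY : extremalCurve h hr z t = (x, Y t) := by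
    rw [← heq htt]; simp only [hE.initial]
  obtain ⟨L, hL, hL1, hL2⟩ := hasStrictFDerivAt_extremalCurve h hr hb hzR ht
  obtain ⟨Lc, hLc, hLc1, hLc2⟩ := hasStrictFDerivAt_costCurve h hr hb hzR ht
  have hdecomp : ∀ (τ : ℝ) (ζ : Vec n), ((τ, ζ) : ℝ × Vec n) = τ • (1, 0) + (0, ζ) := by
    intro τ ζ; simp
  have hLv : ∀ τ ζ, (L (τ, ζ)).1 = τ • (p.A t x + p.B t (p.feedback t x (Y t))) +
      (extremalVariation h hr z ζ t).1 := by
    intro τ ζ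
    rw [hdecomp, map_add, map_smul, hL1, hL2, hXY]
    rfl
  have hLcv : ∀ τ ζ, Lc (τ, ζ) = -(τ * p.feedbackCost t (x, Y t)) +
      ⟪Y t, (extremalVariation h hr z ζ t).1⟫ := by
    intro τ ζ
    rw [hdecomp, map_add, map_smul, hLc1, hLc2, hXY]
    simp
  let F : ℝ × Vec n → ℝ × Vec n := fun q => (q.1, (extremalCurve h hr q.2 q.1).1)
  let F' : ℝ × Vec n →L[ℝ] ℝ × Vec n :=
    (ContinuousLinearMap.fst ℝ ℝ (Vec n)).prod
      (ContinuousLinearMap.fst ℝ (Vec n) (Vec n) ∘L L)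
  have hF : HasStrictFDerivAt F F' (t, z) :=
    hasStrictFDerivAt_fst.prodMk hL.fst
  have hFz : F (t, z) = (t, x) := by simp only [F, hXY]
  have hinj : Function.Injective F' := by
    rw [injective_iff_map_eq_zero]
    rintro ⟨τ, ζ⟩ h0
    have h1 : τ = 0 := congrArg Prod.fst h0
    have h2 : (L (τ, ζ)).1 = 0 := congrArg Prod.snd h0
    rw [hLv, h1, zero_smul, zero_add] at h2
    have hJ := isJacobi_extremalVariation h hr hb hzR ζ
    have hE' := isExtremal_extremalCurve h hr hb hzR ht
    have h3 := hH.nondegenerate t ht _ _ _ _ _ hE' hJ h2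
    rw [extremalVariation_final] at h3
    rw [h1, show ζ = 0 from h3]
    rfl
  obtain ⟨Φ, hΦ⟩ : ∃ Φ : (ℝ × Vec n) ≃L[ℝ] (ℝ × Vec n), (Φ : ℝ × Vec n →L[ℝ] ℝ × Vec n) = F' :=
    ⟨(LinearEquiv.ofInjectiveEndo (F' : ℝ × Vec n →ₗ[ℝ] ℝ × Vec n)
      hinj).toContinuousLinearEquiv, ContinuousLinearMap.ext fun v => rfl⟩
  rw [← hΦ] at hF
  obtain ⟨G, hG⟩ : ∃ G, G = hF.localInverse F Φ (t, z) := ⟨_, rfl⟩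
  have hG1 : HasStrictFDerivAt G (Φ.symm : ℝ × Vec n →L[ℝ] ℝ × Vec n) (t, x) := by
    rw [hG, ← hFz]; exact hF.to_localInverse
  have hG2 : ∀ᶠ q in 𝓝 (t, x), F (G q) = q := by
    rw [hG, ← hFz]; exact hF.eventually_right_inverse
  have hG3 : ∀ᶠ q in 𝓝 (t, z), G (F q) = q := by
    rw [hG]; exact hF.eventually_left_inverse
  have hG0 : G (t, x) = (t, z) := by
    have := hG3.self_of_nhds
    rwa [hFz] at this
  have hg : ContinuousAt (fun q => (G q).2) (t, x) := continuousAt_snd.comp hG1.continuousAt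
  have hgR : ∀ᶠ q in 𝓝 (t, x), ‖(G q).2‖ ≤ R := by
    have h1 : ‖(G (t, x)).2‖ < R := by rw [hG0]; simp only; linarith
    filter_upwards [hg.norm.eventually_lt_const h1] with q hq using hq.le
  refine ⟨fun q => (G q).2, fun q => costCurve h hr (G q).2 (G q).1, hg,
    by simp only [hG0]; exact hz,
    ?_, ?_, ?_⟩
  · filter_upwards [hG2, hgR] with q hq1 hq2 hq
    have e1 : (F (G q)).1 = q.1 := by rw [hq1]
    have e1 : (G q).1 = q.1 := e1
    have e2 : (extremalCurve h hr (G q).2 (G q).1).1 = q.2 :=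
      congrArg (fun z : ℝ × Vec n => z.2) hq1
    rw [e1] at e2
    have hE' := isExtremal_extremalCurve h hr hb hq2 hq
    rw [e2] at hE'
    refine ⟨_, _, hE', by rw [extremalCurve_final], ?_⟩
    rw [e1, costCurve_eq h hr _ hq, pairCost, extremalCurve_final]
  · rw [← hz]
    obtain ⟨A, hA, U, hU, hAU⟩ := mem_nhds_prod_iff.1 hG3
    have hUR : Metric.ball z 1 ∈ 𝓝 z := Metric.ball_mem_nhds z one_pos
    refine ⟨U ∩ Metric.ball z 1, inter_mem hU hUR, ?_⟩
    filter_upwards [continuous_fst.continuousAt.preimage_mem_nhds hA] with q hqA hq X' Y' hE' hX'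
    have hX'R : ‖X' T‖ ≤ R := by
      have h1 := mem_ball_iff_norm.1 hX'.2
      have h2 := norm_le_norm_add_norm_sub' (X' T) z
      linarith
    have h1 := hE'.eqOn_extremalCurve h hr hb hq hX'R ⟨le_rfl, hq.2⟩
    have h2 : F (q.1, X' T) = q := by
      simp only [F]
      rw [← h1]
      simp only [hE'.initial]
    have h3 : G (F (q.1, X' T)) = (q.1, X' T) := hAU ⟨hqA, hX'.1⟩
    rw [h2] at h3
    rw [h3]
  · have h1 : HasFDerivAt (fun q : ℝ × Vec n => costCurve h hr q.2 q.1) Lc (G (t, x)) := by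
      rw [hG0]; exact hLc.hasFDerivAt
    have h2 := h1.comp (t, x) hG1.hasFDerivAt
    refine h2.congr_fderiv ?_
    refine ContinuousLinearMap.ext fun v => ?_
    obtain ⟨w, hw⟩ : ∃ w, w = Φ.symm v := ⟨_, rfl⟩
    have h3 : F' w = v := by rw [← hΦ, hw]; exact Φ.apply_symm_apply v
    have h4 : v.1 = w.1 := by rw [← h3]; rfl
    have h5 : v.2 = w.1 • (p.A t x + p.B t (p.feedback t x (Y t))) +
        (extremalVariation h hr z w.2 t).1 := by
      rw [← hLv, ← h3]; rfl
    change Lc (Φ.symm v) = _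
    rw [← hw, valueDeriv_apply, h5, h4, inner_add_right, inner_smul_right]
    have h6 := hLcv w.1 w.2
    rw [Prod.mk.eta] at h6
    rw [h6]
    ring

end Problem

end AQ

namespace AQ

open Filter Topology

/-- A closed, bounded relation over a connected space that near each of its points is the graph of
a continuous function is the graph of a function as soon as one of its fibres is a singleton. -/
lemma existsUnique_fibre {S E : Type*} [TopologicalSpace S] [PreconnectedSpace S]
    [TopologicalSpace E] [T2Space E] {Γ : Set (S × E)} {K : Set E} (hK : IsCompact K)
    (hΓ : IsClosed Γ) (hΓK : ∀ q ∈ Γ, q.2 ∈ K)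
    (hbr : ∀ s z, (s, z) ∈ Γ → ∃ g : S → E, ContinuousAt g s ∧ g s = z ∧
      (∀ᶠ s' in 𝓝 s, (s', g s') ∈ Γ) ∧ ∃ U ∈ 𝓝 z, ∀ᶠ s' in 𝓝 s, ∀ z' ∈ U, (s', z') ∈ Γ → z' = g s')
    {s₀ : S} (h0 : ∃! z, (s₀, z) ∈ Γ) (s : S) : ∃! z, (s, z) ∈ Γ := by
  have huhc : ∀ (s : S) (U : Set E), (∀ z, (s, z) ∈ Γ → U ∈ 𝓝 z) →
      ∀ᶠ s' in 𝓝 s, ∀ z, (s', z) ∈ Γ → z ∈ U := by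
    intro s U hU
    have h1 := hK.eventually_forall_of_forall_eventually (x₀ := s)
      (P := fun s' z => (s', z) ∈ Γ → z ∈ U) (fun z _ => by
        by_cases hz : (s, z) ∈ Γ
        · filter_upwards [continuous_snd.continuousAt.preimage_mem_nhds (hU z hz)] with q hq _
          exact hq
        · filter_upwards [hΓ.isOpen_compl.mem_nhds hz] with q hq hq'
          exact absurd hq' hq)
    filter_upwards [h1] with s' hs' z hz
    exact hs' z (hΓK _ hz) hz
  have hclopen : IsClopen {s | ∃! z, (s, z) ∈ Γ} := by
    refine ⟨isClosed_iff_nhds.2 ?_, isOpen_iff_mem_nhds.2 ?_⟩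
    · intro s hs
      have hfreq : ∃ᶠ s' in 𝓝 s, ∃! z, (s', z) ∈ Γ := by
        rw [frequently_iff]
        intro V hV
        obtain ⟨s', h1, h2⟩ := hs V hV
        exact ⟨s', h1, h2⟩
      have hne : ∃ z, (s, z) ∈ Γ := by
        by_contra hcon
        push Not at hcon
        obtain ⟨s', ⟨z, hz, _⟩, h2⟩ :=
          (hfreq.and_eventually (huhc s ∅ fun z hz => absurd hz (hcon z))).exists
        exact h2 z hz
      obtain ⟨z, hz⟩ := hne
      refine ⟨z, hz, fun z' hz' => ?_⟩
      obtain ⟨g, hg, hgz, hgΓ, -⟩ := hbr s z hz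
      obtain ⟨g', hg', hgz', hgΓ', -⟩ := hbr s z' hz'
      by_contra hne
      have hne : g s ≠ g' s := by rw [hgz, hgz']; exact Ne.symm hne
      obtain ⟨s', ⟨⟨⟨w, _, hw⟩, h2⟩, h3⟩, h4⟩ :=
        (((hfreq.and_eventually hgΓ).and_eventually hgΓ').and_eventually
          ((hg.prodMk hg').eventually (isOpen_ne_fun continuous_fst continuous_snd |>.mem_nhds hne))).exists
      exact h4 ((hw _ h2).trans (hw _ h3).symm)
    · rintro s ⟨z, hz, huniq⟩
      obtain ⟨g, -, -, hgΓ, U, hU, hgU⟩ := hbr s z hz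
      filter_upwards [hgΓ, hgU, huhc s U fun z' hz' => by rwa [huniq z' hz']] with s' h1 h2 h3
      exact ⟨g s', h1, fun z' hz' => h2 z' (h3 z' hz') hz'⟩
  have h1 := hclopen.eq_univ ⟨s₀, h0⟩
  have h2 : s ∈ {s | ∃! z, (s, z) ∈ Γ} := by rw [h1]; trivial
  exact h2

namespace Problem

variable {n m : ℕ} {p : Problem n m} {T : ℝ} {t : ℝ}
  {x : Vec n} {X Y : ℝ → Vec n}

lemma isExtremal_at_final (p : Problem n m) (T : ℝ) (x : Vec n) :
    p.IsExtremal T T x (fun _ => x) (fun _ => gradient p.G x) where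
  state s hs := by
    rw [Icc_self]; exact HasFDerivWithinAt.of_subsingleton subsingleton_singleton
  adjoint s hs := by
    rw [Icc_self]; exact HasFDerivWithinAt.of_subsingleton subsingleton_singleton
  initial := rfl
  terminal := rfl

/-- `z` is the final state of an extremal issued from `(t,x)`. -/
def IsFinalState (p : Problem n m) (T t : ℝ) (x z : Vec n) : Prop :=
  ∃ X Y, p.IsExtremal T t x X Y ∧ X T = z

theorem existsUnique_finalState (hH : p.RegularHyp T) (ht : t ∈ Icc 0 T) (x : Vec n) :
    ∃! z, p.IsFinalState T t x z := by
  have h := hH.standing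
  obtain ⟨R, hR⟩ := hH.final_bound ‖x‖
  obtain ⟨r, hr, hb⟩ := hH.bound R
  have hnorm : ∀ s ∈ Icc 0 T, ∀ z, p.IsFinalState T s x z → ‖z‖ ≤ R := by
    rintro s hs z ⟨X, Y, hE, rfl⟩
    exact hR s hs x X Y hE le_rfl
  have hiff : ∀ s ∈ Icc 0 T, ∀ z, p.IsFinalState T s x z ↔
      ‖z‖ ≤ R ∧ (extremalCurve h hr z s).1 = x := by
    refine fun s hs z => ⟨fun hz => ⟨hnorm s hs z hz, ?_⟩, fun hz => ?_⟩
    · have hzR := hnorm s hs z hz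
      obtain ⟨X, Y, hE, rfl⟩ := hz
      rw [← hE.eqOn_extremalCurve h hr hb hs hzR ⟨le_rfl, hs.2⟩]
      exact hE.initial
    · have h1 := isExtremal_extremalCurve h hr hb hz.1 hs
      rw [hz.2] at h1
      exact ⟨_, _, h1, by rw [extremalCurve_final]⟩
  have : PreconnectedSpace (Icc 0 T) := isPreconnected_iff_preconnectedSpace.1 isPreconnected_Icc
  let Γ : Set (Icc 0 T × Vec n) := {q | p.IsFinalState T q.1 x q.2}
  have hΓ : IsClosed Γ := by
    have h1 : Γ = {q | ‖q.2‖ ≤ R} ∩ {q | (extremalCurve h hr q.2 q.1).1 = x} :=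
      Set.ext fun q => hiff q.1 q.1.2 q.2
    rw [h1]
    have h2 : Continuous fun q : ℝ × Vec n => extremalCurve h hr q.2 q.1 :=
      continuous_IccExtend_eval (flow_le h) (contDiff_extremalFlow h hr).continuous
    have h3 : Continuous fun q : Icc 0 T × Vec n => ((q.1 : ℝ), q.2) :=
      (continuous_subtype_val.comp continuous_fst).prodMk continuous_snd
    exact (isClosed_le continuous_snd.norm continuous_const).inter
      (isClosed_eq (continuous_fst.comp (h2.comp h3)) continuous_const)
  refine existsUnique_fibre (Γ := Γ) (isCompact_closedBall (0 : Vec n) R) hΓ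
    (fun q hq => mem_closedBall_zero_iff.2 (hnorm q.1 q.1.2 q.2 hq)) ?_
    (s₀ := ⟨T, h.pos.le, le_rfl⟩) ?_ ⟨t, ht⟩
  · rintro s z ⟨X, Y, hE, rfl⟩
    obtain ⟨g, W, hg, hgz, hgΓ, ⟨U, hU, hgU⟩, -⟩ := exists_local_field hH s.2 hE
    have hι : ContinuousAt (fun s : Icc 0 T => ((s : ℝ), x)) s :=
      (continuous_subtype_val.prodMk continuous_const).continuousAt
    refine ⟨fun s => g (s, x), hg.comp_of_eq hι rfl, hgz, ?_, U, hU, ?_⟩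
    · filter_upwards [hι.eventually hgΓ] with s' hs'
      obtain ⟨X', Y', hE', h1, -⟩ := hs' s'.2
      exact ⟨X', Y', hE', h1⟩
    · filter_upwards [hι.eventually hgU] with s' hs' z' hz' hz''
      obtain ⟨X', Y', hE', h1⟩ := hz''
      obtain rfl : X' T = z' := h1
      exact hs' s'.2 X' Y' hE' hz'
  · refine ⟨x, ⟨_, _, isExtremal_at_final p T x, rfl⟩, ?_⟩
    rintro z ⟨X, Y, hE, rfl⟩
    exact hE.initial

/-- Any two extremals issued from the same point agree. -/
lemma IsExtremal.eqOn (hH : p.RegularHyp T) (ht : t ∈ Icc 0 T) {X' Y' : ℝ → Vec n}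
    (hE : p.IsExtremal T t x X Y) (hE' : p.IsExtremal T t x X' Y') :
    EqOn (fun s => (X s, Y s)) (fun s => (X' s, Y' s)) (Icc t T) := by
  have h := hH.standing
  obtain ⟨r, hr, hb⟩ := hH.bound ‖X T‖
  have h1 : X T = X' T :=
    (existsUnique_finalState hH ht x).unique ⟨X, Y, hE, rfl⟩ ⟨X', Y', hE', rfl⟩
  have h2 := hE.eqOn_extremalCurve h hr hb ht le_rfl
  have h3 := hE'.eqOn_extremalCurve h hr hb ht (by rw [h1])
  rw [← h1] at h3
  exact h2.trans h3.symm

lemma pairCost_congr {X' Y' : ℝ → Vec n} (ht : t ∈ Icc 0 T)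
    (hXY : EqOn (fun s => (X s, Y s)) (fun s => (X' s, Y' s)) (Icc t T)) :
    p.pairCost T t X Y = p.pairCost T t X' Y' := by
  have h1 : X T = X' T := congrArg Prod.fst (hXY ⟨ht.2, le_rfl⟩)
  rw [pairCost, pairCost, h1]
  congr 1
  refine intervalIntegral.integral_congr fun s hs => ?_
  rw [uIcc_of_le ht.2] at hs
  exact congrArg (p.feedbackCost s) (hXY hs)

/-- The cost of the extremals as a function of the initial pair is differentiable. -/
theorem exists_costField (hH : p.RegularHyp T) :
    ∃ W : ℝ × Vec n → ℝ, ∀ t ∈ Icc 0 T, ∀ x, ∃ X Y, p.IsExtremal T t x X Y ∧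
      W (t, x) = p.pairCost T t X Y ∧
      HasFDerivWithinAt W (p.valueDeriv t x (Y t)) (Icc 0 T ×ˢ univ) (t, x) := by
  have hex : ∀ q : ℝ × Vec n, ∃ w : ℝ, q.1 ∈ Icc 0 T → ∀ X Y, p.IsExtremal T q.1 q.2 X Y →
      w = p.pairCost T q.1 X Y := by
    intro q
    by_cases hq : q.1 ∈ Icc 0 T
    · obtain ⟨z, ⟨X, Y, hE, -⟩, -⟩ := existsUnique_finalState hH hq q.2
      exact ⟨p.pairCost T q.1 X Y, fun _ X' Y' hE' => pairCost_congr hq (hE.eqOn hH hq hE')⟩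
    · exact ⟨0, fun hq' => absurd hq' hq⟩
  choose W hW using hex
  refine ⟨W, fun t ht x => ?_⟩
  obtain ⟨z, ⟨X, Y, hE, -⟩, -⟩ := existsUnique_finalState hH ht x
  refine ⟨X, Y, hE, hW (t, x) ht X Y hE, ?_⟩
  obtain ⟨g, W', -, -, hgW, -, hW'⟩ := exists_local_field hH ht hE
  have heq : ∀ᶠ q in 𝓝 (t, x), q.1 ∈ Icc 0 T → W q = W' q := by
    filter_upwards [hgW] with q hq hq1
    obtain ⟨X', Y', hE', -, h1⟩ := hq hq1
    rw [h1, hW q hq1 X' Y' hE']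
  refine hW'.hasFDerivWithinAt.congr_of_eventuallyEq ?_ (heq.self_of_nhds ht)
  filter_upwards [nhdsWithin_le_nhds heq, self_mem_nhdsWithin] with q hq hq1
  exact hq hq1.1

/-! ### Verification -/

lemma valueDeriv_add_lagrangian (hC : p.CostHyp T) {s : ℝ} (hs : s ∈ Icc 0 T) (x y : Vec n) (w : Vec m) :
    p.valueDeriv s x y (1, p.A s x + p.B s w) + p.lagrangian s x w =
      (1 / 2) * ⟪p.R s (w - p.feedback s x y), w - p.feedback s x y⟫ := by
  rw [valueDeriv_apply, feedbackCost]
  have hRf : p.R s (p.feedback s x y) = -(ContinuousLinearMap.adjoint (p.B s) y + p.S s x) := by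
    rw [feedback, map_neg, R_Rinv hC hs]
  have e3 : ∀ v, ⟪p.R s (p.feedback s x y), v⟫ = -⟪y, p.B s v⟫ - ⟪p.S s x, v⟫ := by
    intro v
    rw [hRf, inner_neg_left, inner_add_left, ContinuousLinearMap.adjoint_inner_left]
    ring
  have e4 : ⟪p.R s w, p.feedback s x y⟫ = ⟪p.R s (p.feedback s x y), w⟫ := by
    rw [inner_R_comm hC hs, real_inner_comm]
  simp only [lagrangian, map_sub, inner_add_right, inner_sub_left, inner_sub_right, e4, e3]
  ring

end Problem

end AQ

namespace AQ

open Filter Topology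

namespace Problem

variable {n m : ℕ} {p : Problem n m} {T : ℝ} {t : ℝ}
  {x : Vec n} {X Y : ℝ → Vec n}

/-- A field `W` of extremal costs is a lower bound of the cost of continuous controls. -/
lemma le_cost_toL2 (h : p.StandingHyp T) (ht : t ∈ Icc 0 T) {W : ℝ × Vec n → ℝ}
    (hW : ∀ t ∈ Icc 0 T, ∀ x, ∃ X Y, p.IsExtremal T t x X Y ∧
      W (t, x) = p.pairCost T t X Y ∧
      HasFDerivWithinAt W (p.valueDeriv t x (Y t)) (Icc 0 T ×ˢ univ) (t, x))
    (x : Vec n) (v : C(Icc t T, Vec m)) : W (t, x) ≤ p.cost T t x (toL2 ht.2 v) := by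
  have hsub : Icc t T ⊆ Icc 0 T := Icc_subset_Icc_left ht.1
  have htt : t ∈ Icc t T := ⟨le_rfl, ht.2⟩
  have hTT : T ∈ Icc t T := ⟨ht.2, le_rfl⟩
  obtain ⟨w, hwv⟩ : ∃ w, w = IccExtend ht.2 v := ⟨_, rfl⟩
  have hwc : ContinuousOn w (Icc t T) := by
    rw [hwv]; exact (v.continuous.Icc_extend' (h := ht.2)).continuousOn
  have huw : toL2 ht.2 v =ᵐ[volume.restrict (Icc t T)] w := by
    rw [hwv]; exact coeFn_toL2 ht.2 v
  obtain ⟨X, hXdef⟩ : ∃ X, X = IccExtend ht.2 (stateMap h ht x (toL2 ht.2 v)) := ⟨_, rfl⟩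
  have hXt : X t = x := by rw [hXdef]; exact stateMap_initial h ht _
  have hX : ∀ s ∈ Icc t T, HasDerivWithinAt X (p.A s (X s) + p.B s (w s)) (Icc t T) s := by
    intro s hs
    rw [hXdef]
    exact hasDerivWithinAt_stateMap h ht hwc huw hs
  have hXc : ContinuousOn X (Icc t T) := fun s hs => (hX s hs).continuousWithinAt
  have hlc := continuousOn_lagrangian h hsub hXc hwc
  rw [cost_eq_of_trajectory h ht _ huw (isTrajectory_of_hasDerivWithinAt h ht hwc huw hXt hX)]
  have hder : ∀ s ∈ Icc t T, ∃ d, 0 ≤ d ∧ HasDerivWithinAt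
      (fun s => W (s, X s) + ∫ r in t..s, p.lagrangian r (X r) (w r)) d (Icc t T) s := by
    intro s hs
    obtain ⟨X', Y', hE, -, hW'⟩ := hW s (hsub hs) (X s)
    have h1 : HasDerivWithinAt (fun s => (s, X s)) (1, p.A s (X s) + p.B s (w s)) (Icc t T) s :=
      (hasDerivWithinAt_id s _).prodMk (hX s hs)
    have hmaps : MapsTo (fun s => (s, X s)) (Icc t T) (Icc 0 T ×ˢ univ) :=
      fun r hr => ⟨hsub hr, trivial⟩
    have h2 := hW'.comp_hasDerivWithinAt s h1 hmaps
    have h3 := hasDerivWithinAt_of_eq_integral ht.2 hlc (z := 0)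
      (X := fun s => ∫ r in t..s, p.lagrangian r (X r) (w r)) (fun s _ => (zero_add _).symm) hs
    refine ⟨_, ?_, h2.add h3⟩
    rw [valueDeriv_add_lagrangian h.cost (hsub hs)]
    have := inner_R_nonneg h.cost (hsub hs) (w s - p.feedback s (X s) (Y' s))
    positivity
  choose! d hd0 hd using hder
  have hmono := monotoneOn_of_hasDerivWithinAt_nonneg (convex_Icc t T)
    (fun s hs => (hd s hs).continuousWithinAt)
    (fun s hs => (hd s (interior_subset hs)).mono interior_subset)
    (fun s hs => hd0 s (interior_subset hs))
  have h1 := hmono htt hTT ht.2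
  simp only [intervalIntegral.integral_same, add_zero, hXt] at h1
  obtain ⟨X', Y', hE, hWT, -⟩ := hW T (hsub hTT) (X T)
  rw [hWT, pairCost, hE.initial, intervalIntegral.integral_same, zero_add] at h1
  linarith

theorem value_eq_costField (h : p.StandingHyp T) (ht : t ∈ Icc 0 T) {W : ℝ × Vec n → ℝ}
    (hW : ∀ t ∈ Icc 0 T, ∀ x, ∃ X Y, p.IsExtremal T t x X Y ∧
      W (t, x) = p.pairCost T t X Y ∧
      HasFDerivWithinAt W (p.valueDeriv t x (Y t)) (Icc 0 T ×ˢ univ) (t, x)) (x : Vec n) :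
    p.value T t x = W (t, x) := by
  have hsub : Icc t T ⊆ Icc 0 T := Icc_subset_Icc_left ht.1
  have hle : ∀ u : Control m t T, W (t, x) ≤ p.cost T t x u := by
    intro u
    have hclosed : IsClosed {u : Control m t T | W (t, x) ≤ p.cost T t x u} :=
      isClosed_le continuous_const (contDiff_cost h ht x).continuous
    exact (denseRange_toL2 (m := m) ht.2).induction_on u hclosed fun v => le_cost_toL2 h ht hW x v
  obtain ⟨X, Y, hE, hWx, -⟩ := hW t ht x
  have hfc := continuousOn_feedback h hsub hE.continuousOn_state hE.continuousOn_adjoint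
  let v : C(Icc t T, Vec m) := ⟨_, hfc.domRestrict⟩
  have hv : toL2 ht.2 v =ᵐ[volume.restrict (Icc t T)] fun s => p.feedback s (X s) (Y s) := by
    refine (coeFn_toL2 ht.2 v).trans ?_
    filter_upwards [ae_restrict_mem measurableSet_Icc] with s hs
    rw [IccExtend_of_mem _ _ hs]
    rfl
  have heq : p.cost T t x (toL2 ht.2 v) = W (t, x) := by
    rw [cost_eq_of_trajectory h ht _ hv (isTrajectory_of_hasDerivWithinAt h ht hfc hv hE.initial
      hE.state), hWx]
    rfl
  refine le_antisymm ?_ (le_ciInf hle)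
  rw [← heq]
  exact ciInf_le ⟨W (t, x), forall_mem_range.2 hle⟩ _

theorem differentiableOn_value (hH : p.RegularHyp T) :
    DifferentiableOn ℝ (fun z : ℝ × Vec n => p.value T z.1 z.2) (Icc 0 T ×ˢ univ) := by
  obtain ⟨W, hW⟩ := exists_costField hH
  have hval : ∀ z ∈ Icc 0 T ×ˢ (univ : Set (Vec n)), p.value T z.1 z.2 = W z :=
    fun z hz => value_eq_costField hH.standing hz.1 hW z.2
  have hWd : DifferentiableOn ℝ W (Icc 0 T ×ˢ univ) := by
    rintro ⟨t, x⟩ hz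
    obtain ⟨X, Y, -, -, h1⟩ := hW t hz.1 x
    exact h1.differentiableWithinAt
  exact hWd.congr hval

lemma regularHyp (h : p.StandingHyp T) {K₀ α δ : ℝ}
    (hK₀ : 0 < K₀) (hK : p.AdjointBound T K₀) (hα : α ∈ Ioo (0:ℝ) 1) (hδ : 0 < δ)
    {Gbar : Vec n →L[ℝ] Vec n} {Qbar : ℝ → Vec n →L[ℝ] Vec n} (hG : p.TerminalSemiconvex Gbar)
    (hW : p.ControlWeightPositive T α δ Gbar Qbar) (hR : p.RunningSemiconvex T K₀ α Qbar) :
    p.RegularHyp T where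
  standing := h
  bound R := by
    obtain ⟨r, hr, h1, h2⟩ := exists_extremal_bound h hK₀ hK R
    exact ⟨r, hr, h1, h2⟩
  final_bound R := by
    obtain ⟨M, hM, hb⟩ := exists_one_add_norm_sq_le h hK₀ hK
    refine ⟨(1 + R ^ 2) * M, fun t ht x X Y hE hx => ?_⟩
    have h1 := hb t ht x X Y hE t ⟨le_rfl, ht.2⟩ T ⟨ht.2, le_rfl⟩
    rw [hE.initial] at h1
    have h2 : (1 + ‖x‖ ^ 2) * M ≤ (1 + R ^ 2) * M := by gcongr
    nlinarith [sq_nonneg (‖X T‖ - 1), norm_nonneg (X T)]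
  nondegenerate t ht x X Y ξ η hE hJ hξ :=
    hJ.state_terminal_eq_zero h ht hK₀ hK hα hδ hG hW hR hE hξ

end Problem

end AQ

end

/-- The constants of the adjoint estimate are `κ₁` (short horizon) and `κ₂` (dissipative case); the
latter depends neither on `T` nor on the initial pair. The conclusion on the Hessian and on the
value function holds with these and with any other constant `K₀` valid in the adjoint estimate. -/
theorem theorem5p7 :
    ∃ (κ₁ : ℝ → ℝ → ℝ → ℝ → ℝ → ℝ → ℝ → ℝ → ℝ) (κ₂ : ℝ → ℝ → ℝ → ℝ → ℝ → ℝ),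
      (∀ T LA LB LQ LG A₀ Q₀ g₀, 0 < κ₁ T LA LB LQ LG A₀ Q₀ g₀) ∧
      (∀ L₀ LA LB LQ LG, 0 < κ₂ L₀ LA LB LQ LG) ∧
      ∀ (n m : ℕ) (p : AQ.Problem n m) (T : ℝ), 0 < T →
        p.DynamicsHyp T → p.CostHyp T → p.SmoothHyp T →
        (∀ LA LB LQ LG A₀ Q₀, p.ShortHorizon T LA LB LQ LG A₀ Q₀ →
          p.AdjointBound T (κ₁ T LA LB LQ LG A₀ Q₀ ‖gradient p.G 0‖)) ∧
        (∀ L₀ LA LB LQ LG, p.Dissipative T L₀ LA LB LQ LG →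
          p.AdjointBound T (κ₂ L₀ LA LB LQ LG)) ∧
        ((∃ LA LB LQ LG A₀ Q₀, p.ShortHorizon T LA LB LQ LG A₀ Q₀) ∨
            (∃ L₀ LA LB LQ LG, p.Dissipative T L₀ LA LB LQ LG) →
          ∀ K₀ > 0, p.AdjointBound T K₀ →
          ∀ (Gbar : AQ.Vec n →L[ℝ] AQ.Vec n) (Qbar : ℝ → AQ.Vec n →L[ℝ] AQ.Vec n) (α δ : ℝ),
            IsSelfAdjoint Gbar → (∀ s ∈ Set.Icc 0 T, IsSelfAdjoint (Qbar s)) →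
            α ∈ Set.Ioo (0 : ℝ) 1 → 0 < δ →
            p.TerminalSemiconvex Gbar →
            p.ControlWeightPositive T α δ Gbar Qbar →
            p.RunningSemiconvex T K₀ α Qbar →
            p.HessianCoercive T δ ∧
              DifferentiableOn ℝ (fun z : ℝ × AQ.Vec n => p.value T z.1 z.2)
                (Set.Icc 0 T ×ˢ Set.univ)) := by
  refine ⟨AQ.Problem.shortHorizonConst, AQ.Problem.dissipativeConst,
    AQ.Problem.shortHorizonConst_pos, AQ.Problem.dissipativeConst_pos, ?_⟩
  intro n m p T hT hD hC hS
  have h : p.StandingHyp T := ⟨hT, hD, hC, hS⟩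
  refine ⟨fun LA LB LQ LG A₀ Q₀ hH => AQ.Problem.adjointBound_of_shortHorizon hS hT hH,
    fun L₀ LA LB LQ LG hH => AQ.Problem.adjointBound_of_dissipative hS hH, ?_⟩
  intro _ K₀ hK₀ hK Gbar Qbar α δ _ _ hα hδ hG hW hR
  exact ⟨AQ.Problem.hessianCoercive h hK₀ hK hα hG hW hR,
    AQ.Problem.differentiableOn_value (AQ.Problem.regularHyp h hK₀ hK hα hδ hG hW hR)⟩
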